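/- Let $M$ be a compact 3-manifold, possibly with boundary (for instance oriented with toroidal boundary), and fix a transverse orientation of $\partial M$, i.e. for each component of $\partial M$ one of the two normal directions, outward or inward. Let $\mathcal B\subset M$ be a cooriented branched surface, transverse to $\partial M$: a compact 2-complex with a well-defined tangent plane everywhere, locally modelled at interior points of $M$ on a plane, on three half-planes meeting along a line (two of them tangent to each other on one side, one on the other side), or on a triple point, where two such branch lines cross transversely and exactly six local sheets meet; and near $\partial M$ on the product of an interval with an arc or with the switch of a trivalent train track. We work in the PL category: $M$ is a finite simplicial complex in which the link of every simplex is a PL sphere or ball, and $\mathcal B$ is a subcomplex. The branching locus is the set of non-manifold points of $\mathcal B$; a sector is the metric closure of a component of $\mathcal B$ minus the branching locus; a complementary region is a component of $M$ cut open along $\mathcal B$. The maw vector field along the branching locus is tangent to $\mathcal B$ and points towards the one-sheeted side; along $\partial\mathcal B=\mathcal B\cap\partial M$ it points in the chosen normal direction of $\partial M$. A double corner of a sector $s$ is a corner of $\partial s$ at which the maw vector field points into $s$ along one of the two adjacent edges of $\partial s$ and out of $s$ along the other one. With $\mathrm{dc}(s)$ the number of double corners, the maw Euler characteristic is $$\chi_m(s)=\chi(s)-\tfrac12\,\mathrm{dc}(s).$$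 The maw dual graph $\Gamma(\mathcal B)$ is the oriented weighted graph with one vertex for each complementary region and, for each sector $s$, one edge of weight $\chi_m(s)$ crossing $s$ once in the direction of the coorientation, from the region behind $s$ to the region in front of $s$. Assume that the exterior of $\mathcal B$ is a union of sutured product balls $(D^2\times[0,1],\partial D^2\times[0,1])$, i.e. each complementary region $C$ is a 3-ball, and the parts $R_+(C)$ and $R_-(C)$ of its horizontal boundary, made of the sheets whose coorientation points out of $C$ and into $C$ respectively, are disks. Then $\Gamma(\mathcal B)$ is a 1-cycle: all weights $\chi_m(s)$ are integers, the boundary of the 1-chain $\sum_s\chi_m(s)\,a(s)$, where $a(s)$ is the edge crossing $s$, is zero, and at each vertex the total weight of the incoming edges is equal to the total weight of the outgoing edges. Moreover, for each complementary region $C$ such that every component of $\partial M$ meeting $C$ is oriented outward (in particular for every $C$ if $M$ is closed), both total weights at $C$ are equal to $\chi(D^2)=1$. -/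

import Mathlib

/-!
Branched surfaces are treated in the piecewise linear category: a compact 3-manifold is a finite
simplicial complex with the usual condition on links, a branched surface is a 2-dimensional
subcomplex whose vertex links are the links of the standard local models, and the surfaces and
3-manifolds obtained by cutting (sectors, complementary regions, horizontal boundary) are finite
complexes obtained by gluing simplices along faces.
-/

noncomputable section

namespace MawGraph

/-! ### PL balls and spheres (stellar equivalence) -/

/-- The full simplex with vertices `0, …, n`. -/
def fullSimplex (n : ℕ) : PreAbstractSimplicialComplex ℕ where
  faces := {s | s.Nonempty ∧ s ⊆ Finset.range (n + 1)}
  isRelLowerSet_faces := fun {_} h => ⟨h.1, fun _ hts ht => ⟨ht, hts.trans h.2⟩⟩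

/-- The boundary of the simplex with vertices `0, …, n + 1`, an `n`-sphere. -/
def simplexBoundary (n : ℕ) : PreAbstractSimplicialComplex ℕ where
  faces := {s | s.Nonempty ∧ s ⊂ Finset.range (n + 2)}
  isRelLowerSet_faces := fun {_} h => ⟨h.1, fun _ hts ht => ⟨ht, lt_of_le_of_lt hts h.2⟩⟩

/-- The stellar subdivision of `K` at the simplex `σ` with new vertex `a`: the open star of `σ`
is replaced by the cone with apex `a` over (boundary of `σ`) join (link of `σ`). -/
def stellarSubdivision (K : PreAbstractSimplicialComplex ℕ) (σ : Finset ℕ) (a : ℕ) :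
    PreAbstractSimplicialComplex ℕ where
  faces := {s | (s ∈ K.faces ∧ ¬ σ ⊆ s) ∨
    (a ∈ s ∧ s.erase a ∪ σ ∈ K.faces ∧ ¬ σ ⊆ s.erase a)}
  isRelLowerSet_faces := by
    intro s hs
    have hK : ∀ {x y : Finset ℕ}, x ∈ K.faces → y ⊆ x → y.Nonempty → y ∈ K.faces :=
      fun hx hyx hy => (K.isRelLowerSet_faces hx).2 hyx hy
    refine ⟨?_, ?_⟩
    · rcases hs with h | h
      · exact (K.isRelLowerSet_faces h.1).1
      · exact ⟨a, h.1⟩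
    · intro t hts ht
      have hta : t.erase a ⊆ s.erase a := Finset.erase_subset_erase a hts
      rcases hs with h | h
      · exact Or.inl ⟨hK h.1 hts ht, fun h' => h.2 (h'.trans hts)⟩
      · have hn : ¬ σ ⊆ t.erase a := fun h' => h.2.2 (h'.trans hta)
        by_cases hat : a ∈ t
        · refine Or.inr ⟨hat, hK h.2.1 (Finset.union_subset_union_left hta) ?_, hn⟩
          by_contra hne
          rw [Finset.not_nonempty_iff_eq_empty, Finset.union_eq_empty] at hne
          exact hn (by rw [hne.2]; exact Finset.empty_subset _)
        · rw [Finset.erase_eq_of_notMem hat] at hn hta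
          exact Or.inl ⟨hK h.2.1 (hta.trans Finset.subset_union_left) ht, hn⟩

/-- `L` is a stellar subdivision of `K` at one of its simplices, with a new vertex. -/
def StellarStep (K L : PreAbstractSimplicialComplex ℕ) : Prop :=
  ∃ σ ∈ K.faces, ∃ a : ℕ, {a} ∉ K.faces ∧ L = stellarSubdivision K σ a

/-- Stellar equivalence, i.e. PL homeomorphism, of finite complexes. -/
def StellarEquiv : PreAbstractSimplicialComplex ℕ → PreAbstractSimplicialComplex ℕ → Prop :=
  Relation.EqvGen StellarStep

/-- `K` is a PL `n`-ball. -/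
def IsPLBall {α : Type*} (n : ℕ) (K : PreAbstractSimplicialComplex α) : Prop :=
  ∃ f : α → ℕ, Function.Injective f ∧ StellarEquiv (K.map f) (fullSimplex n)

/-- `K` is a PL `n`-sphere. -/
def IsPLSphere {α : Type*} (n : ℕ) (K : PreAbstractSimplicialComplex α) : Prop :=
  ∃ f : α → ℕ, Function.Injective f ∧ StellarEquiv (K.map f) (simplexBoundary n)

/-! ### Graphs up to subdivision -/

/-- An identification of the graph `G` (without its isolated vertices) with a subdivision of the
multigraph with `n` nodes and `m` arcs, the arc `j` joining the two nodes `ends j`. -/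
structure Subdivides {V : Type*} (G : SimpleGraph V) {n m : ℕ}
    (ends : Fin m → Fin n × Fin n) where
  node : Fin n → V
  node_injective : Function.Injective node
  arc : ∀ j : Fin m, G.Walk (node (ends j).1) (node (ends j).2)
  arc_isPath : ∀ j, (arc j).IsPath
  edge_mem : ∀ e ∈ G.edgeSet, ∃! j, e ∈ (arc j).edges
  node_mem : ∀ i j, node i ∈ (arc j).support → i = (ends j).1 ∨ i = (ends j).2
  arc_disjoint : ∀ j k, j ≠ k → ∀ x ∈ (arc j).support, x ∈ (arc k).support →
    x ∈ Set.range node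

/-- A circle (as a triangle). -/
def circleModel : Fin 3 → Fin 3 × Fin 3 := ![(0, 1), (1, 2), (2, 0)]

/-- An arc. -/
def arcModel : Fin 1 → Fin 2 × Fin 2 := ![(0, 1)]

/-- The theta graph: three arcs joining two nodes. -/
def thetaModel : Fin 3 → Fin 2 × Fin 2 := ![(0, 1), (0, 1), (0, 1)]

/-- The tripod: three arcs from the centre `0` to the ends `1, 2, 3`. -/
def tripodModel : Fin 3 → Fin 4 × Fin 4 := ![(0, 1), (0, 2), (0, 3)]

/-- The link of a triple point, a complete graph on four nodes. In the plane `z = 0` with a sheet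
leaving upwards over `x ≥ 0` along the line `x = 0`, and a sheet leaving downwards over `y ≥ 0`
along the line `y = 0`, the nodes `0, 1, 2, 3` are the directions north, east, south, west; the
arcs `0, 1, 2, 3` are the quadrants of the plane between `0, 3`, between `3, 2`, between `2, 1` and
between `1, 0`; the arc `4` is the upper sheet and the arc `5` is the lower sheet. -/
def tripleModel : Fin 6 → Fin 4 × Fin 4 := ![(0, 3), (3, 2), (2, 1), (1, 0), (0, 2), (1, 3)]

/-! ### Triangulated 3-manifolds -/

/-- The link of the vertex `v`. -/
def vertexLink {V : Type*} [DecidableEq V] (K : PreAbstractSimplicialComplex V) (v : V) :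
    PreAbstractSimplicialComplex V where
  faces := {s | s.Nonempty ∧ v ∉ s ∧ insert v s ∈ K.faces}
  isRelLowerSet_faces := fun {_} h => ⟨h.1, fun _ hts ht => ⟨ht, fun hv => h.2.1 (hts hv),
    (K.isRelLowerSet_faces h.2.2).2 (Finset.insert_subset_insert v hts)
      (Finset.insert_nonempty _ _)⟩⟩

/-- The link of the edge `e` in a 3-dimensional complex, as a graph. -/
def edgeLink {V : Type*} [DecidableEq V] (K : PreAbstractSimplicialComplex V) (e : Finset V) :
    SimpleGraph V where
  Adj u w := u ≠ w ∧ u ∉ e ∧ w ∉ e ∧ insert u (insert w e) ∈ K.faces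
  symm := ⟨fun u w h => ⟨h.1.symm, h.2.2.1, h.2.1, by rw [Finset.insert_comm]; exact h.2.2.2⟩⟩
  loopless := ⟨fun _ h => h.1 rfl⟩

/-- A triangulated 3-manifold, possibly with boundary: a pure 3-dimensional complex in which the
link of every simplex is a sphere or a ball. It is compact when `V` is finite. -/
structure ThreeManifold (V : Type*) [DecidableEq V] where
  complex : PreAbstractSimplicialComplex V
  pure : ∀ σ ∈ complex.faces, ∃ τ ∈ complex.faces, τ.card = 4 ∧ σ ⊆ τ
  card_le : ∀ σ ∈ complex.faces, σ.card ≤ 4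
  triangle_link : ∀ f ∈ complex.faces, f.card = 3 →
    {τ | τ ∈ complex.faces ∧ τ.card = 4 ∧ f ⊆ τ}.ncard = 1 ∨
    {τ | τ ∈ complex.faces ∧ τ.card = 4 ∧ f ⊆ τ}.ncard = 2
  edge_link : ∀ e ∈ complex.faces, e.card = 2 →
    Nonempty (Subdivides (edgeLink complex e) circleModel) ∨
    Nonempty (Subdivides (edgeLink complex e) arcModel)
  vertex_link : ∀ v, {v} ∈ complex.faces →
    IsPLSphere 2 (vertexLink complex v) ∨ IsPLBall 2 (vertexLink complex v)

namespace ThreeManifold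

variable {V : Type*} [DecidableEq V]

/-- The tetrahedra of `M`. -/
def tets (M : ThreeManifold V) : Set (Finset V) := {τ | τ ∈ M.complex.faces ∧ τ.card = 4}

/-- `σ` lies in the boundary of `M`: it is a face of a triangle that lies in only one
tetrahedron. -/
def IsBdry (M : ThreeManifold V) (σ : Finset V) : Prop :=
  ∃ f ∈ M.complex.faces, f.card = 3 ∧ σ ⊆ f ∧ {τ | τ ∈ M.tets ∧ f ⊆ τ}.ncard = 1

/-- A transverse orientation of the boundary of `M`: each boundary component is normally oriented
either outwards or inwards. -/
structure BdryOrientation (M : ThreeManifold V) where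
  outward : V → Prop
  locally_constant : ∀ u w, M.IsBdry {u, w} → (outward u ↔ outward w)

end ThreeManifold

/-! ### Complexes glued from simplices -/

/-- A collection of simplices `top`, all of the same dimension, together with the relation `adj`
saying which of them are glued to each other along their common face. -/
structure Gluing (V : Type*) where
  top : Set (Finset V)
  adj : Finset V → Finset V → Prop

namespace Gluing

variable {V : Type*}

/-- The faces `σ` of `t` and of `t'` are identified by the gluing. -/
def SameCell (G : Gluing V) (σ : Finset V) : Finset V → Finset V → Prop :=
  Relation.EqvGen fun t t' => t ∈ G.top ∧ t' ∈ G.top ∧ σ ⊆ t ∧ σ ⊆ t' ∧ G.adj t t'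

/-- A face `σ` of a simplex `t`, as the pair `(σ, t)`. -/
def Flag (G : Gluing V) : Type _ :=
  {p : Finset V × Finset V // p.1.Nonempty ∧ p.1 ⊆ p.2 ∧ p.2 ∈ G.top}

/-- The identification of faces. -/
def flagSetoid (G : Gluing V) : Setoid G.Flag where
  r p q := p.1.1 = q.1.1 ∧ G.SameCell p.1.1 p.1.2 q.1.2
  iseqv :=
    { refl := fun _ => ⟨rfl, Relation.EqvGen.refl _⟩
      symm := fun h => ⟨h.1.symm, h.1 ▸ Relation.EqvGen.symm _ _ h.2⟩
      trans := fun h h' => ⟨h.1.trans h'.1, Relation.EqvGen.trans _ _ _ h.2 (h.1 ▸ h'.2)⟩ }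

/-- The cells of the glued complex. -/
def Cell (G : Gluing V) : Type _ := Quotient G.flagSetoid

/-- The cell given by a flag. -/
def Flag.cell {G : Gluing V} (p : G.Flag) : G.Cell := Quotient.mk G.flagSetoid p

/-- The simplex over which a cell lies. -/
def Cell.simplex {G : Gluing V} (x : G.Cell) : Finset V :=
  Quotient.lift (s := G.flagSetoid) (fun p => p.1.1) (fun _ _ h => h.1) x

/-- `x` is a face of `y`. -/
def Cell.IsFace {G : Gluing V} (x y : G.Cell) : Prop :=
  ∃ p q : G.Flag, p.cell = x ∧ q.cell = y ∧ p.1.2 = q.1.2 ∧ p.1.1 ⊆ q.1.1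

/-- The barycentric subdivision of the glued complex: its simplices are the flags of cells. -/
def barycentric (G : Gluing V) : PreAbstractSimplicialComplex G.Cell where
  faces := {s | s.Nonempty ∧ ∀ x ∈ s, ∀ y ∈ s, x.IsFace y ∨ y.IsFace x}
  isRelLowerSet_faces := fun {_} h =>
    ⟨h.1, fun _ hts ht => ⟨ht, fun x hx y hy => h.2 x (hts hx) y (hts hy)⟩⟩

instance [Finite V] (G : Gluing V) : Finite G.Flag := by
  have : Finite (Finset V) := by
    have := Fintype.ofFinite V
    infer_instance
  unfold Flag
  infer_instance

instance [Finite V] (G : Gluing V) : Finite G.Cell := by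
  unfold Cell
  infer_instance

instance [Finite V] (G : Gluing V) : Fintype G.Cell := Fintype.ofFinite _

/-- The Euler characteristic: the number of cells, with the sign `(-1) ^ dim`. -/
def eulerChar [Finite V] (G : Gluing V) : ℤ :=
  ∑ x : G.Cell, (-1) ^ (x.simplex.card + 1)

/-- The connected pieces: top-dimensional simplices up to passing through glued faces. -/
def Piece (G : Gluing V) : Type _ := Quot fun t t' : G.top => G.adj t.1 t'.1

/-- The piece of a top-dimensional simplex. -/
def piece (G : Gluing V) (t : Finset V) (ht : t ∈ G.top) : G.Piece := Quot.mk _ ⟨t, ht⟩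

/-- `t` belongs to the piece `c`. -/
def InPiece (G : Gluing V) (c : G.Piece) (t : Finset V) : Prop :=
  ∃ ht : t ∈ G.top, G.piece t ht = c

/-- A piece as a glued complex. -/
def sub (G : Gluing V) (c : G.Piece) : Gluing V := ⟨{t | G.InPiece c t}, G.adj⟩

instance [Finite V] (G : Gluing V) : Finite G.Piece := by
  have : Finite (Finset V) := by
    have := Fintype.ofFinite V
    infer_instance
  unfold Piece
  infer_instance

instance [Finite V] (G : Gluing V) : Fintype G.Piece := Fintype.ofFinite _

end Gluing

/-! ### Branched surfaces -/

section LinkGraph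

variable {V : Type*} [DecidableEq V]

/-- The link of `v` in the 2-complex with set of triangles `T`, as a graph. -/
def linkGraph (T : Set (Finset V)) (v : V) : SimpleGraph V where
  Adj u w := u ≠ w ∧ u ≠ v ∧ w ≠ v ∧ {v, u, w} ∈ T
  symm := ⟨fun u w h => ⟨h.1.symm, h.2.2.1, h.2.1, by
    rw [Finset.pair_comm w u]; exact h.2.2.2⟩⟩
  loopless := ⟨fun _ h => h.1 rfl⟩

/-- A branch edge: three sheets meet along it. -/
def IsBranchEdge (T : Set (Finset V)) (e : Finset V) : Prop :=
  e.card = 2 ∧ {t | t ∈ T ∧ e ⊆ t}.ncard = 3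

/-- `M` cut open along the 2-complex with set of triangles `T`. -/
def cutAlong (M : ThreeManifold V) (T : Set (Finset V)) : Gluing V where
  top := M.tets
  adj τ τ' := (τ ∩ τ').card = 3 ∧ τ ∩ τ' ∉ T

/-- In the link of `v` in `M`, the complement of the link of `v` in the 2-complex contains `F`
different regions, and the regions on the two sides of the arc `k` of the graph are the regions `i`
with `borders k i`. -/
def HasLocalRegions (M : ThreeManifold V) (T : Set (Finset V)) (v : V) {n m : ℕ}
    {ends : Fin m → Fin n × Fin n} (S : Subdivides (linkGraph T v) ends) (F : ℕ)
    (borders : Fin m → Fin F → Prop) : Prop :=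
  ∃ r : Fin F → Finset V, (∀ i, r i ∈ M.tets ∧ v ∈ r i) ∧
    (∀ i j, i ≠ j → ¬ (cutAlong M T).SameCell {v} (r i) (r j)) ∧
    ∀ k x y, s(x, y) ∈ (S.arc k).edges → ∀ i, borders k i →
      ∃ τ ∈ M.tets, {v, x, y} ⊆ τ ∧ (cutAlong M T).SameCell {v} τ (r i)

/-- A manifold point in the interior of `M`. -/
def IsSmoothVertex (T : Set (Finset V)) (v : V) : Prop :=
  Nonempty (Subdivides (linkGraph T v) circleModel)

/-- A point of the branching locus in the interior of `M` which is not a triple point: three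
half-disks meet along a line, any two of them bound one of the three local regions, and the
half-disk to which the maw points is the same on both halves of the line. -/
def IsBranchVertex (M : ThreeManifold V) (T : Set (Finset V)) (maw : Finset V → Finset V)
    (v : V) : Prop :=
  ∃ S : Subdivides (linkGraph T v) thetaModel,
    HasLocalRegions M T v S 3 (fun k i => i ≠ k) ∧
    maw {v, S.node 0} = {v, S.node 0, (S.arc 0).snd} ∧
    maw {v, S.node 1} = {v, S.node 1, (S.arc 0).penultimate}

/-- A triple point. The link divides the sphere into four triangles, the triangle `i` being the one
opposite to the node `i`. In the coordinates described at `tripleModel` the maw points west along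
the line `x = 0` and south along the line `y = 0`. -/
def IsTriplePoint (M : ThreeManifold V) (T : Set (Finset V)) (maw : Finset V → Finset V)
    (v : V) : Prop :=
  ∃ S : Subdivides (linkGraph T v) tripleModel,
    HasLocalRegions M T v S 4 (fun k i => i ≠ (tripleModel k).1 ∧ i ≠ (tripleModel k).2) ∧
    maw {v, S.node 0} = {v, S.node 0, (S.arc 0).snd} ∧
    maw {v, S.node 3} = {v, S.node 3, (S.arc 1).snd} ∧
    maw {v, S.node 2} = {v, S.node 2, (S.arc 1).penultimate} ∧
    maw {v, S.node 1} = {v, S.node 1, (S.arc 2).penultimate}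

end LinkGraph

/-- A branched surface in `M`, as a subcomplex with set of triangles `tri`. For a branch edge `e`,
`maw e` is the triangle on the one-sheeted side of `e`: the maw vector field (the branching
direction) along `e` points into `maw e`, and out of the two other triangles at `e`, which are
tangent to each other. In the boundary of `M`, the surface is a train track: the link of a vertex
is an arc or a tripod, properly embedded in the link of the vertex in `M`. -/
structure BranchedSurface {V : Type*} [DecidableEq V] (M : ThreeManifold V) where
  tri : Set (Finset V)
  tri_mem : ∀ t ∈ tri, t ∈ M.complex.faces ∧ t.card = 3 ∧ ¬ M.IsBdry t
  maw : Finset V → Finset V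
  maw_mem : ∀ e, IsBranchEdge tri e → maw e ∈ tri ∧ e ⊆ maw e
  interior_model : ∀ t ∈ tri, ∀ v ∈ t, ¬ M.IsBdry {v} →
    IsSmoothVertex tri v ∨ IsBranchVertex M tri maw v ∨ IsTriplePoint M tri maw v
  boundary_model : ∀ t ∈ tri, ∀ v ∈ t, M.IsBdry {v} →
    (∃ S : Subdivides (linkGraph tri v) arcModel, ∀ u ∈ (linkGraph tri v).support,
      (M.IsBdry {v, u} ↔ u = S.node 0 ∨ u = S.node 1)) ∨
    (∃ S : Subdivides (linkGraph tri v) tripodModel, ∀ u ∈ (linkGraph tri v).support,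
      (M.IsBdry {v, u} ↔ u = S.node 1 ∨ u = S.node 2 ∨ u = S.node 3))

namespace BranchedSurface

variable {V : Type*} [DecidableEq V] {M : ThreeManifold V}

/-- `B` cut open along its branching locus. -/
def sheets (B : BranchedSurface M) : Gluing V where
  top := B.tri
  adj t t' := (t ∩ t').card = 2 ∧ ¬ IsBranchEdge B.tri (t ∩ t')

/-- The sectors of `B`; the sector `s`, as a compact surface, is `B.sheets.sub s`. -/
abbrev Sector (B : BranchedSurface M) : Type _ := B.sheets.Piece

/-- `M` cut open along `B`. -/
def cut (B : BranchedSurface M) : Gluing V := cutAlong M B.tri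

/-- The complementary regions of `B`; the region `C`, as a compact 3-manifold (with cusps along
the branching locus), is `B.cut.sub C`. -/
abbrev Region (B : BranchedSurface M) : Type _ := B.cut.Piece

/-- The maw vector field points into `t` along its edge `e`, where `e` lies in the branching locus
or in the boundary of `M`. -/
def MawInward (B : BranchedSurface M) (n : M.BdryOrientation) (e t : Finset V) : Prop :=
  (IsBranchEdge B.tri e ∧ B.maw e = t) ∨ (M.IsBdry e ∧ ∀ v ∈ e, ¬ n.outward v)

/-- The maw vector field points out of `t` along its edge `e`, where `e` lies in the branching
locus or in the boundary of `M`. -/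
def MawOutward (B : BranchedSurface M) (n : M.BdryOrientation) (e t : Finset V) : Prop :=
  (IsBranchEdge B.tri e ∧ B.maw e ≠ t) ∨ (M.IsBdry e ∧ ∀ v ∈ e, n.outward v)

/-- The vertex `x` of the sector `s` is a double corner: the maw vector field points inward on one
of the two boundary edges of `s` at `x` and outward on the other one. (This happens only over
triple points and over points of the branching locus in the boundary of `M`.) -/
def IsDoubleCorner (B : BranchedSurface M) (n : M.BdryOrientation) (s : B.Sector)
    (x : (B.sheets.sub s).Cell) : Prop :=
  x.simplex.card = 1 ∧ ∃ p q : (B.sheets.sub s).Flag,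
    p.1.1.card = 2 ∧ q.1.1.card = 2 ∧ x.IsFace p.cell ∧ x.IsFace q.cell ∧
    B.MawInward n p.1.1 p.1.2 ∧ B.MawOutward n q.1.1 q.1.2

/-- The number of double corners of a sector. -/
def doubleCorners (B : BranchedSurface M) (n : M.BdryOrientation) (s : B.Sector) : ℕ :=
  {x | B.IsDoubleCorner n s x}.ncard

/-- The maw Euler characteristic of a sector. -/
def mawEulerChar [Finite V] (B : BranchedSurface M) (n : M.BdryOrientation) (s : B.Sector) : ℚ :=
  (B.sheets.sub s).eulerChar - (1 / 2) * B.doubleCorners n s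

/-- A coorientation: the coorientation of the triangle `t` points from the tetrahedron `back t` to
the tetrahedron `front t`. It is coherent across the edges at which `B` is a surface. At a branch
edge with one-sheeted side `a`, one of the other two sheets, `u`, lies above the other one, `l`:
the region above `a` is the one above `u`, the region below `a` is the one below `l`, and the region
below `u` is the one above `l`. -/
structure Coorientation (B : BranchedSurface M) where
  back : Finset V → Finset V
  front : Finset V → Finset V
  back_mem : ∀ t ∈ B.tri, back t ∈ M.tets ∧ t ⊆ back t
  front_mem : ∀ t ∈ B.tri, front t ∈ M.tets ∧ t ⊆ front t
  back_ne_front : ∀ t ∈ B.tri, back t ≠ front t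
  coherent_smooth : ∀ t ∈ B.tri, ∀ t' ∈ B.tri, B.sheets.adj t t' →
    B.cut.SameCell (t ∩ t') (back t) (back t') ∧ B.cut.SameCell (t ∩ t') (front t) (front t')
  coherent_branch : ∀ e, IsBranchEdge B.tri e → ∃ u l : Finset V,
    {t | t ∈ B.tri ∧ e ⊆ t} = {B.maw e, u, l} ∧
    B.cut.SameCell e (front (B.maw e)) (front u) ∧
    B.cut.SameCell e (back u) (front l) ∧
    B.cut.SameCell e (back l) (back (B.maw e))

theorem piece_eq_of_sameCell (B : BranchedSurface M) {σ τ τ' : Finset V}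
    (h : B.cut.SameCell σ τ τ') (hτ : τ ∈ B.cut.top) (hτ' : τ' ∈ B.cut.top) :
    B.cut.piece τ hτ = B.cut.piece τ' hτ' := by
  have key : (∃ (h1 : τ ∈ B.cut.top) (h2 : τ' ∈ B.cut.top),
      B.cut.piece τ h1 = B.cut.piece τ' h2) ∨ τ = τ' := by
    clear hτ hτ'
    induction h with
    | rel a b hab => exact Or.inl ⟨hab.1, hab.2.1, Quot.sound hab.2.2.2.2⟩
    | refl a => exact Or.inr rfl
    | symm a b _ ih =>
      rcases ih with ⟨h1, h2, h3⟩ | h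
      · exact Or.inl ⟨h2, h1, h3.symm⟩
      · exact Or.inr h.symm
    | trans a b c _ _ ih ih' =>
      rcases ih with ⟨h1, h2, h3⟩ | rfl
      · rcases ih' with ⟨k1, k2, k3⟩ | rfl
        · exact Or.inl ⟨h1, k2, h3.trans k3⟩
        · exact Or.inl ⟨h1, h2, h3⟩
      · exact ih'
  rcases key with ⟨_, _, h3⟩ | rfl
  · exact h3
  · rfl

end BranchedSurface

/-! ### The exterior and the maw dual graph -/

/-- A finite oriented graph with rational weights on its edges. -/
structure WeightedGraph (Vertex Edge : Type*) where
  source : Edge → Vertex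
  target : Edge → Vertex
  weight : Edge → ℚ

namespace WeightedGraph

variable {Vertex Edge : Type*} [Fintype Edge]

open Classical in
/-- The total weight of the edges pointing into `v`. -/
def incoming (Γ : WeightedGraph Vertex Edge) (v : Vertex) : ℚ :=
  ∑ e : Edge with Γ.target e = v, Γ.weight e

open Classical in
/-- The total weight of the edges pointing out of `v`. -/
def outgoing (Γ : WeightedGraph Vertex Edge) (v : Vertex) : ℚ :=
  ∑ e : Edge with Γ.source e = v, Γ.weight e

/-- The boundary of the 1-chain given by the weighted edges. -/
def boundary (Γ : WeightedGraph Vertex Edge) : Vertex →₀ ℚ :=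
  ∑ e : Edge, Γ.weight e •
    (Finsupp.single (Γ.target e) (1 : ℚ) - Finsupp.single (Γ.source e) (1 : ℚ))

/-- The weighted graph is a 1-cycle with integer coefficients. -/
def IsCycle (Γ : WeightedGraph Vertex Edge) : Prop :=
  (∀ e : Edge, ∃ k : ℤ, Γ.weight e = k) ∧ Γ.boundary = 0

end WeightedGraph

namespace BranchedSurface.Coorientation

variable {V : Type*} [DecidableEq V] {M : ThreeManifold V} {B : BranchedSurface M}

/-- The part `R₊` of the horizontal boundary of the region `C`: the sheets of `B` whose
coorientation points out of `C`, glued along an edge when they are adjacent there to the same local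
region of the complement. (The two sheets forming a cusp of `C` lie one in `R₊` and one in `R₋`,
and are not glued to each other: the vertical boundary lies in between.) -/
def plusBoundary (o : B.Coorientation) (C : B.Region) : Gluing V where
  top := {t | t ∈ B.tri ∧ B.cut.InPiece C (o.back t)}
  adj t t' := (t ∩ t').card = 2 ∧ B.cut.SameCell (t ∩ t') (o.back t) (o.back t')

/-- The part `R₋` of the horizontal boundary of the region `C`: the sheets of `B` whose
coorientation points into `C`. -/
def minusBoundary (o : B.Coorientation) (C : B.Region) : Gluing V where
  top := {t | t ∈ B.tri ∧ B.cut.InPiece C (o.front t)}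
  adj t t' := (t ∩ t').card = 2 ∧ B.cut.SameCell (t ∩ t') (o.front t) (o.front t')

/-- The region `C` is a sutured product ball `(D × [0,1], ∂D × [0,1])`, `D` a disk: it is a ball,
and `R₊` and `R₋` are disks. (The set of sutures, consisting of the cusps of `C`, thickened to the
vertical boundary, and of the part of `C` in the boundary of `M`, is the complement in the sphere
`∂C` of the two disks, an annulus.) -/
def IsProductBall (o : B.Coorientation) (C : B.Region) : Prop :=
  IsPLBall 3 (B.cut.sub C).barycentric ∧
  IsPLBall 2 (o.plusBoundary C).barycentric ∧
  IsPLBall 2 (o.minusBoundary C).barycentric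

/-- The region behind a sector. -/
def backRegion (o : B.Coorientation) : B.Sector → B.Region :=
  Quot.lift (fun t => B.cut.piece (o.back t.1) (o.back_mem t.1 t.2).1) fun t t' h =>
    B.piece_eq_of_sameCell (o.coherent_smooth t.1 t.2 t'.1 t'.2 h).1 _ _

/-- The region in front of a sector. -/
def frontRegion (o : B.Coorientation) : B.Sector → B.Region :=
  Quot.lift (fun t => B.cut.piece (o.front t.1) (o.front_mem t.1 t.2).1) fun t t' h =>
    B.piece_eq_of_sameCell (o.coherent_smooth t.1 t.2 t'.1 t'.2 h).2 _ _

/-- The maw dual graph: a vertex for every complementary region, and for every sector an edge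
crossing it in the direction of the coorientation, weighted by the maw Euler characteristic. -/
def mawDualGraph [Finite V] (o : B.Coorientation) (n : M.BdryOrientation) :
    WeightedGraph B.Region B.Sector where
  source := o.backRegion
  target := o.frontRegion
  weight := B.mawEulerChar n

end BranchedSurface.Coorientation

end MawGraph

end

noncomputable section

namespace MawGraph

/-! ### Euler characteristic of PL balls -/

/-- The complex `K` is finite and has Euler characteristic `k`. -/
def HasEulerChar {α : Type*} (K : PreAbstractSimplicialComplex α) (k : ℤ) : Prop :=
  ∃ S : Finset (Finset α), (∀ s, s ∈ S ↔ s ∈ K.faces) ∧ ∑ s ∈ S, (-1 : ℤ) ^ (s.card + 1) = k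

theorem HasEulerChar.unique {α : Type*} {K : PreAbstractSimplicialComplex α} {k k' : ℤ}
    (h : HasEulerChar K k) (h' : HasEulerChar K k') : k = k' := by
  obtain ⟨S, hS, rfl⟩ := h
  obtain ⟨S', hS', rfl⟩ := h'
  have : S = S' := Finset.ext fun s => (hS s).trans (hS' s).symm
  rw [this]

theorem sum_nonempty_powerset_sign {α : Type*} [DecidableEq α] (σ : Finset α) (hσ : σ.Nonempty) :
    ∑ s ∈ σ.powerset with s.Nonempty, (-1 : ℤ) ^ (s.card + 1) = 1 := by
  have h := Finset.sum_powerset_neg_one_pow_card_of_nonempty hσ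
  have h2 : σ.powerset = insert ∅ (σ.powerset.filter (·.Nonempty)) := by
    ext s
    rcases s.eq_empty_or_nonempty with rfl | hs
    · simp
    · simp [hs, hs.ne_empty]
  rw [h2, Finset.sum_insert (by simp)] at h
  simp only [pow_succ, mul_neg, mul_one, Finset.sum_neg_distrib]
  simp at h
  linarith

theorem hasEulerChar_fullSimplex (n : ℕ) : HasEulerChar (fullSimplex n) 1 :=
  ⟨(Finset.range (n + 1)).powerset.filter (·.Nonempty),
    fun s => by simp [fullSimplex, and_comm],
    sum_nonempty_powerset_sign _ (by simp)⟩

theorem HasEulerChar.map {α β : Type*} [DecidableEq β] {K : PreAbstractSimplicialComplex α} {k : ℤ}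
    (h : HasEulerChar K k) {f : α → β} (hf : Function.Injective f) :
    HasEulerChar (K.map f) k := by
  obtain ⟨S, hS, rfl⟩ := h
  refine ⟨S.image (fun s => s.image f), fun s => ?_, ?_⟩
  · simp [PreAbstractSimplicialComplex.map, hS]
  · rw [Finset.sum_image (fun _ _ _ _ h => Finset.image_injective hf h)]
    simp [Finset.card_image_of_injective _ hf]

theorem finite_of_stellarSubdivision {K : PreAbstractSimplicialComplex ℕ} {σ : Finset ℕ} {a : ℕ}
    (hσ : σ ∈ K.faces) (ha : {a} ∉ K.faces) (hL : (stellarSubdivision K σ a).faces.Finite) :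
    K.faces.Finite := by
  obtain ⟨w, hw⟩ := (K.isRelLowerSet_faces hσ).1
  refine (hL.union (hL.image fun r => insert w (r.erase a))).subset fun s hs => ?_
  have has : a ∉ s := fun h => ha ((K.isRelLowerSet_faces hs).2
    (Finset.singleton_subset_iff.2 h) (by simp))
  by_cases h : σ ⊆ s
  · refine Or.inr ⟨insert a (s.erase w), Or.inr ?_, ?_⟩
    · have h1 : (insert a (s.erase w)).erase a = s.erase w :=
        Finset.erase_insert fun h => has (Finset.mem_of_mem_erase h)
      refine ⟨by simp, ?_, ?_⟩
      · rw [h1]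
        convert hs
        ext x
        have := @h x
        by_cases hx : x = w
        · subst hx; simp [hw, h hw]
        · simp only [Finset.mem_union, Finset.mem_erase]; tauto
      · rw [h1]
        exact fun h' => by simpa using h' hw
    · dsimp only
      rw [Finset.erase_insert fun h => has (Finset.mem_of_mem_erase h),
        Finset.insert_erase (h hw)]
  · exact Or.inl (Or.inl ⟨hs, h⟩)

theorem sum_ssubset_sign {α : Type*} [DecidableEq α] {σ τ : Finset α} (hσ : σ.Nonempty)
    (h : σ ⊆ τ) :
    ∑ r ∈ τ.powerset with r ∪ σ = τ ∧ ¬ σ ⊆ r, (-1 : ℤ) ^ r.card = (-1) ^ (τ.card + 1) := by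
  have h1 : ∑ r ∈ τ.powerset with r ∪ σ = τ ∧ ¬ σ ⊆ r, (-1 : ℤ) ^ r.card =
      ∑ ρ ∈ σ.powerset.erase σ, (-1 : ℤ) ^ ((τ \ σ).card + ρ.card) := by
    refine Finset.sum_bij' (fun r _ => r ∩ σ) (fun ρ _ => (τ \ σ) ∪ ρ) ?_ ?_ ?_ ?_ ?_
    · intro r hr
      simp only [Finset.mem_filter, Finset.mem_powerset] at hr
      simp only [Finset.mem_erase, Finset.mem_powerset, Finset.inter_subset_right, and_true]
      exact fun h => hr.2.2 (Finset.inter_eq_right.1 h)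
    · intro ρ hρ
      simp only [Finset.mem_erase, Finset.mem_powerset] at hρ
      simp only [Finset.mem_filter, Finset.mem_powerset]
      refine ⟨Finset.union_subset Finset.sdiff_subset (hρ.2.trans h), ?_, fun h' => hρ.1 ?_⟩
      · rw [Finset.union_assoc, Finset.union_eq_right.2 hρ.2, Finset.sdiff_union_of_subset h]
      · refine hρ.2.antisymm fun x hx => ?_
        have := h' hx
        simp only [Finset.mem_union, Finset.mem_sdiff] at this
        tauto
    · intro r hr
      simp only [Finset.mem_filter, Finset.mem_powerset] at hr
      ext x
      have h2 := hr.1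
      have h3 := Finset.ext_iff.1 hr.2.1 x
      have := @h2 x
      simp only [Finset.mem_union, Finset.mem_sdiff, Finset.mem_inter] at *
      tauto
    · intro ρ hρ
      simp only [Finset.mem_erase, Finset.mem_powerset] at hρ
      ext x
      have := @hρ.2 x
      simp only [Finset.mem_union, Finset.mem_sdiff, Finset.mem_inter] at *
      tauto
    · intro r hr
      simp only [Finset.mem_filter, Finset.mem_powerset] at hr
      congr 1
      rw [← hr.2.1, Finset.union_sdiff_right, add_comm, Finset.card_inter_add_card_sdiff]
  have h2 := Finset.sum_powerset_neg_one_pow_card_of_nonempty hσ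
  rw [← Finset.sum_erase_add _ _ (Finset.mem_powerset_self σ)] at h2
  rw [h1]
  simp only [pow_add, ← Finset.mul_sum]
  rw [eq_neg_of_add_eq_zero_left h2, pow_one, mul_neg, mul_neg, mul_one, ← pow_add,
    Finset.card_sdiff_add_card_eq_card h]

theorem HasEulerChar.stellarSubdivision {K : PreAbstractSimplicialComplex ℕ} {σ : Finset ℕ} {a : ℕ}
    {k : ℤ} (hσ : σ ∈ K.faces) (ha : {a} ∉ K.faces) (h : HasEulerChar K k) :
    HasEulerChar (stellarSubdivision K σ a) k := by
  obtain ⟨S, hS, rfl⟩ := h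
  have hne := (K.isRelLowerSet_faces hσ).1
  have haS : ∀ s ∈ S, a ∉ s := fun s hs h => ha ((K.isRelLowerSet_faces ((hS s).1 hs)).2
    (Finset.singleton_subset_iff.2 h) (by simp))
  set R : Finset (Finset ℕ) := (S.biUnion Finset.powerset).filter
    (fun r => r ∪ σ ∈ S ∧ ¬ σ ⊆ r) with hR
  have memR : ∀ r, r ∈ R ↔ r ∪ σ ∈ S ∧ ¬ σ ⊆ r := by
    intro r
    simp only [hR, Finset.mem_filter, Finset.mem_biUnion, Finset.mem_powerset,
      and_iff_right_iff_imp]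
    exact fun h => ⟨_, h.1, Finset.subset_union_left⟩
  have haR : ∀ r ∈ R, a ∉ r := fun r hr h =>
    haS _ ((memR r).1 hr).1 (Finset.mem_union_left _ h)
  refine ⟨S.filter (fun s => ¬ σ ⊆ s) ∪ R.image (insert a), fun s => ?_, ?_⟩
  · simp only [Finset.mem_union, Finset.mem_filter, Finset.mem_image, memR,
      MawGraph.stellarSubdivision, Set.mem_ofPred_eq, ← hS]
    refine or_congr Iff.rfl ⟨?_, fun h => ⟨s.erase a, ⟨h.2.1, h.2.2⟩, Finset.insert_erase h.1⟩⟩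
    rintro ⟨r, hr, rfl⟩
    have := haR r ((memR r).2 hr)
    rw [Finset.erase_insert this]
    exact ⟨by simp, hr⟩
  · rw [Finset.sum_union, ← Finset.sum_filter_not_add_sum_filter S (fun s => σ ⊆ s)]
    · congr 1
      rw [Finset.sum_image]
      · rw [← Finset.sum_fiberwise_of_maps_to (s := R) (t := S.filter (fun s => σ ⊆ s))
          (g := fun r => r ∪ σ)]
        · refine Finset.sum_congr rfl fun τ hτ => ?_
          simp only [Finset.mem_filter] at hτ
          rw [← sum_ssubset_sign hne hτ.2]
          refine Finset.sum_congr ?_ fun r hr => ?_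
          · ext r
            simp only [Finset.mem_filter, memR, Finset.mem_powerset]
            constructor
            · rintro ⟨⟨h1, h2⟩, rfl⟩
              exact ⟨Finset.subset_union_left, rfl, h2⟩
            · rintro ⟨_, rfl, h2⟩
              exact ⟨⟨hτ.1, h2⟩, rfl⟩
          · simp only [Finset.mem_filter, Finset.mem_powerset] at hr
            rw [Finset.card_insert_of_notMem fun h => haS τ hτ.1 (hr.1 h)]
            ring
        · intro r hr
          simp [((memR r).1 hr).1]
      · intro r hr r' hr' h
        rw [← Finset.erase_insert (haR r hr), ← Finset.erase_insert (haR r' hr'), h]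
    · rw [Finset.disjoint_left]
      intro s hs hs'
      simp only [Finset.mem_filter, Finset.mem_image] at hs hs'
      obtain ⟨r, _, rfl⟩ := hs'
      exact haS _ hs.1 (by simp)

theorem StellarEquiv.hasEulerChar_iff {K L : PreAbstractSimplicialComplex ℕ}
    (h : StellarEquiv K L) (k : ℤ) : HasEulerChar K k ↔ HasEulerChar L k := by
  induction h with
  | rel K L h =>
    obtain ⟨σ, hσ, a, ha, rfl⟩ := h
    refine ⟨fun h => h.stellarSubdivision hσ ha, fun h => ?_⟩
    have hK : K.faces.Finite := finite_of_stellarSubdivision hσ ha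
      (h.choose.finite_toSet.subset fun s hs => (h.choose_spec.1 s).2 hs)
    have hK' : HasEulerChar K _ := ⟨hK.toFinset, by simp, rfl⟩
    rw [h.unique (hK'.stellarSubdivision hσ ha)]
    exact hK'
  | refl => rfl
  | symm _ _ _ ih => exact ih.symm
  | trans _ _ _ _ _ ih ih' => exact ih.trans ih'

theorem IsPLBall.eulerChar_eq_one {α : Type*} {n : ℕ} {K : PreAbstractSimplicialComplex α}
    (h : IsPLBall n K) {k : ℤ} (hk : HasEulerChar K k) : k = 1 := by
  obtain ⟨f, hf, h⟩ := h
  exact ((h.hasEulerChar_iff k).1 (hk.map hf)).unique (hasEulerChar_fullSimplex n)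

namespace Gluing

variable {V : Type*} {G : Gluing V}

/-! ### The barycentric subdivision -/

theorem SameCell.mono {σ σ' t t' : Finset V} (hσ : σ ⊆ σ') (h : G.SameCell σ' t t') :
    G.SameCell σ t t' :=
  Relation.EqvGen.mono (fun _ _ h =>
    ⟨h.1, h.2.1, hσ.trans h.2.2.1, hσ.trans h.2.2.2.1, h.2.2.2.2⟩) _ _ h

theorem Flag.cell_eq_iff {p q : G.Flag} :
    p.cell = q.cell ↔ p.1.1 = q.1.1 ∧ G.SameCell p.1.1 p.1.2 q.1.2 :=
  ⟨fun h => Quotient.exact h, fun h => Quotient.sound (s := G.flagSetoid) h⟩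

@[simp] theorem Flag.simplex_cell (p : G.Flag) : p.cell.simplex = p.1.1 := rfl

theorem Cell.exists_flag (x : G.Cell) : ∃ p : G.Flag, p.cell = x := Quotient.exists_rep x

/-- The face `σ` of the cell of the flag `p`. -/
def Flag.face (p : G.Flag) (σ : Finset V) (hσ : σ.Nonempty) (h : σ ⊆ p.1.1) : G.Flag :=
  ⟨(σ, p.1.2), hσ, h.trans p.2.2.1, p.2.2.2⟩

theorem Flag.isFace_cell_iff {q : G.Flag} {x : G.Cell} :
    x.IsFace q.cell ↔ ∃ σ hσ, ∃ h : σ ⊆ q.1.1, (q.face σ hσ h).cell = x := by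
  constructor
  · rintro ⟨p, q', rfl, hq, h1, h2⟩
    rw [Flag.cell_eq_iff] at hq
    refine ⟨p.1.1, p.2.1, h2.trans hq.1.subset, ?_⟩
    rw [Flag.cell_eq_iff]
    refine ⟨rfl, ?_⟩
    have := hq.2.mono h2
    rw [← h1] at this
    exact this.symm
  · rintro ⟨σ, hσ, h, rfl⟩
    exact ⟨_, q, rfl, rfl, rfl, h⟩

theorem Cell.IsFace.simplex_subset {x y : G.Cell} (h : x.IsFace y) : x.simplex ⊆ y.simplex := by
  obtain ⟨p, q, rfl, rfl, -, h⟩ := h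
  exact h

theorem Cell.IsFace.eq_of_card_le {x y : G.Cell} (h : x.IsFace y)
    (hc : y.simplex.card ≤ x.simplex.card) : x = y := by
  have h0 := Finset.eq_of_subset_of_card_le h.simplex_subset hc
  obtain ⟨p, q, rfl, rfl, h1, h2⟩ := h
  rw [Flag.cell_eq_iff]
  refine ⟨h0, ?_⟩
  rw [h1]
  exact Relation.EqvGen.refl _

theorem Cell.isFace_refl (x : G.Cell) : x.IsFace x := by
  obtain ⟨p, rfl⟩ := x.exists_flag
  exact ⟨p, p, rfl, rfl, rfl, subset_rfl⟩

theorem Cell.IsFace.trans {x y z : G.Cell} (h : x.IsFace y) (h' : y.IsFace z) : x.IsFace z := by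
  obtain ⟨q, rfl⟩ := z.exists_flag
  obtain ⟨σ, hσ, hs, rfl⟩ := Flag.isFace_cell_iff.1 h'
  obtain ⟨σ', hσ', hs', rfl⟩ := Flag.isFace_cell_iff.1 h
  exact Flag.isFace_cell_iff.2 ⟨σ', hσ', hs'.trans hs, rfl⟩

/-- The cells form a partially ordered set. -/
instance : PartialOrder G.Cell where
  le := Cell.IsFace
  le_refl := Cell.isFace_refl
  le_trans _ _ _ := Cell.IsFace.trans
  le_antisymm _ _ h h' := h.eq_of_card_le (Finset.card_le_card h'.simplex_subset)

theorem Cell.le_def {x y : G.Cell} : x ≤ y ↔ x.IsFace y := Iff.rfl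

open Classical in
theorem sum_faces_sign [Finite V] (y : G.Cell) :
    ∑ x with x ≤ y, (-1 : ℤ) ^ (x.simplex.card + 1) = 1 := by
  obtain ⟨q, rfl⟩ := y.exists_flag
  refine Eq.trans ?_ (sum_nonempty_powerset_sign q.1.1 q.2.1)
  refine Finset.sum_bij' (fun x _ => x.simplex)
    (fun σ h => (q.face σ (Finset.mem_filter.1 h).2
      (Finset.mem_powerset.1 (Finset.mem_filter.1 h).1)).cell) ?_ ?_ ?_ ?_ ?_
  · intro x hx
    simp only [Finset.mem_filter, Finset.mem_univ, true_and, Cell.le_def] at hx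
    obtain ⟨σ, hσ, h, rfl⟩ := Flag.isFace_cell_iff.1 hx
    simp only [Finset.mem_filter, Finset.mem_powerset]
    exact ⟨h, hσ⟩
  · intro σ h
    simp only [Finset.mem_filter, Finset.mem_univ, true_and, Cell.le_def]
    exact Flag.isFace_cell_iff.2 ⟨σ, _, _, rfl⟩
  · intro x hx
    simp only [Finset.mem_filter, Finset.mem_univ, true_and, Cell.le_def] at hx
    obtain ⟨σ, hσ, h, rfl⟩ := Flag.isFace_cell_iff.1 hx
    rfl
  · intro σ h
    rfl
  · intro x hx
    rfl

end Gluing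

/-! ### Order complexes -/

section OrderComplex

variable {P : Type*} [PartialOrder P] [Fintype P]

open Classical in
/-- The chains with largest element `y`. -/
def chainsBelow (y : P) : Finset (Finset P) :=
  Finset.univ.filter fun s => y ∈ s ∧ IsChain (· ≤ ·) (s : Set P) ∧ ∀ x ∈ s, x ≤ y

open Classical in
theorem sum_chainsBelow (y : P) :
    ∑ s ∈ chainsBelow y, (-1 : ℤ) ^ (s.card + 1) =
      1 - ∑ x with x < y, ∑ s ∈ chainsBelow x, (-1 : ℤ) ^ (s.card + 1) := by
  have hdisj : ((Finset.univ.filter (· < y) : Finset P) : Set P).PairwiseDisjoint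
      (chainsBelow (P := P)) := by
    intro x _ x' _ hne
    rw [Function.onFun, Finset.disjoint_left]
    intro s hs hs'
    simp only [chainsBelow, Finset.mem_filter, Finset.mem_univ, true_and] at hs hs'
    exact hne (le_antisymm (hs'.2.2 x hs.1) (hs.2.2 x' hs'.1))
  rw [← Finset.sum_biUnion hdisj]
  set U := (Finset.univ.filter (· < y)).biUnion (chainsBelow (P := P)) with hU
  have hyU : ∀ s ∈ U, y ∉ s := by
    intro s hs hy
    simp only [hU, Finset.mem_biUnion, chainsBelow, Finset.mem_filter, Finset.mem_univ,
      true_and] at hs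
    obtain ⟨x, hx, hs⟩ := hs
    exact absurd (hs.2.2 y hy) (not_le_of_gt hx)
  have key : chainsBelow y = insert {y} (U.image (insert y)) := by
    ext s
    simp only [chainsBelow, Finset.mem_filter, Finset.mem_univ, true_and, Finset.mem_insert,
      Finset.mem_image]
    constructor
    · rintro ⟨hy, hc, hle⟩
      rcases (s.erase y).eq_empty_or_nonempty with h | h
      · left
        rw [← Finset.insert_erase hy, h]
        rfl
      · right
        refine ⟨s.erase y, ?_, Finset.insert_erase hy⟩
        have hc' : IsChain (· ≤ ·) ((s.erase y : Finset P) : Set P) :=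
          hc.mono (by simp)
        obtain ⟨x, hx⟩ := (s.erase y).exists_maximal h
        simp only [hU, Finset.mem_biUnion, chainsBelow, Finset.mem_filter, Finset.mem_univ,
          true_and]
        refine ⟨x, lt_of_le_of_ne (hle x (Finset.mem_of_mem_erase hx.1))
          (Finset.ne_of_mem_erase hx.1), hx.1, hc', fun z hz => ?_⟩
        rcases hc'.total (Finset.mem_coe.2 hx.1) (Finset.mem_coe.2 hz) with h | h
        · exact hx.2 hz h
        · exact h
    · rintro (rfl | ⟨r, hr, rfl⟩)
      · simp
      · simp only [hU, Finset.mem_biUnion, chainsBelow, Finset.mem_filter, Finset.mem_univ,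
          true_and] at hr
        obtain ⟨x, hx, hxr, hc, hle⟩ := hr
        have hle' : ∀ z ∈ r, z ≤ y := fun z hz => (hle z hz).trans hx.le
        refine ⟨by simp, ?_, ?_⟩
        · rw [Finset.coe_insert]
          exact hc.insert fun z hz _ => Or.inr (hle' z hz)
        · intro z hz
          rcases Finset.mem_insert.1 hz with rfl | hz
          · exact le_rfl
          · exact hle' z hz
  rw [key, Finset.sum_insert, Finset.sum_image]
  · have : ∀ s ∈ U, (-1 : ℤ) ^ ((insert y s).card + 1) = - (-1 : ℤ) ^ (s.card + 1) := by
      intro s hs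
      rw [Finset.card_insert_of_notMem (hyU s hs)]
      ring
    rw [Finset.sum_congr rfl this, Finset.sum_neg_distrib]
    simp [sub_eq_add_neg]
  · intro r hr r' hr' h
    rw [← Finset.erase_insert (hyU r hr), ← Finset.erase_insert (hyU r' hr'), h]
  · intro h
    obtain ⟨r, hr, h⟩ := Finset.mem_image.1 h
    have hr2 := hr
    simp only [hU, Finset.mem_biUnion, chainsBelow, Finset.mem_filter, Finset.mem_univ,
      true_and] at hr2
    obtain ⟨x, hx, hxr, -⟩ := hr2
    have : x ∈ ({y} : Finset P) := h ▸ Finset.mem_insert_of_mem hxr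
    exact hx.ne (Finset.mem_singleton.1 this)

end OrderComplex

namespace Gluing

variable {V : Type*} [Finite V] {G : Gluing V}

open Classical in
theorem sum_chainsBelow_cell (y : G.Cell) :
    ∑ s ∈ chainsBelow y, (-1 : ℤ) ^ (s.card + 1) = (-1) ^ (y.simplex.card + 1) := by
  induction hn : y.simplex.card using Nat.strong_induction_on generalizing y with
  | _ n ih =>
    subst hn
    have hlt : ∀ x : G.Cell, x < y → x.simplex.card < y.simplex.card := by
      intro x hx
      by_contra h
      exact hx.ne (Cell.IsFace.eq_of_card_le hx.le (not_lt.1 h))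
    have h1 := sum_faces_sign y
    have h2 : (Finset.univ.filter (· ≤ y) : Finset G.Cell) =
        insert y (Finset.univ.filter (· < y)) := by
      ext x
      simp [le_iff_eq_or_lt]
    rw [h2, Finset.sum_insert (by simp)] at h1
    rw [sum_chainsBelow, Finset.sum_congr rfl fun x hx =>
      ih _ (hlt x (Finset.mem_filter.1 hx).2) x rfl]
    linarith

theorem hasEulerChar_barycentric (G : Gluing V) : HasEulerChar G.barycentric G.eulerChar := by
  classical
  refine ⟨Finset.univ.biUnion (chainsBelow (P := G.Cell)), fun s => ?_, ?_⟩
  · simp only [Finset.mem_biUnion, Finset.mem_univ, true_and, chainsBelow, Finset.mem_filter,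
      barycentric, Set.mem_ofPred_eq]
    constructor
    · rintro ⟨y, hy, hc, hle⟩
      exact ⟨⟨y, hy⟩, fun x hx z hz => hc.total (Finset.mem_coe.2 hx) (Finset.mem_coe.2 hz)⟩
    · rintro ⟨hne, h⟩
      have hc : IsChain (· ≤ ·) (s : Set G.Cell) := fun x hx z hz _ => h x hx z hz
      obtain ⟨y, hy⟩ := s.exists_maximal hne
      refine ⟨y, hy.1, hc, fun z hz => ?_⟩
      rcases h y hy.1 z hz with h | h
      · exact hy.2 hz h
      · exact h
  · rw [Finset.sum_biUnion]
    · exact Finset.sum_congr rfl fun y _ => sum_chainsBelow_cell y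
    · intro x _ x' _ hne
      rw [Function.onFun, Finset.disjoint_left]
      intro s hs hs'
      simp only [chainsBelow, Finset.mem_filter, Finset.mem_univ, true_and] at hs hs'
      exact hne (le_antisymm (hs'.2.2 x hs.1) (hs.2.2 x' hs'.1))

theorem eulerChar_eq_one_of_isPLBall {n : ℕ} (h : IsPLBall n G.barycentric) : G.eulerChar = 1 :=
  h.eulerChar_eq_one (hasEulerChar_barycentric G)

end Gluing

/-! ### Sums over cells as sums over flags -/

namespace Gluing

variable {V : Type*} {G : Gluing V}

theorem SameCell.refl (σ t : Finset V) : G.SameCell σ t t := Relation.EqvGen.refl _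

theorem SameCell.symm {σ t t' : Finset V} (h : G.SameCell σ t t') : G.SameCell σ t' t :=
  Relation.EqvGen.symm _ _ h

theorem SameCell.trans {σ t t' t'' : Finset V} (h₁ : G.SameCell σ t t')
    (h₂ : G.SameCell σ t' t'') : G.SameCell σ t t'' :=
  Relation.EqvGen.trans _ _ _ h₁ h₂

/-- An equivalence relation on the simplices over `σ` that contains the gluing contains
`SameCell`. -/
theorem SameCell.induction {σ : Finset V} {r : Finset V → Finset V → Prop} (hr : Equivalence r)
    (h : ∀ t t', t ∈ G.top → t' ∈ G.top → σ ⊆ t → σ ⊆ t' → G.adj t t' → r t t')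
    {t t' : Finset V} (ht : G.SameCell σ t t') : r t t' := by
  induction ht with
  | rel a b h' => exact h a b h'.1 h'.2.1 h'.2.2.1 h'.2.2.2.1 h'.2.2.2.2
  | refl a => exact hr.refl a
  | symm a b _ ih => exact hr.symm ih
  | trans a b c _ _ ih ih' => exact hr.trans ih ih'

theorem SameCell.mem_iff {σ : Finset V} {p : Finset V → Prop}
    (h : ∀ t t', t ∈ G.top → t' ∈ G.top → σ ⊆ t → σ ⊆ t' → G.adj t t' → (p t ↔ p t'))
    {t t' : Finset V} (ht : G.SameCell σ t t') : p t ↔ p t' :=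
  SameCell.induction (r := fun t t' => p t ↔ p t') ⟨fun _ => Iff.rfl, Iff.symm, Iff.trans⟩ h ht

theorem SameCell.top_iff {σ t t' : Finset V} (h : G.SameCell σ t t') :
    (t ∈ G.top ↔ t' ∈ G.top) :=
  h.mem_iff fun _ _ h h' _ _ _ => iff_of_true h h'

theorem SameCell.subset_iff {σ t t' : Finset V} (h : G.SameCell σ t t') : (σ ⊆ t ↔ σ ⊆ t') :=
  h.mem_iff fun _ _ _ _ h h' _ => iff_of_true h h'

theorem SameCell.of_adj {σ t t' : Finset V} (ht : t ∈ G.top) (ht' : t' ∈ G.top) (hσ : σ ⊆ t)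
    (hσ' : σ ⊆ t') (h : G.adj t t') : G.SameCell σ t t' :=
  Relation.EqvGen.rel _ _ ⟨ht, ht', hσ, hσ', h⟩

theorem SameCell.inPiece_iff {σ t t' : Finset V} (h : G.SameCell σ t t') (c : G.Piece) :
    (G.InPiece c t ↔ G.InPiece c t') := by
  refine h.mem_iff fun t t' ht ht' _ _ h => ?_
  have : G.piece t ht = G.piece t' ht' := Quot.sound h
  constructor
  · rintro ⟨_, hc⟩
    exact ⟨ht', this.symm.trans hc⟩
  · rintro ⟨_, hc⟩
    exact ⟨ht, this.trans hc⟩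

/-! ### Unions of components of a gluing -/

theorem sameCell_restrict {G' : Gluing V} {p : Finset V → Prop}
    (htop : ∀ t, t ∈ G'.top ↔ t ∈ G.top ∧ p t) (hadj : ∀ t t', G'.adj t t' ↔ G.adj t t')
    (hp : ∀ t t', t ∈ G.top → t' ∈ G.top → G.adj t t' → (p t ↔ p t')) {σ t t' : Finset V}
    (ht : p t) : G'.SameCell σ t t' ↔ G.SameCell σ t t' := by
  constructor
  · exact fun h => Relation.EqvGen.mono (fun a b h => ⟨((htop _).1 h.1).1, ((htop _).1 h.2.1).1,
      h.2.2.1, h.2.2.2.1, (hadj _ _).1 h.2.2.2.2⟩) _ _ h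
  · intro h
    have key : (p t ↔ p t') ∧ (p t → G'.SameCell σ t t') := by
      clear ht
      induction h with
      | rel a b h =>
        have := hp a b h.1 h.2.1 h.2.2.2.2
        exact ⟨this, fun ha => SameCell.of_adj ((htop _).2 ⟨h.1, ha⟩)
          ((htop _).2 ⟨h.2.1, this.1 ha⟩) h.2.2.1 h.2.2.2.1 ((hadj _ _).2 h.2.2.2.2)⟩
      | refl a => exact ⟨Iff.rfl, fun _ => SameCell.refl _ _⟩
      | symm a b _ ih => exact ⟨ih.1.symm, fun h => (ih.2 (ih.1.2 h)).symm⟩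
      | trans a b c _ _ ih ih' =>
        exact ⟨ih.1.trans ih'.1, fun h => (ih.2 h).trans (ih'.2 (ih.1.1 h))⟩
    exact key.2 ht

theorem sub_top (c : G.Piece) (t : Finset V) : t ∈ (G.sub c).top ↔ t ∈ G.top ∧ G.InPiece c t :=
  ⟨fun h => ⟨h.choose, h⟩, fun h => h.2⟩

theorem inPiece_iff_of_adj (c : G.Piece) (t t' : Finset V) (ht : t ∈ G.top) (ht' : t' ∈ G.top)
    (h : G.adj t t') : G.InPiece c t ↔ G.InPiece c t' :=
  (SameCell.of_adj (σ := ∅) ht ht' (by simp) (by simp) h).inPiece_iff c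

variable [Fintype V]

open Classical in
/-- The top-dimensional simplices that contain `σ`. -/
def star (G : Gluing V) (σ : Finset V) : Finset (Finset V) :=
  Finset.univ.filter fun t => t ∈ G.top ∧ σ ⊆ t

theorem mem_star {σ t : Finset V} : t ∈ G.star σ ↔ t ∈ G.top ∧ σ ⊆ t := by
  simp [star]

open Classical in
/-- The number of top-dimensional simplices around the cell `(σ, t)`. -/
def cellSize (G : Gluing V) (σ t : Finset V) : ℕ :=
  ((G.star σ).filter fun t' => G.SameCell σ t t').card

theorem cellSize_pos {σ t : Finset V} (ht : t ∈ G.top) (hσ : σ ⊆ t) : 0 < G.cellSize σ t := by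
  classical
  exact Finset.card_pos.2 ⟨t, Finset.mem_filter.2 ⟨mem_star.2 ⟨ht, hσ⟩, SameCell.refl _ _⟩⟩

open Classical in
theorem card_filter_cell_eq (p : G.Flag) [Fintype G.Flag] :
    (Finset.univ.filter fun q : G.Flag => q.cell = p.cell).card = G.cellSize p.1.1 p.1.2 := by
  refine Finset.card_bij' (fun q _ => q.1.2)
    (fun t h => ⟨(p.1.1, t), p.2.1, (mem_star.1 (Finset.mem_filter.1 h).1).2,
      (mem_star.1 (Finset.mem_filter.1 h).1).1⟩) ?_ ?_ ?_ ?_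
  · intro q hq
    simp only [Finset.mem_filter, Finset.mem_univ, true_and, Flag.cell_eq_iff] at hq
    simp only [Finset.mem_filter, mem_star]
    refine ⟨⟨q.2.2.2, ?_⟩, ?_⟩
    · rw [← hq.1]; exact q.2.2.1
    · rw [← hq.1]; exact hq.2.symm
  · intro t ht
    simp only [Finset.mem_filter, mem_star] at ht
    refine Finset.mem_filter.2 ⟨Finset.mem_univ _, Flag.cell_eq_iff.2 ⟨rfl, ht.2.symm⟩⟩
  · intro q hq
    simp only [Finset.mem_filter, Finset.mem_univ, true_and, Flag.cell_eq_iff] at hq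
    refine Subtype.ext ?_
    exact Prod.ext hq.1.symm rfl
  · intro t ht
    rfl

open Classical in
theorem sum_cell (f : G.Cell → ℚ) (g : Finset V → Finset V → ℚ)
    (h : ∀ p : G.Flag, f p.cell = g p.1.1 p.1.2) :
    ∑ x, f x = ∑ t ∈ G.star ∅, ∑ σ ∈ t.powerset with σ.Nonempty, g σ t / G.cellSize σ t := by
  let : Fintype G.Flag := Fintype.ofFinite _
  have h1 : ∑ x, f x = ∑ p : G.Flag, g p.1.1 p.1.2 / G.cellSize p.1.1 p.1.2 := by
    rw [← Finset.sum_fiberwise_of_maps_to (s := (Finset.univ : Finset G.Flag))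
      (t := Finset.univ) (g := Flag.cell) (fun _ _ => Finset.mem_univ _)]
    refine Finset.sum_congr rfl fun x _ => ?_
    obtain ⟨p, rfl⟩ := x.exists_flag
    have h2 : ∀ q ∈ Finset.univ.filter (fun q : G.Flag => q.cell = p.cell),
        g q.1.1 q.1.2 / G.cellSize q.1.1 q.1.2 = f p.cell / G.cellSize p.1.1 p.1.2 := by
      intro q hq
      have hq' := (Finset.mem_filter.1 hq).2
      rw [← h, hq', ← card_filter_cell_eq, ← card_filter_cell_eq, hq']
    rw [Finset.sum_congr rfl h2, Finset.sum_const, card_filter_cell_eq, nsmul_eq_mul]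
    have : (G.cellSize p.1.1 p.1.2 : ℚ) ≠ 0 :=
      Nat.cast_ne_zero.2 (cellSize_pos p.2.2.2 p.2.2.1).ne'
    field_simp
  rw [h1, Finset.sum_sigma']
  refine Finset.sum_bij' (fun p _ => ⟨p.1.2, p.1.1⟩) (fun q hq => ⟨(q.2, q.1), ?_⟩) ?_ ?_ ?_ ?_ ?_
  · simp only [Finset.mem_sigma, mem_star, Finset.mem_filter, Finset.mem_powerset] at hq
    exact ⟨hq.2.2, hq.2.1, hq.1.1⟩
  · intro p _
    simp only [Finset.mem_sigma, mem_star, Finset.mem_filter, Finset.mem_powerset]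
    exact ⟨⟨p.2.2.2, by simp⟩, p.2.2.1, p.2.1⟩
  · intro q _
    exact Finset.mem_univ _
  · intro p _
    rfl
  · intro q _
    rfl
  · intro p _
    rfl

open Classical in
theorem eulerChar_eq_sum_flags (G : Gluing V) :
    (G.eulerChar : ℚ) = ∑ t ∈ G.star ∅, ∑ σ ∈ t.powerset with σ.Nonempty,
      (-1) ^ (σ.card + 1) / (G.cellSize σ t : ℚ) := by
  rw [eulerChar, Int.cast_sum]
  exact sum_cell _ (fun σ _ => (-1) ^ (σ.card + 1)) fun p => by simp

open Classical in
theorem sum_div_cellSize {ι : Type*} {σ : Finset V} (lab : Finset V → ι) (I : Finset ι)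
    (hI : ∀ i, i ∈ I ↔ ∃ t ∈ G.star σ, lab t = i)
    (h : ∀ t ∈ G.star σ, ∀ t' ∈ G.star σ, G.SameCell σ t t' ↔ lab t = lab t') (g : ι → ℚ)
    (f : Finset V → ℚ) (hf : ∀ t ∈ G.star σ, f t = g (lab t)) :
    ∑ t ∈ G.star σ, f t / G.cellSize σ t = ∑ i ∈ I, g i := by
  rw [← Finset.sum_fiberwise_of_maps_to (s := G.star σ) (t := I) (g := lab)
    (fun t ht => (hI _).2 ⟨t, ht, rfl⟩)]
  refine Finset.sum_congr rfl fun i hi => ?_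
  obtain ⟨t₀, ht₀, rfl⟩ := (hI i).1 hi
  have hs : ∀ t ∈ (G.star σ).filter (fun t => lab t = lab t₀),
      f t / G.cellSize σ t = g (lab t₀) / ((G.star σ).filter (fun t => lab t = lab t₀)).card := by
    intro t ht
    obtain ⟨ht, hl⟩ := Finset.mem_filter.1 ht
    rw [hf t ht, hl]
    congr 2
    rw [cellSize]
    congr 1
    refine Finset.filter_congr fun t' ht' => ?_
    rw [h t ht t' ht', hl, eq_comm]
  rw [Finset.sum_congr rfl hs, Finset.sum_const, nsmul_eq_mul]
  have : (((G.star σ).filter (fun t => lab t = lab t₀)).card : ℚ) ≠ 0 :=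
    Nat.cast_ne_zero.2 (Finset.card_pos.2 ⟨t₀, by simp [ht₀]⟩).ne'
  field_simp

open Classical in
theorem cellSize_restrict {G' : Gluing V} {p : Finset V → Prop}
    (htop : ∀ t, t ∈ G'.top ↔ t ∈ G.top ∧ p t) (hadj : ∀ t t', G'.adj t t' ↔ G.adj t t')
    (hp : ∀ t t', t ∈ G.top → t' ∈ G.top → G.adj t t' → (p t ↔ p t')) {σ t : Finset V}
    (ht : p t) : G'.cellSize σ t = G.cellSize σ t := by
  rw [cellSize, cellSize]
  congr 1
  ext t'
  simp only [Finset.mem_filter, mem_star, htop, sameCell_restrict htop hadj hp ht]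
  constructor
  · exact fun h => ⟨⟨h.1.1.1, h.1.2⟩, h.2⟩
  · exact fun h => ⟨⟨⟨h.1.1, (h.2.mem_iff fun t t' h h' _ _ => hp t t' h h').1 ht⟩, h.1.2⟩, h.2⟩

open Classical in
theorem sum_star_restrict {G' : Gluing V} {p : Finset V → Prop}
    (htop : ∀ t, t ∈ G'.top ↔ t ∈ G.top ∧ p t) (f : Finset V → ℚ) (σ : Finset V) :
    ∑ t ∈ G'.star σ, f t = ∑ t ∈ G.star σ, if p t then f t else 0 := by
  rw [← Finset.sum_filter]
  refine Finset.sum_congr ?_ fun _ _ => rfl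
  ext t
  simp only [Finset.mem_filter, mem_star, htop]
  tauto

open Classical in
theorem eulerChar_restrict {G' : Gluing V} {p : Finset V → Prop}
    (htop : ∀ t, t ∈ G'.top ↔ t ∈ G.top ∧ p t) (hadj : ∀ t t', G'.adj t t' ↔ G.adj t t')
    (hp : ∀ t t', t ∈ G.top → t' ∈ G.top → G.adj t t' → (p t ↔ p t')) :
    (G'.eulerChar : ℚ) = ∑ t ∈ G.star ∅, if p t then ∑ σ ∈ t.powerset with σ.Nonempty,
      (-1) ^ (σ.card + 1) / (G.cellSize σ t : ℚ) else 0 := by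
  rw [eulerChar_eq_sum_flags, sum_star_restrict htop]
  refine Finset.sum_congr rfl fun t _ => ?_
  by_cases h : p t
  · simp only [h, if_true, cellSize_restrict htop hadj hp h]
  · simp [h]

end Gluing

/-! ### Arcs of a subdivided graph -/

namespace Subdivides

variable {V : Type*} {G : SimpleGraph V} {n m : ℕ} {ends : Fin m → Fin n × Fin n}

/-- The two ends of the arc `j` of a multigraph. -/
def endNode (ends : Fin m → Fin n × Fin n) (j : Fin m) (b : Bool) : Fin n :=
  if b then (ends j).2 else (ends j).1

/-- The neighbour on the arc `j` of its end `b`. -/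
def nbr (S : Subdivides G ends) (j : Fin m) (b : Bool) : V :=
  if b then (S.arc j).penultimate else (S.arc j).snd

variable (S : Subdivides G ends)

theorem not_nil (hne : ∀ j, (ends j).1 ≠ (ends j).2) (j : Fin m) : ¬ (S.arc j).Nil := by
  intro h
  exact hne j (S.node_injective h.eq)

theorem nbr_mem_edges (hne : ∀ j, (ends j).1 ≠ (ends j).2) (j : Fin m) (b : Bool) :
    s(S.node (endNode ends j b), S.nbr j b) ∈ (S.arc j).edges := by
  rw [← SimpleGraph.Walk.adj_toSubgraph_iff_mem_edges]
  cases b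
  · exact (S.arc j).toSubgraph_adj_snd (S.not_nil hne j)
  · exact ((S.arc j).toSubgraph_adj_penultimate (S.not_nil hne j)).symm

theorem eq_nbr_of_mem_edges (hne : ∀ j, (ends j).1 ≠ (ends j).2) {i : Fin n} {j : Fin m} {y : V}
    (h : s(S.node i, y) ∈ (S.arc j).edges) : ∃ b, i = endNode ends j b ∧ y = S.nbr j b := by
  have hadj := SimpleGraph.Walk.adj_toSubgraph_iff_mem_edges.2 h
  rcases S.node_mem i j ((S.arc j).fst_mem_support_of_mem_edges h) with rfl | rfl
  · refine ⟨false, rfl, ?_⟩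
    have : y ∈ (S.arc j).toSubgraph.neighborSet (S.node (ends j).1) := hadj
    rw [(S.arc_isPath j).neighborSet_toSubgraph_startpoint (S.not_nil hne j)] at this
    exact this
  · refine ⟨true, rfl, ?_⟩
    have : y ∈ (S.arc j).toSubgraph.neighborSet (S.node (ends j).2) := hadj
    rw [(S.arc_isPath j).neighborSet_toSubgraph_endpoint (S.not_nil hne j)] at this
    exact this

theorem mem_edges_of_adj {j : Fin m} {x y z : V} (hx : x ∉ Set.range S.node)
    (h : s(x, y) ∈ (S.arc j).edges) (hz : G.Adj x z) : s(x, z) ∈ (S.arc j).edges := by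
  obtain ⟨k, hk, -⟩ := S.edge_mem s(x, z) hz
  by_cases hjk : j = k
  · exact hjk ▸ hk
  · exact absurd (S.arc_disjoint j k hjk x ((S.arc j).fst_mem_support_of_mem_edges h)
      ((S.arc k).fst_mem_support_of_mem_edges hk)) hx

theorem ncard_neighborSet {j : Fin m} {x y : V} (hx : x ∉ Set.range S.node)
    (h : s(x, y) ∈ (S.arc j).edges) : (G.neighborSet x).ncard = 2 := by
  have h1 : G.neighborSet x = (S.arc j).toSubgraph.neighborSet x := by
    ext z
    constructor
    · exact fun hz => SimpleGraph.Walk.adj_toSubgraph_iff_mem_edges.2 (S.mem_edges_of_adj hx h hz)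
    · exact fun hz => hz.adj_sub
  obtain ⟨i, rfl, hi⟩ := SimpleGraph.Walk.mem_support_iff_exists_getVert.1
    ((S.arc j).fst_mem_support_of_mem_edges h)
  rw [h1]
  refine (S.arc_isPath j).ncard_neighborSet_toSubgraph_internal_eq_two ?_ (lt_of_le_of_ne hi ?_)
  · rintro rfl
    exact hx ⟨_, (SimpleGraph.Walk.getVert_zero _).symm⟩
  · rintro rfl
    exact hx ⟨_, (SimpleGraph.Walk.getVert_length _).symm⟩

theorem _root_.SimpleGraph.Walk.eqvGen_of_mem_edges {a b : V} (p : G.Walk a b) {Q : V → Prop}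
    (hQ : ∀ x ∈ p.support.tail.dropLast, Q x) {r : Sym2 V → Sym2 V → Prop} (hr : Equivalence r)
    (h : ∀ x y z, Q x → s(x, y) ∈ p.edges → s(x, z) ∈ p.edges → r s(x, y) s(x, z))
    {e e' : Sym2 V} (he : e ∈ p.edges) (he' : e' ∈ p.edges) : r e e' := by
  induction p generalizing e e' with
  | nil => simp at he
  | @cons a c b hadj q ih =>
    cases q with
    | nil =>
      simp at he he'
      rw [he, he']
      exact hr.refl _
    | @cons _ d _ hadj' q' =>
      have hc : Q c := by
        apply hQ
        simp [SimpleGraph.Walk.support_cons, List.dropLast_cons_of_ne_nil]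
      have hfirst : r s(a, c) s(c, d) := by
        rw [Sym2.eq_swap]
        exact h c a d hc (by simp [Sym2.eq_swap]) (by simp)
      have ih' : ∀ {e e' : Sym2 V}, e ∈ (SimpleGraph.Walk.cons hadj' q').edges →
          e' ∈ (SimpleGraph.Walk.cons hadj' q').edges → r e e' := by
        refine fun h1 h2 => ih (fun x hx => hQ x ?_) (fun x y z hx h1 h2 => h x y z hx ?_ ?_) h1 h2
        · simp only [SimpleGraph.Walk.support_cons, List.tail_cons] at hx ⊢
          rw [List.dropLast_cons_of_ne_nil (SimpleGraph.Walk.support_ne_nil _)]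
          exact List.mem_cons_of_mem _ hx
        · rw [SimpleGraph.Walk.edges_cons]; exact List.mem_cons_of_mem _ h1
        · rw [SimpleGraph.Walk.edges_cons]; exact List.mem_cons_of_mem _ h2
      have hcd : s(c, d) ∈ (SimpleGraph.Walk.cons hadj' q').edges := by simp
      rw [SimpleGraph.Walk.edges_cons, List.mem_cons] at he he'
      rcases he with rfl | he <;> rcases he' with rfl | he'
      · exact hr.refl _
      · exact hr.trans hfirst (ih' hcd he')
      · exact hr.trans (ih' he hcd) (hr.symm hfirst)
      · exact ih' he he'

theorem notMem_range_of_mem_interior {j : Fin m} {x : V}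
    (hx : x ∈ (S.arc j).support.tail.dropLast) : x ∉ Set.range S.node := by
  rintro ⟨i, rfl⟩
  have hnd := (S.arc_isPath j).support_nodup
  have hs : S.node i ∈ (S.arc j).support.tail := List.mem_of_mem_dropLast hx
  rcases S.node_mem i j (List.mem_of_mem_tail hs) with h | h
  · rw [← SimpleGraph.Walk.cons_tail_support] at hnd
    exact (List.nodup_cons.1 hnd).1 (h ▸ hs)
  · have hne : (S.arc j).support.tail ≠ [] := List.ne_nil_of_mem hs
    have hnd' : (S.arc j).support.tail.Nodup := hnd.sublist (List.tail_sublist _)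
    rw [← List.dropLast_append_getLast hne] at hnd'
    have hlast : (S.arc j).support.tail.getLast hne = S.node (ends j).2 := by
      rw [List.getLast_tail]
      exact SimpleGraph.Walk.getLast_support _
    rw [hlast, List.nodup_append] at hnd'
    exact hnd'.2.2 _ (h ▸ hx) _ (by simp) rfl

theorem rel_of_mem_edges {j : Fin m} {r : Sym2 V → Sym2 V → Prop} (hr : Equivalence r)
    (h : ∀ x y z, x ∉ Set.range S.node → s(x, y) ∈ (S.arc j).edges → s(x, z) ∈ (S.arc j).edges →
      r s(x, y) s(x, z)) {e e' : Sym2 V} (he : e ∈ (S.arc j).edges) (he' : e' ∈ (S.arc j).edges) :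
    r e e' :=
  (S.arc j).eqvGen_of_mem_edges (Q := fun x => x ∉ Set.range S.node)
    (fun _ hx => S.notMem_range_of_mem_interior hx) hr h he he'

end Subdivides

/-! ### The triangles around a vertex -/

section Around

variable {V : Type*} [DecidableEq V] {T : Set (Finset V)} {v : V}

theorem exists_linkGraph_adj {t : Finset V} (h3 : t.card = 3) (ht : t ∈ T) {x : V} (hv : v ∈ t)
    (hx : x ∈ t) (hxv : x ≠ v) : ∃ y, t = {v, x, y} ∧ (linkGraph T v).Adj x y := by
  obtain ⟨y, hy⟩ : ∃ y, t.erase v = {x, y} ∧ x ≠ y := by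
    have h2 : (t.erase v).card = 2 := by rw [Finset.card_erase_of_mem hv, h3]
    obtain ⟨a, b, hab, h⟩ := Finset.card_eq_two.1 h2
    have : x ∈ t.erase v := Finset.mem_erase.2 ⟨hxv, hx⟩
    rw [h] at this
    rcases Finset.mem_insert.1 this with rfl | h'
    · exact ⟨b, h, hab⟩
    · rw [Finset.mem_singleton] at h'
      subst h'
      exact ⟨a, by rw [h, Finset.pair_comm], hab.symm⟩
  have ht' : t = {v, x, y} := by rw [← hy.1, Finset.insert_erase hv]
  have hyv : y ≠ v := by
    have : y ∈ t.erase v := by rw [hy.1]; simp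
    exact Finset.ne_of_mem_erase this
  exact ⟨y, ht', hy.2, hxv, hyv, ht' ▸ ht⟩

theorem exists_linkGraph_adj' {t : Finset V} (h3 : t.card = 3) (ht : t ∈ T) (hv : v ∈ t) :
    ∃ x y, t = {v, x, y} ∧ (linkGraph T v).Adj x y := by
  obtain ⟨x, hx⟩ : (t.erase v).Nonempty := by
    rw [← Finset.card_pos, Finset.card_erase_of_mem hv, h3]; norm_num
  obtain ⟨y, h⟩ := exists_linkGraph_adj h3 ht hv (Finset.mem_of_mem_erase hx)
    (Finset.ne_of_mem_erase hx)
  exact ⟨x, y, h⟩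

theorem eq_edge_of_triangle_eq {x y x' y' : V} (h : (linkGraph T v).Adj x y)
    (h' : (linkGraph T v).Adj x' y') (he : ({v, x, y} : Finset V) = {v, x', y'}) :
    s(x, y) = s(x', y') := by
  have h1 : ({x, y} : Finset V) = {x', y'} := by
    have := congrArg (fun t => t.erase v) he
    simpa [Finset.erase_insert, h.2.1.symm, h.2.2.1.symm, h'.2.1.symm, h'.2.2.1.symm] using this
  have hx : x ∈ ({x', y'} : Finset V) := h1 ▸ by simp
  have hy : y ∈ ({x', y'} : Finset V) := h1 ▸ by simp
  have hxy := h.1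
  simp only [Finset.mem_insert, Finset.mem_singleton] at hx hy
  rw [Sym2.eq_iff]
  rcases hx with rfl | rfl <;> rcases hy with rfl | rfl <;> simp_all

theorem ncard_triangles_eq (hT : ∀ t ∈ T, t.card = 3) {x : V} (hx : x ≠ v) :
    {t | t ∈ T ∧ {v, x} ⊆ t}.ncard = ((linkGraph T v).neighborSet x).ncard := by
  symm
  refine Set.ncard_congr (fun y _ => {v, x, y}) ?_ ?_ ?_
  · intro y hy
    refine ⟨hy.2.2.2, ?_⟩
    intro z hz
    simp only [Finset.mem_insert, Finset.mem_singleton] at hz ⊢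
    tauto
  · intro y y' hy hy' h
    have := eq_edge_of_triangle_eq hy hy' h
    rcases Sym2.eq_iff.1 this with h | h
    · exact h.2
    · exact h.2.trans h.1
  · rintro t ⟨ht, hs⟩
    obtain ⟨y, rfl, hy⟩ := exists_linkGraph_adj (hT t ht) ht (hs (by simp) : v ∈ t)
      (hs (by simp) : x ∈ t) hx
    exact ⟨y, hy, rfl⟩

theorem inter_eq_pair {t t' : Finset V} (h3 : t.card = 3) (h3' : t'.card = 3) (hne : t ≠ t')
    {e : Finset V} (he : e.card = 2) (h : e ⊆ t) (h' : e ⊆ t') : t ∩ t' = e := by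
  symm
  refine Finset.eq_of_subset_of_card_le (Finset.subset_inter h h') ?_
  rw [he]
  by_contra hc
  have h1 : t ∩ t' = t := Finset.eq_of_subset_of_card_le Finset.inter_subset_left (by omega)
  have h2 : t ∩ t' = t' := Finset.eq_of_subset_of_card_le Finset.inter_subset_right (by omega)
  exact hne (h1.symm.trans h2)

theorem exists_eq_pair {e : Finset V} (he : e.card = 2) (hv : v ∈ e) : ∃ x, x ≠ v ∧ e = {v, x} := by
  have h1 : (e.erase v).card = 1 := by rw [Finset.card_erase_of_mem hv, he]
  obtain ⟨x, hx⟩ := Finset.card_eq_one.1 h1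
  have : x ∈ e.erase v := by rw [hx]; simp
  exact ⟨x, Finset.ne_of_mem_erase this, by rw [← hx, Finset.insert_erase hv]⟩

namespace Subdivides

variable {n m : ℕ} {ends : Fin m → Fin n × Fin n} (S : Subdivides (linkGraph T v) ends)

/-- The triangle `t` at `v` corresponds to an edge of the arc `j` of the link. -/
def InArc (j : Fin m) (t : Finset V) : Prop :=
  ∃ x y, t = {v, x, y} ∧ s(x, y) ∈ (S.arc j).edges

/-- The edge of the surface at the end `b` of the arc `j`. -/
def endEdge (j : Fin m) (b : Bool) : Finset V := {v, S.node (endNode ends j b)}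

/-- The triangle at the end `b` of the arc `j`. -/
def endTri (j : Fin m) (b : Bool) : Finset V := {v, S.node (endNode ends j b), S.nbr j b}

variable {S}

theorem InArc.mem {j : Fin m} {t : Finset V} (h : S.InArc j t) : t ∈ T ∧ v ∈ t := by
  obtain ⟨x, y, rfl, h⟩ := h
  have : (linkGraph T v).Adj x y := (S.arc j).adj_of_mem_edges h
  exact ⟨this.2.2.2, by simp⟩

theorem InArc.unique {j k : Fin m} {t : Finset V} (h : S.InArc j t) (h' : S.InArc k t) :
    j = k := by
  obtain ⟨x, y, rfl, h⟩ := h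
  obtain ⟨x', y', ht, h'⟩ := h'
  have h1 : (linkGraph T v).Adj x y := (S.arc j).adj_of_mem_edges h
  have h2 : (linkGraph T v).Adj x' y' := (S.arc k).adj_of_mem_edges h'
  have h3 := eq_edge_of_triangle_eq h1 h2 ht
  exact (S.edge_mem s(x, y) h1).unique h (h3 ▸ h')

theorem exists_inArc (hT : ∀ t ∈ T, t.card = 3) {t : Finset V} (ht : t ∈ T) (hv : v ∈ t) :
    ∃ j, S.InArc j t := by
  obtain ⟨x, y, rfl, h⟩ := exists_linkGraph_adj' (hT t ht) ht hv
  obtain ⟨j, hj, -⟩ := S.edge_mem s(x, y) h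
  exact ⟨j, x, y, rfl, hj⟩

theorem inArc_endTri (hne : ∀ j, (ends j).1 ≠ (ends j).2) (j : Fin m) (b : Bool) :
    S.InArc j (S.endTri j b) :=
  ⟨_, _, rfl, S.nbr_mem_edges hne j b⟩

theorem node_ne (hne : ∀ j, (ends j).1 ≠ (ends j).2) (j : Fin m) (b : Bool) :
    S.node (endNode ends j b) ≠ v := by
  have : (linkGraph T v).Adj _ _ := (S.arc j).adj_of_mem_edges (S.nbr_mem_edges hne j b)
  exact this.2.1

theorem card_endEdge (hne : ∀ j, (ends j).1 ≠ (ends j).2) (j : Fin m) (b : Bool) :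
    (S.endEdge j b).card = 2 :=
  Finset.card_pair (node_ne hne j b).symm

theorem endEdge_subset (j : Fin m) (b : Bool) : S.endEdge j b ⊆ S.endTri j b := by
  intro z hz
  simp only [endEdge, endTri, Finset.mem_insert, Finset.mem_singleton] at hz ⊢
  tauto

theorem mem_endEdge (j : Fin m) (b : Bool) : v ∈ S.endEdge j b := by simp [endEdge]

theorem InArc.exists_adj {j : Fin m} {t : Finset V} (hT : ∀ t ∈ T, t.card = 3)
    (h : S.InArc j t) {x : V} (hx : x ≠ v) (hxt : x ∈ t) :
    ∃ y, t = {v, x, y} ∧ s(x, y) ∈ (S.arc j).edges := by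
  obtain ⟨y, rfl, hy⟩ := exists_linkGraph_adj (hT t h.mem.1) h.mem.1 h.mem.2 hxt hx
  obtain ⟨x', y', ht, h'⟩ := h
  have h2 : (linkGraph T v).Adj x' y' := (S.arc j).adj_of_mem_edges h'
  exact ⟨y, rfl, eq_edge_of_triangle_eq hy h2 ht ▸ h'⟩

theorem InArc.eq_endTri (hT : ∀ t ∈ T, t.card = 3) (hne : ∀ j, (ends j).1 ≠ (ends j).2)
    {j : Fin m} {t : Finset V} (h : S.InArc j t) {i : Fin n} (hi : S.node i ∈ t)
    (hiv : S.node i ≠ v) : ∃ b, i = endNode ends j b ∧ t = S.endTri j b := by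
  obtain ⟨y, rfl, hy⟩ := h.exists_adj hT hiv hi
  obtain ⟨b, rfl, rfl⟩ := S.eq_nbr_of_mem_edges hne hy
  exact ⟨b, rfl, rfl⟩

theorem InArc.of_mem_of_mem {j : Fin m} {t t' : Finset V} (hT : ∀ t ∈ T, t.card = 3)
    (h : S.InArc j t) {x : V} (hx : x ∉ Set.range S.node) (hxv : x ≠ v) (hxt : x ∈ t)
    (ht' : t' ∈ T) (hv : v ∈ t') (hxt' : x ∈ t') : S.InArc j t' := by
  obtain ⟨y, rfl, hy⟩ := h.exists_adj hT hxv hxt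
  obtain ⟨z, rfl, hz⟩ := exists_linkGraph_adj (hT t' ht') ht' hv hxt' hxv
  exact ⟨x, z, rfl, S.mem_edges_of_adj hx hy hz⟩

theorem ncard_of_notMem_range (hT : ∀ t ∈ T, t.card = 3) {x : V} (hx : x ∉ Set.range S.node)
    (hxv : x ≠ v) {t : Finset V} (ht : t ∈ T) (hs : {v, x} ⊆ t) :
    {t | t ∈ T ∧ {v, x} ⊆ t}.ncard = 2 := by
  obtain ⟨j, hj⟩ := exists_inArc (S := S) hT ht (hs (by simp) : v ∈ t)
  obtain ⟨y, rfl, hy⟩ := hj.exists_adj hT hxv (hs (by simp) : x ∈ t)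
  rw [ncard_triangles_eq hT hxv]
  exact S.ncard_neighborSet hx hy

theorem endTri_injective (hne : ∀ j, (ends j).1 ≠ (ends j).2)
    {i : Fin n} {j k : Fin m} {b c : Bool} (hj : endNode ends j b = i) (hk : endNode ends k c = i)
    (h : S.endTri j b = S.endTri k c) : j = k ∧ b = c := by
  have hjk : j = k := (inArc_endTri hne j b).unique (h ▸ inArc_endTri hne k c)
  subst hjk
  refine ⟨rfl, ?_⟩
  have hjj := hne j
  subst hj
  cases b <;> cases c <;> simp [endNode] at hk ⊢
  · exact hjj hk.symm
  · exact hjj hk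

theorem triangles_at_node (hT : ∀ t ∈ T, t.card = 3) (hne : ∀ j, (ends j).1 ≠ (ends j).2)
    (i : Fin n) (hi : ∃ j b, endNode ends j b = i) :
    {t | t ∈ T ∧ {v, S.node i} ⊆ t} =
      (fun p : Fin m × Bool => S.endTri p.1 p.2) '' {p | endNode ends p.1 p.2 = i} := by
  have hiv : S.node i ≠ v := by
    obtain ⟨j, b, rfl⟩ := hi
    exact node_ne hne j b
  ext t
  constructor
  · rintro ⟨ht, hs⟩
    obtain ⟨j, hj⟩ := exists_inArc (S := S) hT ht (hs (by simp) : v ∈ t)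
    obtain ⟨b, rfl, rfl⟩ := hj.eq_endTri hT hne (hs (by simp) : S.node i ∈ t) hiv
    exact ⟨(j, b), rfl, rfl⟩
  · rintro ⟨⟨j, b⟩, rfl, rfl⟩
    exact ⟨(inArc_endTri hne j b).mem.1, endEdge_subset j b⟩

theorem ncard_at_node (hT : ∀ t ∈ T, t.card = 3) (hne : ∀ j, (ends j).1 ≠ (ends j).2)
    (i : Fin n) (hi : ∃ j b, endNode ends j b = i) :
    {t | t ∈ T ∧ {v, S.node i} ⊆ t}.ncard =
      (Finset.univ.filter fun p : Fin m × Bool => endNode ends p.1 p.2 = i).card := by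
  rw [triangles_at_node hT hne i hi, Set.InjOn.ncard_image, ← Set.ncard_coe_finset]
  · congr 1
    ext
    simp
  · rintro ⟨j, b⟩ hj ⟨k, c⟩ hk h
    obtain ⟨rfl, rfl⟩ := endTri_injective hne hj hk h
    rfl

theorem InArc.rel {j : Fin m} {r : Finset V → Finset V → Prop} (hr : Equivalence r)
    (h : ∀ t t' x, S.InArc j t → S.InArc j t' → x ∉ Set.range S.node → x ≠ v → x ∈ t → x ∈ t' →
      r t t') {t t' : Finset V} (ht : S.InArc j t) (ht' : S.InArc j t') : r t t' := by
  obtain ⟨x, y, rfl, hxy⟩ := ht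
  obtain ⟨x', y', rfl, hxy'⟩ := ht'
  let φ : Sym2 V → Finset V := Sym2.lift ⟨fun x y => {v, x, y}, fun x y => by
    simp only [Finset.pair_comm x y]⟩
  refine S.rel_of_mem_edges (j := j) (r := fun e e' => r (φ e) (φ e'))
    ⟨fun _ => hr.refl _, hr.symm, hr.trans⟩ (fun x y z hx h1 h2 => ?_) hxy hxy'
  have hadj : (linkGraph T v).Adj x y := (S.arc j).adj_of_mem_edges h1
  exact h _ _ x ⟨x, y, rfl, h1⟩ ⟨x, z, rfl, h2⟩ hx hadj.2.1 (by simp [φ]) (by simp [φ])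

end Subdivides

end Around

/-! ### Local regions around an edge -/

section EdgeRegions

variable {V : Type*} [DecidableEq V] (M : ThreeManifold V)

theorem ThreeManifold.eq_or_eq_of_subset {f a b c : Finset V} (hf : f.card = 3) (ha : a ∈ M.tets)
    (hb : b ∈ M.tets) (hc : c ∈ M.tets) (hfa : f ⊆ a) (hfb : f ⊆ b) (hfc : f ⊆ c) (hab : a ≠ b) :
    c = a ∨ c = b := by
  have hff : f ∈ M.complex.faces :=
    (M.complex.isRelLowerSet_faces ha.1).2 hfa (Finset.card_pos.1 (by omega))
  have h2 : {τ | τ ∈ M.complex.faces ∧ τ.card = 4 ∧ f ⊆ τ}.ncard ≤ 2 := by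
    rcases M.triangle_link f hff hf with h | h <;> omega
  have hfin : {τ | τ ∈ M.complex.faces ∧ τ.card = 4 ∧ f ⊆ τ}.Finite :=
    Set.finite_of_ncard_ne_zero (by rcases M.triangle_link f hff hf with h | h <;> omega)
  by_contra hcon
  push Not at hcon
  have hsub : (({a, b, c} : Finset (Finset V)) : Set (Finset V)) ⊆
      {τ | τ ∈ M.complex.faces ∧ τ.card = 4 ∧ f ⊆ τ} := by
    intro x hx
    simp only [Finset.coe_insert, Finset.coe_singleton, Set.mem_insert_iff,
      Set.mem_singleton_iff] at hx
    rcases hx with rfl | rfl | rfl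
    exacts [⟨ha.1, ha.2, hfa⟩, ⟨hb.1, hb.2, hfb⟩, ⟨hc.1, hc.2, hfc⟩]
  have h3 := Set.ncard_le_ncard hsub hfin
  rw [Set.ncard_coe_finset, Finset.card_eq_three.2 ⟨a, b, c, hab, hcon.1.symm, hcon.2.symm, rfl⟩]
    at h3
  omega

variable [Fintype V]

/-- A local region of the complement of a 2-complex at an edge has at most two sides. -/
theorem card_sides_le_two (T : Set (Finset V)) {e τ₀ : Finset V} (he : e.card = 2)
    (hτ₀ : τ₀ ∈ M.tets) (heτ₀ : e ⊆ τ₀) (D : Finset (Finset V × Finset V))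
    (hD : ∀ q ∈ D, q.1 ∈ T ∧ q.1.card = 3 ∧ e ⊆ q.1 ∧ q.1 ⊆ q.2 ∧
      (cutAlong M T).SameCell e τ₀ q.2) : D.card ≤ 2 := by
  classical
  let K : Finset (Finset V) := Finset.univ.filter fun τ => (cutAlong M T).SameCell e τ₀ τ
  have hK : ∀ τ, τ ∈ K ↔ (cutAlong M T).SameCell e τ₀ τ := fun τ => by simp [K]
  have hKtet : ∀ τ ∈ K, τ ∈ M.tets ∧ e ⊆ τ := fun τ hτ =>
    ⟨((hK τ).1 hτ).top_iff.1 hτ₀, ((hK τ).1 hτ).subset_iff.1 heτ₀⟩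
  let Γ : SimpleGraph K := SimpleGraph.mk
    (fun a b => a.1 ≠ b.1 ∧ (a.1 ∩ b.1).card = 3 ∧ a.1 ∩ b.1 ∉ T)
    ⟨fun a b h => ⟨h.1.symm, by rw [Finset.inter_comm]; exact h.2⟩⟩ ⟨fun a h => h.1 rfl⟩
  have hconn : Γ.Connected := by
    have key : ∀ τ τ', (cutAlong M T).SameCell e τ τ' → (τ ∈ K ↔ τ' ∈ K) ∧
        ∀ (h : τ ∈ K) (h' : τ' ∈ K), Γ.Reachable ⟨τ, h⟩ ⟨τ', h'⟩ := by
      intro τ τ' h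
      induction h with
      | rel a b h =>
        refine ⟨?_, fun ha hb => ?_⟩
        · rw [hK, hK]
          have : (cutAlong M T).SameCell e a b := Relation.EqvGen.rel _ _ h
          exact ⟨fun h' => h'.trans this, fun h' => h'.trans this.symm⟩
        · by_cases hab : a = b
          · subst hab
            exact SimpleGraph.Reachable.refl _
          · exact SimpleGraph.Adj.reachable (show Γ.Adj _ _ from ⟨hab, h.2.2.2.2⟩)
      | refl a => exact ⟨Iff.rfl, fun _ _ => SimpleGraph.Reachable.refl _⟩
      | symm a b _ ih => exact ⟨ih.1.symm, fun h h' => (ih.2 h' h).symm⟩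
      | trans a b c _ _ ih ih' =>
        exact ⟨ih.1.trans ih'.1, fun h h' => (ih.2 h (ih.1.1 h)).trans (ih'.2 (ih.1.1 h) h')⟩
    have h0 : τ₀ ∈ K := (hK τ₀).2 (Gluing.SameCell.refl _ _)
    have : Nonempty K := ⟨⟨τ₀, h0⟩⟩
    refine SimpleGraph.Connected.mk fun a b => ?_
    exact ((key _ _ ((hK a.1).1 a.2)).2 h0 a.2).symm.trans ((key _ _ ((hK b.1).1 b.2)).2 h0 b.2)
  let X : Finset (Finset V × Finset V) := K.biUnion fun τ =>
    ((τ \ e).image fun x => insert x e) ×ˢ {τ}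
  have hX : ∀ f τ, τ ∈ K → f.card = 3 → e ⊆ f → f ⊆ τ → (f, τ) ∈ X := by
    intro f τ hτ hf hef hfτ
    have h1 : (f \ e).card = 1 := by rw [Finset.card_sdiff_of_subset hef]; omega
    obtain ⟨x, hx⟩ := Finset.card_eq_one.1 h1
    have hxf : x ∈ f \ e := by rw [hx]; simp
    rw [Finset.mem_sdiff] at hxf
    refine Finset.mem_biUnion.2 ⟨τ, hτ, Finset.mem_product.2 ⟨Finset.mem_image.2
      ⟨x, Finset.mem_sdiff.2 ⟨hfτ hxf.1, hxf.2⟩, ?_⟩, by simp⟩⟩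
    rw [← Finset.sdiff_union_of_subset hef, hx, Finset.insert_eq]
  have hXcard : X.card ≤ K.card * 2 := by
    refine Finset.card_biUnion_le_card_mul _ _ _ fun τ hτ => ?_
    rw [Finset.card_product, Finset.card_singleton, mul_one]
    refine Finset.card_image_le.trans ?_
    rw [Finset.card_sdiff_of_subset (hKtet τ hτ).2, (hKtet τ hτ).1.2, he]
  let Y : Finset (Finset V × Finset V) :=
    (Finset.univ : Finset Γ.Dart).image fun d => (d.fst.1 ∩ d.snd.1, d.fst.1)
  have hYcard : Y.card = 2 * Γ.edgeFinset.card := by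
    rw [← SimpleGraph.dart_card_eq_twice_card_edges, Finset.card_image_of_injective,
      Finset.card_univ]
    intro d d' h
    simp only [Prod.mk.injEq] at h
    have h1 : d.fst = d'.fst := Subtype.ext h.2
    have hd : d.fst.1 ≠ d.snd.1 ∧ (d.fst.1 ∩ d.snd.1).card = 3 ∧ d.fst.1 ∩ d.snd.1 ∉ T := d.adj
    have hd' : d'.fst.1 ≠ d'.snd.1 ∧ (d'.fst.1 ∩ d'.snd.1).card = 3 ∧ _ := d'.adj
    have h2 := M.eq_or_eq_of_subset hd.2.1 (hKtet _ d.fst.2).1 (hKtet _ d.snd.2).1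
      (hKtet _ d'.snd.2).1 Finset.inter_subset_left Finset.inter_subset_right
      (h.1 ▸ Finset.inter_subset_right) hd.1
    have h3 : d'.snd = d.snd := by
      rcases h2 with h2 | h2
      · exact absurd (h2.trans h.2) hd'.1.symm
      · exact Subtype.ext h2
    exact SimpleGraph.Dart.ext _ _ (Prod.ext h1 h3.symm)
  have hYX : Y ⊆ X := by
    intro q hq
    obtain ⟨d, -, rfl⟩ := Finset.mem_image.1 hq
    have hd : d.fst.1 ≠ d.snd.1 ∧ (d.fst.1 ∩ d.snd.1).card = 3 ∧ d.fst.1 ∩ d.snd.1 ∉ T := d.adj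
    exact hX _ _ d.fst.2 hd.2.1 (Finset.subset_inter (hKtet _ d.fst.2).2 (hKtet _ d.snd.2).2)
      Finset.inter_subset_left
  have hDX : D ⊆ X := fun q hq => by
    obtain ⟨-, h3, h4, h5, h6⟩ := hD q hq
    exact hX _ _ ((hK _).2 h6) h3 h4 h5
  have hdisj : Disjoint D Y := by
    rw [Finset.disjoint_left]
    intro q hq hq'
    obtain ⟨d, -, rfl⟩ := Finset.mem_image.1 hq'
    have hd : d.fst.1 ≠ d.snd.1 ∧ (d.fst.1 ∩ d.snd.1).card = 3 ∧ d.fst.1 ∩ d.snd.1 ∉ T := d.adj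
    exact hd.2.2 (hD _ hq).1
  have hle : D.card + Y.card ≤ X.card := by
    rw [← Finset.card_union_of_disjoint hdisj]
    exact Finset.card_le_card (Finset.union_subset hDX hYX)
  have hedge := hconn.card_vert_le_card_edgeSet_add_one
  rw [Nat.card_eq_fintype_card, Fintype.card_coe, Nat.card_eq_fintype_card,
    ← SimpleGraph.edgeFinset_card] at hedge
  omega

end EdgeRegions

namespace BranchedSurface

variable {V : Type*} [DecidableEq V] {M : ThreeManifold V} {B : BranchedSurface M}

theorem card_tri {t : Finset V} (ht : t ∈ B.tri) : t.card = 3 := (B.tri_mem t ht).2.1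

namespace Coorientation

/-- The opposite coorientation. -/
def reverse (o : B.Coorientation) : B.Coorientation where
  back := o.front
  front := o.back
  back_mem := o.front_mem
  front_mem := o.back_mem
  back_ne_front t ht := (o.back_ne_front t ht).symm
  coherent_smooth t ht t' ht' h := (o.coherent_smooth t ht t' ht' h).symm
  coherent_branch e he := by
    obtain ⟨u, l, h, h1, h2, h3⟩ := o.coherent_branch e he
    exact ⟨l, u, by rw [h, Set.pair_comm], h3.symm, h2.symm, h1.symm⟩

/-- At the branch edge `e`, the sheet `u` lies above the sheet `l`. -/
structure UpperLower (o : B.Coorientation) (e u l : Finset V) : Prop where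
  branch : IsBranchEdge B.tri e
  triangles : {t | t ∈ B.tri ∧ e ⊆ t} = {B.maw e, u, l}
  above : B.cut.SameCell e (o.front (B.maw e)) (o.front u)
  between : B.cut.SameCell e (o.back u) (o.front l)
  below : B.cut.SameCell e (o.back l) (o.back (B.maw e))

variable {o : B.Coorientation} {e u l : Finset V}

theorem exists_upperLower (o : B.Coorientation) (he : IsBranchEdge B.tri e) :
    ∃ u l, o.UpperLower e u l := by
  obtain ⟨u, l, h, h1, h2, h3⟩ := o.coherent_branch e he
  exact ⟨u, l, he, h, h1, h2, h3⟩

namespace UpperLower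

theorem reverse (h : o.UpperLower e u l) : o.reverse.UpperLower e l u :=
  ⟨h.branch, by rw [h.triangles, Set.pair_comm], h.below.symm, h.between.symm, h.above.symm⟩

theorem mem_iff (h : o.UpperLower e u l) {t : Finset V} :
    t ∈ B.tri ∧ e ⊆ t ↔ t = B.maw e ∨ t = u ∨ t = l := by
  have := Set.ext_iff.1 h.triangles t
  simpa using this

theorem maw_mem (h : o.UpperLower e u l) : B.maw e ∈ B.tri ∧ e ⊆ B.maw e :=
  h.mem_iff.2 (Or.inl rfl)

theorem upper_mem (h : o.UpperLower e u l) : u ∈ B.tri ∧ e ⊆ u :=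
  h.mem_iff.2 (Or.inr (Or.inl rfl))

theorem lower_mem (h : o.UpperLower e u l) : l ∈ B.tri ∧ e ⊆ l :=
  h.mem_iff.2 (Or.inr (Or.inr rfl))

theorem distinct (h : o.UpperLower e u l) : B.maw e ≠ u ∧ B.maw e ≠ l ∧ u ≠ l := by
  have h3 := h.branch.2
  have hset : {t | t ∈ B.tri ∧ e ⊆ t} =
      (({B.maw e, u, l} : Finset (Finset V)) : Set (Finset V)) := by
    rw [h.triangles]; simp
  rw [hset, Set.ncard_coe_finset] at h3
  refine ⟨?_, ?_, ?_⟩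
  · intro h'
    rw [h', Finset.insert_eq_of_mem (by simp)] at h3
    have := Finset.card_le_two (a := u) (b := l)
    omega
  · intro h'
    rw [h', Finset.insert_eq_of_mem (by simp)] at h3
    have := Finset.card_le_two (a := u) (b := l)
    omega
  · intro h'
    rw [h', Finset.pair_eq_singleton] at h3
    have := Finset.card_le_two (a := B.maw e) (b := l)
    omega

theorem not_sameCell_back [Fintype V] (h : o.UpperLower e u l) :
    ¬ B.cut.SameCell e (o.back u) (o.back l) := by
  intro hc
  obtain ⟨hau, hal, hul⟩ := h.distinct
  have hb : ∀ {t}, t ∈ B.tri ∧ e ⊆ t → t ⊆ o.back t ∧ t ⊆ o.front t ∧ o.back t ≠ o.front t :=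
    fun ht => ⟨(o.back_mem _ ht.1).2, (o.front_mem _ ht.1).2, o.back_ne_front _ ht.1⟩
  have hle := card_sides_le_two M B.tri h.branch.1 (o.back_mem u h.upper_mem.1).1
    (h.upper_mem.2.trans (hb h.upper_mem).1)
    {(u, o.back u), (l, o.front l), (l, o.back l)} (by
      intro q hq
      simp only [Finset.mem_insert, Finset.mem_singleton] at hq
      rcases hq with rfl | rfl | rfl
      · exact ⟨h.upper_mem.1, card_tri h.upper_mem.1, h.upper_mem.2, (hb h.upper_mem).1,
          Gluing.SameCell.refl _ _⟩
      · exact ⟨h.lower_mem.1, card_tri h.lower_mem.1, h.lower_mem.2, (hb h.lower_mem).2.1,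
          h.between⟩
      · exact ⟨h.lower_mem.1, card_tri h.lower_mem.1, h.lower_mem.2, (hb h.lower_mem).1, hc⟩)
  rw [Finset.card_eq_three.2 ⟨_, _, _, ?_, ?_, ?_, rfl⟩] at hle
  · omega
  · exact fun h => hul (Prod.ext_iff.1 h).1
  · exact fun h => hul (Prod.ext_iff.1 h).1
  · exact fun h' => (hb h.lower_mem).2.2 (Prod.ext_iff.1 h').2.symm

end UpperLower

/-! ### The upward horizontal boundary of all regions -/

/-- The sheets of `B`, glued along an edge when they have the same local region behind them: the
disjoint union of the `R₊` of all the regions. -/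
def plusGluing (o : B.Coorientation) : Gluing V where
  top := B.tri
  adj t t' := (t ∩ t').card = 2 ∧ B.cut.SameCell (t ∩ t') (o.back t) (o.back t')

theorem plusGluing_adj_of_sheets_adj {t t' : Finset V} (ht : t ∈ B.tri) (ht' : t' ∈ B.tri)
    (h : B.sheets.adj t t') : o.plusGluing.adj t t' :=
  ⟨h.1, (o.coherent_smooth t ht t' ht' h).1⟩

theorem sheets_adj_of_plusGluing_adj {t t' : Finset V} (h : o.plusGluing.adj t t')
    (he : ¬ IsBranchEdge B.tri (t ∩ t')) : B.sheets.adj t t' :=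
  ⟨h.1, he⟩

theorem plusSame_of_sheetsSame {σ t t' : Finset V} (h : B.sheets.SameCell σ t t') :
    o.plusGluing.SameCell σ t t' :=
  Relation.EqvGen.mono (fun _ _ h => ⟨h.1, h.2.1, h.2.2.1, h.2.2.2.1,
    plusGluing_adj_of_sheets_adj h.1 h.2.1 h.2.2.2.2⟩) _ _ h

theorem back_sameCell_of_plusSame {σ t t' : Finset V} (h : o.plusGluing.SameCell σ t t') :
    B.cut.SameCell σ (o.back t) (o.back t') := by
  refine h.induction (r := fun t t' => B.cut.SameCell σ (o.back t) (o.back t'))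
    ⟨fun _ => Gluing.SameCell.refl _ _, Gluing.SameCell.symm, Gluing.SameCell.trans⟩ ?_
  intro _ _ _ _ hs hs' h
  exact h.2.mono (Finset.subset_inter hs hs')

theorem front_sameCell_of_sheetsSame {σ t t' : Finset V} (h : B.sheets.SameCell σ t t') :
    B.cut.SameCell σ (o.front t) (o.front t') :=
  back_sameCell_of_plusSame (o := o.reverse) (plusSame_of_sheetsSame h)

namespace UpperLower

theorem plusGluing_adj (h : o.UpperLower e u l) : o.plusGluing.adj (B.maw e) l := by
  have := inter_eq_pair (card_tri h.maw_mem.1) (card_tri h.lower_mem.1) h.distinct.2.1 h.branch.1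
    h.maw_mem.2 h.lower_mem.2
  refine ⟨by rw [this]; exact h.branch.1, ?_⟩
  rw [this]
  exact h.below.symm

theorem eq_of_plusGluing_adj [Fintype V] (h : o.UpperLower e u l) {t t' : Finset V}
    (ht : t ∈ B.tri) (ht' : t' ∈ B.tri) (he : t ∩ t' = e) (hadj : o.plusGluing.adj t t') :
    (t = B.maw e ∧ t' = l) ∨ (t = l ∧ t' = B.maw e) := by
  have hs : B.cut.SameCell e (o.back t) (o.back t') := he ▸ hadj.2
  have hne : t ≠ t' := by
    rintro rfl
    have := hadj.1
    rw [Finset.inter_self, card_tri ht] at this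
    omega
  have hul := h.not_sameCell_back
  have hua : ¬ B.cut.SameCell e (o.back u) (o.back (B.maw e)) :=
    fun h' => hul (h'.trans h.below.symm)
  rcases h.mem_iff.1 ⟨ht, he ▸ Finset.inter_subset_left⟩ with rfl | rfl | rfl <;>
    rcases h.mem_iff.1 ⟨ht', he ▸ Finset.inter_subset_right⟩ with rfl | rfl | rfl
  · exact absurd rfl hne
  · exact absurd hs.symm hua
  · exact Or.inl ⟨rfl, rfl⟩
  · exact absurd hs hua
  · exact absurd rfl hne
  · exact absurd hs hul
  · exact Or.inr ⟨rfl, rfl⟩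
  · exact absurd hs.symm hul
  · exact absurd rfl hne

end UpperLower

/-! ### The contribution of an edge -/

theorem sheetsSame_edge_iff (he : IsBranchEdge B.tri e) {t t' : Finset V} :
    B.sheets.SameCell e t t' ↔ t = t' := by
  constructor
  · refine fun h => h.induction (r := Eq) ⟨fun _ => rfl, Eq.symm, Eq.trans⟩ ?_
    intro t t' ht ht' hs hs' h
    have : t ∩ t' = e := (Finset.eq_of_subset_of_card_le (Finset.subset_inter hs hs')
      (by rw [h.1, he.1])).symm
    exact absurd (this ▸ he) h.2
  · rintro rfl
    exact Gluing.SameCell.refl _ _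

open Classical in
theorem sum_edge [Fintype V] (he : e.card = 2) (p : Finset V → Prop)
    (hp : ∀ t t', t ∈ B.tri → t' ∈ B.tri → o.plusGluing.adj t t' → (p t ↔ p t')) :
    ∑ t ∈ B.sheets.star e, (if p t then (1 : ℚ) else 0) / B.sheets.cellSize e t -
      ∑ t ∈ o.plusGluing.star e, (if p t then (1 : ℚ) else 0) / o.plusGluing.cellSize e t =
      if IsBranchEdge B.tri e ∧ p (B.maw e) then 1 else 0 := by
  by_cases hb : IsBranchEdge B.tri e
  · obtain ⟨u, l, h⟩ := o.exists_upperLower hb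
    obtain ⟨hau, hal, hul⟩ := h.distinct
    have hpl : p (B.maw e) ↔ p l := hp _ _ h.maw_mem.1 h.lower_mem.1 h.plusGluing_adj
    have hstar : B.sheets.star e = {B.maw e, u, l} := by
      ext t
      rw [Gluing.mem_star, Finset.mem_insert, Finset.mem_insert, Finset.mem_singleton]
      exact h.mem_iff
    have hstar' : o.plusGluing.star e = {B.maw e, u, l} := hstar
    rw [Gluing.sum_div_cellSize id {B.maw e, u, l} (by simp [hstar])
      (fun t _ t' _ => by simpa using sheetsSame_edge_iff hb)
      (fun t => if p t then 1 else 0) (fun t => if p t then 1 else 0) (fun _ _ => rfl)]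
    rw [Gluing.sum_div_cellSize (fun t => decide (t = u)) {false, true} ?_ ?_
      (fun b : Bool => if b then (if p u then 1 else 0) else (if p l then 1 else 0))
      (fun t => if p t then 1 else 0) ?_]
    · rw [Finset.sum_insert (by simp [hau, hal]), Finset.sum_pair hul,
        Finset.sum_pair (by simp)]
      simp only [hb, hpl, true_and, if_true, Bool.false_eq_true, if_false]
      ring
    · intro b
      cases b <;> simp [hstar', hau]
    · intro t ht t' ht'
      constructor
      · intro hs
        have : t = u ↔ t' = u := by
          refine hs.mem_iff (p := fun t => t = u) fun t t' ht ht' h1 h2 hadj => ?_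
          have hinter : t ∩ t' = e := (Finset.eq_of_subset_of_card_le (Finset.subset_inter h1 h2)
            (by rw [hadj.1, he])).symm
          rcases h.eq_of_plusGluing_adj ht ht' hinter hadj with ⟨rfl, rfl⟩ | ⟨rfl, rfl⟩
          · exact iff_of_false hau hul.symm
          · exact iff_of_false hul.symm hau
        simpa using this
      · intro hl
        have hl : t = u ↔ t' = u := by simpa using hl
        have hal' : o.plusGluing.SameCell e (B.maw e) l :=
          Gluing.SameCell.of_adj h.maw_mem.1 h.lower_mem.1 h.maw_mem.2 h.lower_mem.2
            h.plusGluing_adj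
        rw [hstar'] at ht ht'
        simp only [Finset.mem_insert, Finset.mem_singleton] at ht ht'
        rcases ht with rfl | rfl | rfl <;> rcases ht' with rfl | rfl | rfl
        · exact Gluing.SameCell.refl _ _
        · exact absurd (hl.2 rfl) hau
        · exact hal'
        · exact absurd (hl.1 rfl) hau
        · exact Gluing.SameCell.refl _ _
        · exact absurd (hl.1 rfl) hul.symm
        · exact hal'.symm
        · exact absurd (hl.2 rfl) hul.symm
        · exact Gluing.SameCell.refl _ _
    · intro t ht
      rw [hstar'] at ht
      simp only [Finset.mem_insert, Finset.mem_singleton] at ht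
      rcases ht with rfl | rfl | rfl
      · simp [hau, hpl]
      · simp
      · simp [hul.symm]
  · have hiff : ∀ t t', B.sheets.SameCell e t t' ↔ o.plusGluing.SameCell e t t' := by
      refine fun t t' => ⟨plusSame_of_sheetsSame, fun h => Relation.EqvGen.mono ?_ _ _ h⟩
      rintro t t' ⟨ht, ht', h1, h2, hadj⟩
      have hinter : t ∩ t' = e := (Finset.eq_of_subset_of_card_le (Finset.subset_inter h1 h2)
        (by rw [hadj.1, he])).symm
      exact ⟨ht, ht', h1, h2, sheets_adj_of_plusGluing_adj hadj (hinter ▸ hb)⟩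
    have hsize : ∀ t, B.sheets.cellSize e t = o.plusGluing.cellSize e t := by
      intro t
      simp only [Gluing.cellSize, hiff]
      rfl
    simp only [hsize, hb, false_and, if_false]
    exact sub_self _

end Coorientation

end BranchedSurface

namespace Subdivides

/-- The number of ends of arcs at the node `i`. -/
def nodeDegree {n m : ℕ} (ends : Fin m → Fin n × Fin n) (i : Fin n) : ℕ :=
  (Finset.univ.filter fun p : Fin m × Bool => endNode ends p.1 p.2 = i).card

end Subdivides

open Subdivides

/-! ### Corners of sectors at a vertex -/

namespace BranchedSurface

variable {V : Type*} [DecidableEq V] {M : ThreeManifold V} (B : BranchedSurface M)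
  (nu : M.BdryOrientation)

/-- The corner at `v` of the sector containing the triangle `t` is a double corner. -/
def DoubleCornerAt (v : V) (t : Finset V) : Prop :=
  ∃ e₁ t₁ e₂ t₂ : Finset V, B.sheets.SameCell {v} t t₁ ∧ B.sheets.SameCell {v} t t₂ ∧
    e₁.card = 2 ∧ v ∈ e₁ ∧ e₁ ⊆ t₁ ∧ B.MawInward nu e₁ t₁ ∧
    e₂.card = 2 ∧ v ∈ e₂ ∧ e₂ ⊆ t₂ ∧ B.MawOutward nu e₂ t₂

variable {B nu} {v : V}

theorem sheetsSame_of_inArc {n m : ℕ} {ends : Fin m → Fin n × Fin n}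
    {S : Subdivides (linkGraph B.tri v) ends} {j : Fin m} {t t' : Finset V} (h : S.InArc j t)
    (h' : S.InArc j t') : B.sheets.SameCell {v} t t' := by
  refine InArc.rel (r := B.sheets.SameCell {v}) ⟨fun _ => Gluing.SameCell.refl _ _,
    Gluing.SameCell.symm, Gluing.SameCell.trans⟩ ?_ h h'
  intro t t' x h h' hx hxv hxt hxt'
  by_cases htt : t = t'
  · subst htt
    exact Gluing.SameCell.refl _ _
  have hs : ({v, x} : Finset V) ⊆ t := by
    simp [Finset.insert_subset_iff, h.mem.2, hxt]
  have hs' : ({v, x} : Finset V) ⊆ t' := by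
    simp [Finset.insert_subset_iff, h'.mem.2, hxt']
  have hinter := inter_eq_pair (card_tri h.mem.1) (card_tri h'.mem.1) htt
    (Finset.card_pair hxv.symm) hs hs'
  refine Gluing.SameCell.of_adj h.mem.1 h'.mem.1 (by simpa using h.mem.2) (by simpa using h'.mem.2)
    ⟨by rw [hinter, Finset.card_pair hxv.symm], ?_⟩
  rw [hinter]
  intro hb
  have := ncard_of_notMem_range (S := S) (fun _ => card_tri) hx hxv h.mem.1 hs
  have := hb.2
  omega

/-- The arcs of the link of `v` are the corners at `v` of the sectors, that is, every node of the
link lies in the branching locus or in the boundary of `M`. -/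
structure CornerModel {n m : ℕ} {ends : Fin m → Fin n × Fin n}
    (S : Subdivides (linkGraph B.tri v) ends) : Prop where
  ne : ∀ j, (ends j).1 ≠ (ends j).2
  used : ∀ i, ∃ j b, endNode ends j b = i
  degree : ∀ i, nodeDegree ends i = 1 ∨ nodeDegree ends i = 3
  bdry : ∀ t ∈ B.tri, v ∈ t → ∀ x ∈ t, x ≠ v →
    (M.IsBdry {v, x} ↔ ∃ i, x = S.node i ∧ nodeDegree ends i = 1)

namespace CornerModel

variable {n m : ℕ} {ends : Fin m → Fin n × Fin n} {S : Subdivides (linkGraph B.tri v) ends}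

theorem node_ne (hS : CornerModel S) (i : Fin n) : S.node i ≠ v := by
  obtain ⟨j, b, rfl⟩ := hS.used i
  exact Subdivides.node_ne hS.ne j b

theorem isBranchEdge_iff (hS : CornerModel S) (i : Fin n) :
    IsBranchEdge B.tri {v, S.node i} ↔ nodeDegree ends i = 3 := by
  rw [IsBranchEdge, Finset.card_pair (hS.node_ne i).symm,
    ncard_at_node (fun _ => card_tri) hS.ne i (hS.used i)]
  exact and_iff_right rfl

theorem exists_node_of_isBranchEdge (hS : CornerModel S) {e : Finset V}
    (he : IsBranchEdge B.tri e) (hv : v ∈ e) :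
    ∃ i, e = {v, S.node i} ∧ nodeDegree ends i = 3 := by
  obtain ⟨x, hxv, rfl⟩ := exists_eq_pair he.1 hv
  obtain ⟨t, ht, hs⟩ : {t | t ∈ B.tri ∧ {v, x} ⊆ t}.Nonempty :=
    Set.nonempty_of_ncard_ne_zero (by rw [he.2]; norm_num)
  by_cases hx : x ∈ Set.range S.node
  · obtain ⟨i, rfl⟩ := hx
    exact ⟨i, rfl, (hS.isBranchEdge_iff i).1 he⟩
  · have := ncard_of_notMem_range (S := S) (fun _ => card_tri) hx hxv ht hs
    have := he.2
    omega

theorem sheetsSame_iff (hS : CornerModel S) {j k : Fin m} {t t' : Finset V} (h : S.InArc j t)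
    (hk : S.InArc k t') : B.sheets.SameCell {v} t t' ↔ j = k := by
  constructor
  · intro hs
    have : S.InArc j t ↔ S.InArc j t' := by
      refine hs.mem_iff (p := S.InArc j) fun t t' ht ht' hvt hvt' hadj => ?_
      rw [Finset.singleton_subset_iff] at hvt hvt'
      obtain ⟨x, hxv, he⟩ := exists_eq_pair hadj.1 (Finset.mem_inter.2 ⟨hvt, hvt'⟩)
      have hxt : x ∈ t ∩ t' := by rw [he]; simp
      rw [Finset.mem_inter] at hxt
      have hne : t ≠ t' := by
        rintro rfl
        have := hadj.1
        rw [Finset.inter_self, card_tri ht] at this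
        omega
      by_cases hx : x ∈ Set.range S.node
      · exfalso
        obtain ⟨i, rfl⟩ := hx
        rcases hS.degree i with hd | hd
        · have h1 : {t | t ∈ B.tri ∧ {v, S.node i} ⊆ t}.ncard = 1 := by
            rw [ncard_at_node (fun _ => card_tri) hS.ne i (hS.used i)]
            exact hd
          obtain ⟨a, ha⟩ := Set.ncard_eq_one.1 h1
          have ht1 : t ∈ ({a} : Set (Finset V)) := ha ▸ ⟨ht, he ▸ Finset.inter_subset_left⟩
          have ht2 : t' ∈ ({a} : Set (Finset V)) := ha ▸ ⟨ht', he ▸ Finset.inter_subset_right⟩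
          exact hne (ht1.trans ht2.symm)
        · exact hadj.2 (he ▸ (hS.isBranchEdge_iff i).2 hd)
      · exact ⟨fun h => h.of_mem_of_mem (fun _ => card_tri) hx hxv hxt.1 ht' hvt' hxt.2,
          fun h => h.of_mem_of_mem (fun _ => card_tri) hx hxv hxt.2 ht hvt hxt.1⟩
    exact (this.1 h).unique hk
  · rintro rfl
    exact sheetsSame_of_inArc h hk

/-- The maw vector field points into the sector at the end `b` of the arc `j`. -/
def InwardEnd (nu : M.BdryOrientation) (S : Subdivides (linkGraph B.tri v) ends) (j : Fin m)
    (b : Bool) : Prop :=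
  B.MawInward nu (S.endEdge j b) (S.endTri j b)

theorem isBdry_endEdge_iff (hS : CornerModel S) (j : Fin m) (b : Bool) :
    M.IsBdry (S.endEdge j b) ↔ nodeDegree ends (endNode ends j b) = 1 := by
  have hin := inArc_endTri (S := S) hS.ne j b
  rw [endEdge, hS.bdry _ hin.mem.1 hin.mem.2 _ (by simp [endTri]) (hS.node_ne _)]
  constructor
  · rintro ⟨i, hi, hd⟩
    rwa [S.node_injective hi]
  · exact fun h => ⟨_, rfl, h⟩

theorem inwardEnd_of_degree_three (hS : CornerModel S) {j : Fin m} {b : Bool}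
    (h : nodeDegree ends (endNode ends j b) = 3) :
    InwardEnd nu S j b ↔ B.maw (S.endEdge j b) = S.endTri j b := by
  have h1 : ¬ M.IsBdry (S.endEdge j b) := by rw [hS.isBdry_endEdge_iff]; omega
  have h2 : IsBranchEdge B.tri (S.endEdge j b) := (hS.isBranchEdge_iff _).2 h
  simp [InwardEnd, MawInward, h1, h2]

theorem inwardEnd_of_degree_one (hS : CornerModel S) {j : Fin m} {b : Bool}
    (h : nodeDegree ends (endNode ends j b) = 1) : InwardEnd nu S j b ↔ ¬ nu.outward v := by
  have h1 : M.IsBdry (S.endEdge j b) := (hS.isBdry_endEdge_iff j b).2 h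
  have h2 : ¬ IsBranchEdge B.tri (S.endEdge j b) := by
    rw [endEdge, hS.isBranchEdge_iff]; omega
  have h3 := nu.locally_constant _ _ h1
  simp only [endEdge] at h1 h2
  simp [InwardEnd, MawInward, h1, h2, endEdge, h3]

theorem mawOutward_endEdge_iff (hS : CornerModel S) (j : Fin m) (b : Bool) :
    B.MawOutward nu (S.endEdge j b) (S.endTri j b) ↔ ¬ InwardEnd nu S j b := by
  rcases hS.degree (endNode ends j b) with hd | hd
  · rw [hS.inwardEnd_of_degree_one hd]
    have h1 : M.IsBdry (S.endEdge j b) := (hS.isBdry_endEdge_iff j b).2 hd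
    have h2 : ¬ IsBranchEdge B.tri (S.endEdge j b) := by
      rw [endEdge, hS.isBranchEdge_iff]; omega
    have h3 := nu.locally_constant _ _ h1
    simp only [endEdge] at h1 h2
    simp [MawOutward, h1, h2, endEdge, h3]
  · rw [hS.inwardEnd_of_degree_three hd]
    have h1 : ¬ M.IsBdry (S.endEdge j b) := by rw [hS.isBdry_endEdge_iff]; omega
    have h2 : IsBranchEdge B.tri (S.endEdge j b) := (hS.isBranchEdge_iff _).2 hd
    simp [MawOutward, h1, h2]

theorem eq_end_of_maw (hS : CornerModel S) {j : Fin m} {e t : Finset V} (ht : S.InArc j t)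
    (he : e.card = 2) (hv : v ∈ e) (hs : e ⊆ t) (h : IsBranchEdge B.tri e ∨ M.IsBdry e) :
    ∃ b, e = S.endEdge j b ∧ t = S.endTri j b := by
  have : ∃ i, e = {v, S.node i} := by
    rcases h with h | h
    · obtain ⟨i, hi, -⟩ := hS.exists_node_of_isBranchEdge h hv
      exact ⟨i, hi⟩
    · obtain ⟨x, hxv, rfl⟩ := exists_eq_pair he hv
      obtain ⟨i, rfl, -⟩ := (hS.bdry t ht.mem.1 ht.mem.2 x (hs (by simp)) hxv).1 h
      exact ⟨i, rfl⟩
  obtain ⟨i, rfl⟩ := this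
  obtain ⟨b, rfl, rfl⟩ := ht.eq_endTri (fun _ => card_tri) hS.ne (hs (by simp) : S.node i ∈ t)
    (hS.node_ne i)
  exact ⟨b, rfl, rfl⟩

theorem doubleCornerAt_iff (hS : CornerModel S) {j : Fin m} {t : Finset V} (ht : S.InArc j t) :
    B.DoubleCornerAt nu v t ↔ ¬ (InwardEnd nu S j false ↔ InwardEnd nu S j true) := by
  have hj : ∀ {t'}, B.sheets.SameCell {v} t t' → S.InArc j t' := by
    intro t' h
    have h1 : t' ∈ B.tri := h.top_iff.1 ht.mem.1
    have h2 : v ∈ t' := by simpa using h.subset_iff.1 (by simpa using ht.mem.2)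
    obtain ⟨k, hk⟩ := exists_inArc (S := S) (fun _ => card_tri) h1 h2
    rwa [(hS.sheetsSame_iff ht hk).1 h]
  constructor
  · rintro ⟨e₁, t₁, e₂, t₂, h1, h2, c1, v1, s1, m1, c2, v2, s2, m2⟩
    obtain ⟨b, rfl, rfl⟩ := hS.eq_end_of_maw (hj h1) c1 v1 s1
      (m1.imp (fun h => h.1) fun h => h.1)
    obtain ⟨c, rfl, rfl⟩ := hS.eq_end_of_maw (hj h2) c2 v2 s2
      (m2.imp (fun h => h.1) fun h => h.1)
    rw [hS.mawOutward_endEdge_iff] at m2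
    change InwardEnd nu S j b at m1
    cases b <;> cases c <;> tauto
  · intro h
    obtain ⟨b, c, hb, hc⟩ : ∃ b c, InwardEnd nu S j b ∧ ¬ InwardEnd nu S j c := by
      by_cases h1 : InwardEnd nu S j false
      · exact ⟨false, true, h1, fun h2 => h (iff_of_true h1 h2)⟩
      · exact ⟨true, false, by_contra fun h2 => h (iff_of_false h1 h2), h1⟩
    exact ⟨_, _, _, _, sheetsSame_of_inArc ht (inArc_endTri hS.ne j b),
      sheetsSame_of_inArc ht (inArc_endTri hS.ne j c), card_endEdge hS.ne j b, mem_endEdge j b,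
      endEdge_subset j b, hb, card_endEdge hS.ne j c, mem_endEdge j c, endEdge_subset j c,
      (hS.mawOutward_endEdge_iff j c).2 hc⟩

/-! ### Sums over the corners at a vertex -/

/-- The arc of a triangle at `v`. -/
def arcOf [NeZero m] (S : Subdivides (linkGraph B.tri v) ends) (t : Finset V) : Fin m :=
  open Classical in if h : ∃ j, S.InArc j t then h.choose else 0

theorem arcOf_eq [NeZero m] {j : Fin m} {t : Finset V} (h : S.InArc j t) : arcOf S t = j := by
  have : ∃ j, S.InArc j t := ⟨j, h⟩
  rw [arcOf, dif_pos this]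
  exact this.choose_spec.unique h

variable [Fintype V]

theorem exists_inArc_of_mem_star {t : Finset V} (ht : t ∈ B.sheets.star {v}) :
    ∃ j, S.InArc j t := by
  rw [Gluing.mem_star, Finset.singleton_subset_iff] at ht
  exact exists_inArc (S := S) (fun _ => card_tri) ht.1 ht.2

theorem mem_star_of_inArc {j : Fin m} {t : Finset V} (ht : S.InArc j t) :
    t ∈ B.sheets.star {v} := by
  rw [Gluing.mem_star, Finset.singleton_subset_iff]
  exact ht.mem

theorem sum_sheets [NeZero m] (hS : CornerModel S) (f : Finset V → ℚ) (g : Fin m → ℚ)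
    (h : ∀ j t, S.InArc j t → f t = g j) :
    ∑ t ∈ B.sheets.star {v}, f t / B.sheets.cellSize {v} t = ∑ j, g j := by
  refine Gluing.sum_div_cellSize (arcOf S) Finset.univ (fun j => ?_) (fun t ht t' ht' => ?_) g f
    (fun t ht => ?_)
  · have hj := inArc_endTri (S := S) hS.ne j false
    exact iff_of_true (Finset.mem_univ _) ⟨_, mem_star_of_inArc hj, arcOf_eq hj⟩
  · obtain ⟨j, hj⟩ := exists_inArc_of_mem_star (S := S) ht
    obtain ⟨k, hk⟩ := exists_inArc_of_mem_star (S := S) ht'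
    rw [hS.sheetsSame_iff hj hk, arcOf_eq hj, arcOf_eq hk]
  · obtain ⟨j, hj⟩ := exists_inArc_of_mem_star (S := S) ht
    rw [h j t hj, arcOf_eq hj]

theorem sum_plus [NeZero m] (hS : CornerModel S) {o : B.Coorientation} {ι : Type*}
    (lab : Fin m → ι) (I : Finset ι) (hI : ∀ i, i ∈ I ↔ ∃ j, lab j = i)
    (hlab : ∀ j k t t', S.InArc j t → S.InArc k t' →
      (o.plusGluing.SameCell {v} t t' ↔ lab j = lab k)) (f : Finset V → ℚ) (g : ι → ℚ)
    (h : ∀ j t, S.InArc j t → f t = g (lab j)) :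
    ∑ t ∈ o.plusGluing.star {v}, f t / o.plusGluing.cellSize {v} t = ∑ i ∈ I, g i := by
  refine Gluing.sum_div_cellSize (fun t => lab (arcOf S t)) I (fun i => ?_)
    (fun t ht t' ht' => ?_) g f (fun t ht => ?_)
  · rw [hI]
    constructor
    · rintro ⟨j, rfl⟩
      exact ⟨_, mem_star_of_inArc (inArc_endTri hS.ne j false),
        by rw [arcOf_eq (inArc_endTri hS.ne j false)]⟩
    · rintro ⟨t, -, rfl⟩
      exact ⟨_, rfl⟩
  · obtain ⟨j, hj⟩ := exists_inArc_of_mem_star (S := S) ht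
    obtain ⟨k, hk⟩ := exists_inArc_of_mem_star (S := S) ht'
    rw [hlab j k t t' hj hk, arcOf_eq hj, arcOf_eq hk]
  · obtain ⟨j, hj⟩ := exists_inArc_of_mem_star (S := S) ht
    rw [h j t hj, arcOf_eq hj]

open Classical in
theorem sum_branchEdges (hS : CornerModel S) (p : Finset V → Prop) :
    ∑ e with v ∈ e, (if IsBranchEdge B.tri e ∧ p (B.maw e) then (1 : ℚ) else 0) =
      ∑ i with nodeDegree ends i = 3, if p (B.maw {v, S.node i}) then 1 else 0 := by
  symm
  refine Finset.sum_of_injOn (fun i => {v, S.node i}) ?_ ?_ ?_ ?_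
  · intro i _ k _ h
    have : S.node i ∈ ({v, S.node k} : Finset V) := by
      have h' : ({v, S.node i} : Finset V) = {v, S.node k} := h
      rw [← h']
      simp
    rcases Finset.mem_insert.1 this with h | h
    · exact absurd h (hS.node_ne i)
    · exact S.node_injective (Finset.mem_singleton.1 h)
  · intro i _
    simp
  · intro e he h
    rw [if_neg]
    rintro ⟨hb, -⟩
    obtain ⟨i, rfl, hi⟩ := hS.exists_node_of_isBranchEdge hb (Finset.mem_filter.1 he).2
    exact h ⟨i, by simpa using hi, rfl⟩
  · intro i hi
    rw [Finset.mem_filter] at hi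
    simp [(hS.isBranchEdge_iff i).2 hi.2]

open Classical in
theorem sum_inward (hS : CornerModel S) (q : Finset V → Prop) :
    ∑ t ∈ B.sheets.star {v}, ∑ e ∈ t.powerset with e.card = 2 ∧ v ∈ e,
        (if q t ∧ B.MawInward nu e t then (1 : ℚ) else 0) =
      ∑ j, ∑ b, if q (S.endTri j b) ∧ InwardEnd nu S j b then 1 else 0 := by
  rw [Finset.sum_sigma', ← Finset.sum_product', Finset.univ_product_univ]
  symm
  refine Finset.sum_of_injOn (fun p => ⟨S.endTri p.1 p.2, S.endEdge p.1 p.2⟩) ?_ ?_ ?_ ?_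
  · rintro ⟨j, b⟩ _ ⟨k, c⟩ _ h
    simp only [Sigma.mk.injEq, heq_eq_eq] at h
    have hn : endNode ends k c = endNode ends j b := by
      have : S.node (endNode ends j b) ∈ S.endEdge k c := by rw [← h.2]; simp [endEdge]
      rcases Finset.mem_insert.1 this with h | h
      · exact absurd h (hS.node_ne _)
      · exact (S.node_injective (Finset.mem_singleton.1 h)).symm
    obtain ⟨rfl, rfl⟩ := endTri_injective hS.ne rfl hn h.1
    rfl
  · rintro ⟨j, b⟩ _
    simp only [Finset.coe_sigma, Set.mem_sigma_iff, Finset.mem_coe, Finset.mem_filter,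
      Finset.mem_powerset]
    exact ⟨mem_star_of_inArc (inArc_endTri hS.ne j b), endEdge_subset j b,
      card_endEdge hS.ne j b, mem_endEdge j b⟩
  · rintro ⟨t, e⟩ he h
    simp only [Finset.mem_sigma, Finset.mem_filter, Finset.mem_powerset] at he
    dsimp only
    rw [if_neg]
    rintro ⟨-, hm⟩
    obtain ⟨j, hj⟩ := exists_inArc_of_mem_star (S := S) he.1
    obtain ⟨b, rfl, rfl⟩ := hS.eq_end_of_maw hj he.2.2.1 he.2.2.2 he.2.1
      (hm.imp (fun h => h.1) fun h => h.1)
    exact h ⟨(j, b), by simp, rfl⟩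
  · rintro ⟨j, b⟩ _
    rfl

open Classical in
/-- Up to an even number, the number of double corners at `v` is the number of edges at `v` along
which the maw vector field points inward. -/
theorem sum_doubleCornerAt [NeZero m] (hS : CornerModel S) (q : Finset V → Prop)
    (hq : ∀ t t', B.sheets.SameCell {v} t t' → (q t ↔ q t')) :
    ∃ k : ℤ, ∑ t ∈ B.sheets.star {v},
        (if q t ∧ B.DoubleCornerAt nu v t then (1 : ℚ) else 0) / B.sheets.cellSize {v} t =
      ∑ t ∈ B.sheets.star {v}, ∑ e ∈ t.powerset with e.card = 2 ∧ v ∈ e,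
        (if q t ∧ B.MawInward nu e t then (1 : ℚ) else 0) - 2 * k := by
  rw [hS.sum_inward, hS.sum_sheets _
    (fun j => if q (S.endTri j false) ∧ ¬ (InwardEnd nu S j false ↔ InwardEnd nu S j true)
      then 1 else 0)]
  · refine ⟨∑ j, if q (S.endTri j false) ∧ InwardEnd nu S j false ∧ InwardEnd nu S j true
      then 1 else 0, ?_⟩
    rw [Int.cast_sum, Finset.mul_sum, ← Finset.sum_sub_distrib]
    refine Finset.sum_congr rfl fun j _ => ?_
    have hq' : q (S.endTri j true) ↔ q (S.endTri j false) :=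
      hq _ _ (sheetsSame_of_inArc (inArc_endTri hS.ne j true) (inArc_endTri hS.ne j false))
    rw [Fintype.sum_bool, hq']
    by_cases h0 : q (S.endTri j false) <;> by_cases h1 : InwardEnd nu S j false <;>
      by_cases h2 : InwardEnd nu S j true <;> simp [h0, h1, h2]
    norm_num
  · intro j t ht
    simp only [hS.doubleCornerAt_iff ht,
      hq t _ (sheetsSame_of_inArc ht (inArc_endTri hS.ne j false))]

end CornerModel

end BranchedSurface

namespace BranchedSurface

variable {V : Type*} [DecidableEq V] {M : ThreeManifold V} {B : BranchedSurface M} {v : V}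

/-! ### The contribution of a vertex -/

namespace Coorientation

/-- The vertex `v` lies in an inward boundary component, and the local region between the two
tangent sheets at `v` belongs to `C`. -/
def IsInwardCusp (o : B.Coorientation) (nu : M.BdryOrientation) (C : B.Region) (v : V) : Prop :=
  M.IsBdry {v} ∧ ¬ nu.outward v ∧
    ∃ e u l, v ∈ e ∧ o.UpperLower e u l ∧ B.cut.InPiece C (o.back u)

open Classical in
/-- The difference of the contributions of `v` to the maw Euler characteristics of the sectors in
front of `C` and to the Euler characteristic of `R₊(C)`. -/
def VertexFormula [Fintype V] (o : B.Coorientation) (nu : M.BdryOrientation) (C : B.Region)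
    (v : V) : Prop :=
  ∑ t ∈ B.sheets.star {v}, (if B.cut.InPiece C (o.back t) then
      1 - (if B.DoubleCornerAt nu v t then (1 / 2 : ℚ) else 0) else 0) / B.sheets.cellSize {v} t -
    ∑ t ∈ o.plusGluing.star {v}, (if B.cut.InPiece C (o.back t) then (1 : ℚ) else 0) /
      o.plusGluing.cellSize {v} t =
  1 / 2 * ∑ e with v ∈ e,
      (if IsBranchEdge B.tri e ∧ B.cut.InPiece C (o.back (B.maw e)) then (1 : ℚ) else 0) -
    1 / 2 * if o.IsInwardCusp nu C v then 1 else 0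

variable {o : B.Coorientation} {nu : M.BdryOrientation} {C : B.Region}

theorem isBdry_mono {σ τ : Finset V} (h : M.IsBdry τ) (hs : σ ⊆ τ) : M.IsBdry σ := by
  obtain ⟨f, hf, h3, hτ, h1⟩ := h
  exact ⟨f, hf, h3, hs.trans hτ, h1⟩

theorem not_doubleCornerAt_of_no_branch (h : ∀ e, v ∈ e → ¬ IsBranchEdge B.tri e) (t : Finset V) :
    ¬ B.DoubleCornerAt nu v t := by
  rintro ⟨e₁, t₁, e₂, t₂, -, -, -, v1, -, m1, -, v2, -, m2⟩
  rcases m1 with m1 | m1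
  · exact h e₁ v1 m1.1
  rcases m2 with m2 | m2
  · exact h e₂ v2 m2.1
  exact m1.2 v v1 (m2.2 v v2)

theorem vertexFormula_of_no_branch [Fintype V] (h : ∀ e, v ∈ e → ¬ IsBranchEdge B.tri e) :
    o.VertexFormula nu C v := by
  classical
  have hiff : ∀ t t', B.sheets.SameCell {v} t t' ↔ o.plusGluing.SameCell {v} t t' := by
    refine fun t t' => ⟨plusSame_of_sheetsSame, fun h' => Relation.EqvGen.mono ?_ _ _ h'⟩
    rintro t t' ⟨ht, ht', h1, h2, hadj⟩
    exact ⟨ht, ht', h1, h2, sheets_adj_of_plusGluing_adj hadj (h _ (by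
      simpa using Finset.subset_inter h1 h2))⟩
  have hsize : ∀ t, B.sheets.cellSize {v} t = o.plusGluing.cellSize {v} t := by
    intro t
    simp only [Gluing.cellSize, hiff]
    rfl
  have hcusp : ¬ o.IsInwardCusp nu C v := by
    rintro ⟨-, -, e, u, l, hv, hul, -⟩
    exact h e hv hul.branch
  rw [VertexFormula, Finset.sum_eq_zero (s := Finset.univ.filter fun e => v ∈ e)]
  · simp only [hsize, not_doubleCornerAt_of_no_branch h, hcusp, if_false, sub_zero, mul_zero]
    exact sub_self _
  · intro e he
    rw [if_neg]
    exact fun h' => h e (Finset.mem_filter.1 he).2 h'.1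

section Labels

variable {n m : ℕ} {ends : Fin m → Fin n × Fin n} {S : Subdivides (linkGraph B.tri v) ends}

/-- The local regions in front of and behind each of the arcs. -/
theorem exists_labels (o : B.Coorientation) (hne : ∀ j, (ends j).1 ≠ (ends j).2) {F : ℕ}
    {borders : Fin m → Fin F → Prop} (hloc : HasLocalRegions M B.tri v S F borders)
    (br : Fin m → Fin F × Fin F)
    (hbr : ∀ k, (br k).1 ≠ (br k).2 ∧ borders k (br k).1 ∧ borders k (br k).2) :
    ∃ r : Fin F → Finset V, (∀ i j, B.cut.SameCell {v} (r i) (r j) → i = j) ∧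
      ∃ Fr Bk : Fin m → Fin F,
        (∀ k, (Fr k = (br k).1 ∧ Bk k = (br k).2) ∨ (Fr k = (br k).2 ∧ Bk k = (br k).1)) ∧
        ∀ k t, S.InArc k t → B.cut.SameCell {v} (o.front t) (r (Fr k)) ∧
          B.cut.SameCell {v} (o.back t) (r (Bk k)) := by
  obtain ⟨r, -, hr, hb⟩ := hloc
  refine ⟨r, fun i j h => by_contra fun hij => hr i j hij h, ?_⟩
  have key : ∀ k, ∃ f b : Fin F, ((f = (br k).1 ∧ b = (br k).2) ∨ (f = (br k).2 ∧ b = (br k).1)) ∧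
      ∀ t, S.InArc k t → B.cut.SameCell {v} (o.front t) (r f) ∧
        B.cut.SameCell {v} (o.back t) (r b) := by
    intro k
    have hin := inArc_endTri (S := S) hne k false
    obtain ⟨hk, hk1, hk2⟩ := hbr k
    obtain ⟨τ₁, ht1, hs1, hc1⟩ := hb k _ _ (S.nbr_mem_edges hne k false) _ hk1
    obtain ⟨τ₂, ht2, hs2, hc2⟩ := hb k _ _ (S.nbr_mem_edges hne k false) _ hk2
    have hτ : τ₁ ≠ τ₂ := by
      rintro rfl
      exact hr _ _ hk (hc1.symm.trans hc2)
    have hc3 : (S.endTri k false).card = 3 := card_tri hin.mem.1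
    have hfm := o.front_mem _ hin.mem.1
    have hbm := o.back_mem _ hin.mem.1
    have hfb := o.back_ne_front _ hin.mem.1
    have hf := M.eq_or_eq_of_subset hc3 ht1 ht2 hfm.1 hs1 hs2 hfm.2 hτ
    have hb := M.eq_or_eq_of_subset hc3 ht1 ht2 hbm.1 hs1 hs2 hbm.2 hτ
    have spread : ∀ f b, B.cut.SameCell {v} (o.front (S.endTri k false)) (r f) →
        B.cut.SameCell {v} (o.back (S.endTri k false)) (r b) → ∀ t, S.InArc k t →
        B.cut.SameCell {v} (o.front t) (r f) ∧ B.cut.SameCell {v} (o.back t) (r b) := by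
      intro f b h1 h2 t ht
      have hs := sheetsSame_of_inArc ht hin
      exact ⟨(front_sameCell_of_sheetsSame hs).trans h1,
        (back_sameCell_of_plusSame (plusSame_of_sheetsSame hs)).trans h2⟩
    rcases hf with hf | hf <;> rcases hb with hb | hb
    · exact absurd (hb.trans hf.symm) hfb
    · exact ⟨_, _, Or.inl ⟨rfl, rfl⟩, spread _ _ (hf ▸ hc1) (hb ▸ hc2)⟩
    · exact ⟨_, _, Or.inr ⟨rfl, rfl⟩, spread _ _ (hf ▸ hc2) (hb ▸ hc1)⟩
    · exact absurd (hb.trans hf.symm) hfb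
  choose Fr Bk h1 h2 using key
  exact ⟨Fr, Bk, h1, h2⟩

theorem upperLower_at_node (o : B.Coorientation) (hS : CornerModel S) {i : Fin n}
    (hd : nodeDegree ends i = 3) {pm px py : Fin m × Bool}
    (hm : B.maw {v, S.node i} = S.endTri pm.1 pm.2)
    (hp : ∀ p : Fin m × Bool, endNode ends p.1 p.2 = i → p = pm ∨ p = px ∨ p = py) :
    o.UpperLower {v, S.node i} (S.endTri px.1 px.2) (S.endTri py.1 py.2) ∨
      o.UpperLower {v, S.node i} (S.endTri py.1 py.2) (S.endTri px.1 px.2) := by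
  obtain ⟨u, l, h⟩ := o.exists_upperLower ((hS.isBranchEdge_iff i).2 hd)
  obtain ⟨hau, hal, hul⟩ := h.distinct
  have key : ∀ t, t ∈ B.tri ∧ {v, S.node i} ⊆ t → B.maw {v, S.node i} ≠ t →
      t = S.endTri px.1 px.2 ∨ t = S.endTri py.1 py.2 := by
    intro t ht hne
    have ht' : t ∈ {t | t ∈ B.tri ∧ {v, S.node i} ⊆ t} := ht
    rw [triangles_at_node (fun _ => card_tri) hS.ne i (hS.used i)] at ht'
    obtain ⟨p, hpi, rfl⟩ := ht'
    rcases hp p hpi with rfl | rfl | rfl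
    · exact absurd hm hne
    · exact Or.inl rfl
    · exact Or.inr rfl
  rcases key u h.upper_mem hau with rfl | rfl <;> rcases key l h.lower_mem hal with rfl | rfl
  · exact absurd rfl hul
  · exact Or.inl h
  · exact Or.inr h
  · exact absurd rfl hul

theorem UpperLower.labels {e u l : Finset V} (h : o.UpperLower e u l) (hv : v ∈ e) {F : ℕ}
    {r : Fin F → Finset V} (hr : ∀ i j, B.cut.SameCell {v} (r i) (r j) → i = j)
    {Fr Bk : Fin m → Fin F}
    (hlab : ∀ k t, S.InArc k t → B.cut.SameCell {v} (o.front t) (r (Fr k)) ∧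
      B.cut.SameCell {v} (o.back t) (r (Bk k))) {a j k : Fin m} (ha : S.InArc a (B.maw e))
    (hu : S.InArc j u) (hl : S.InArc k l) :
    Fr a = Fr j ∧ Bk j = Fr k ∧ Bk k = Bk a := by
  have hs : {v} ⊆ e := by simpa using hv
  refine ⟨hr _ _ ?_, hr _ _ ?_, hr _ _ ?_⟩
  · exact (hlab a _ ha).1.symm.trans ((h.above.mono hs).trans (hlab j _ hu).1)
  · exact (hlab j _ hu).2.symm.trans ((h.between.mono hs).trans (hlab k _ hl).1)
  · exact (hlab k _ hl).2.symm.trans ((h.below.mono hs).trans (hlab a _ ha).2)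

theorem UpperLower.plusSame {e u l : Finset V} (h : o.UpperLower e u l) (hv : v ∈ e)
    {a k : Fin m} (ha : S.InArc a (B.maw e)) (hl : S.InArc k l) {t t' : Finset V}
    (ht : S.InArc a t) (ht' : S.InArc k t') : o.plusGluing.SameCell {v} t t' := by
  have hs : {v} ⊆ e := by simpa using hv
  have h1 : o.plusGluing.SameCell {v} (B.maw e) l :=
    Gluing.SameCell.of_adj h.maw_mem.1 h.lower_mem.1 (hs.trans h.maw_mem.2)
      (hs.trans h.lower_mem.2) h.plusGluing_adj
  exact ((plusSame_of_sheetsSame (sheetsSame_of_inArc ht ha)).trans h1).trans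
    (plusSame_of_sheetsSame (sheetsSame_of_inArc hl ht'))

/-- The formula at an interior vertex, when the corners of `R₊` at `v` are given by the labels
`Bk`, and the maw points into the arc end `mawEnd i` at the node `i`. -/
theorem vertexFormula_of_labels [Fintype V] [NeZero m] (hS : CornerModel S)
    (hd : ∀ i, nodeDegree ends i = 3) (hv : ¬ M.IsBdry {v}) {F : ℕ} {r : Fin F → Finset V}
    (hr : ∀ i j, B.cut.SameCell {v} (r i) (r j) → i = j) {Bk : Fin m → Fin F}
    (hBk : ∀ k t, S.InArc k t → B.cut.SameCell {v} (o.back t) (r (Bk k)))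
    (hglue : ∀ j k, Bk j = Bk k → ∀ t t', S.InArc j t → S.InArc k t' →
      o.plusGluing.SameCell {v} t t')
    (mawEnd : Fin n → Fin m × Bool)
    (hend : ∀ i, endNode ends (mawEnd i).1 (mawEnd i).2 = i)
    (hmaw : ∀ i, B.maw {v, S.node i} = S.endTri (mawEnd i).1 (mawEnd i).2)
    (hid : ∀ c : Fin F → ℚ, ∑ j, c (Bk j) * (1 - if (mawEnd (endNode ends j false) = (j, false) ↔
      mawEnd (endNode ends j true) = (j, true)) then 0 else 1 / 2) -
        ∑ i ∈ Finset.univ.image Bk, c i =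
        1 / 2 * ∑ i, c (Bk (mawEnd i).1)) : o.VertexFormula nu C v := by
  classical
  have hcusp : ¬ o.IsInwardCusp nu C v := fun h => hv h.1
  have hin : ∀ j b, CornerModel.InwardEnd nu S j b ↔ mawEnd (endNode ends j b) = (j, b) := by
    intro j b
    rw [hS.inwardEnd_of_degree_three (hd _), endEdge, hmaw]
    constructor
    · intro h
      obtain ⟨h1, h2⟩ := endTri_injective hS.ne (hend _) rfl h
      exact Prod.ext h1 h2
    · intro h
      rw [h]
  have hC : ∀ {j t}, S.InArc j t →
      (B.cut.InPiece C (o.back t) ↔ B.cut.InPiece C (r (Bk j))) := fun ht =>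
    (hBk _ _ ht).inPiece_iff C
  have hid' := hid fun i => if B.cut.InPiece C (r i) then 1 else 0
  rw [VertexFormula, hS.sum_sheets _ (fun j => (if B.cut.InPiece C (r (Bk j)) then 1 else 0) *
    (1 - if (mawEnd (endNode ends j false) = (j, false) ↔
      mawEnd (endNode ends j true) = (j, true)) then 0 else 1 / 2)),
    hS.sum_plus Bk (Finset.univ.image Bk) (by simp) ?_ _
      (fun i => if B.cut.InPiece C (r i) then 1 else 0),
    hS.sum_branchEdges (fun t => B.cut.InPiece C (o.back t)), if_neg hcusp, hid']
  · simp only [hd, Finset.filter_true, mul_zero, sub_zero]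
    congr 1
    refine Finset.sum_congr rfl fun i _ => ?_
    have hi := inArc_endTri (S := S) hS.ne (mawEnd i).1 (mawEnd i).2
    rw [← hmaw] at hi
    simp only [hC hi]
  · intro j t ht
    simp only [hC ht]
  · intro j k t t' hj hk
    refine ⟨fun h => hr _ _ ?_, fun h => hglue j k h t t' hj hk⟩
    exact (hBk j t hj).symm.trans ((back_sameCell_of_plusSame h).trans (hBk k t' hk))
  · intro j t ht
    simp only [hC ht, hS.doubleCornerAt_iff ht, hin]
    by_cases h1 : B.cut.InPiece C (r (Bk j)) <;>
      by_cases h2 : (mawEnd (endNode ends j false) = (j, false) ↔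
        mawEnd (endNode ends j true) = (j, true)) <;> simp [h1, h2]

theorem cornerModel_of_interior (hv : ¬ M.IsBdry {v}) (hne : ∀ j, (ends j).1 ≠ (ends j).2)
    (hu : ∀ i, ∃ j b, endNode ends j b = i) (hd : ∀ i, nodeDegree ends i = 3) : CornerModel S where
  ne := hne
  used := hu
  degree i := Or.inr (hd i)
  bdry t _ _ x _ _ := by
    refine iff_of_false (fun h => hv (isBdry_mono h (by simp))) ?_
    rintro ⟨i, -, h⟩
    rw [hd i] at h
    omega

end Labels

theorem cornerModel_theta (hv : ¬ M.IsBdry {v}) (S : Subdivides (linkGraph B.tri v) thetaModel) :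
    CornerModel S :=
  cornerModel_of_interior hv (by decide) (by decide) (by decide)

theorem cornerModel_triple (hv : ¬ M.IsBdry {v}) (S : Subdivides (linkGraph B.tri v) tripleModel) :
    CornerModel S :=
  cornerModel_of_interior hv (by decide) (by decide) (by decide)

end Coorientation

end BranchedSurface

namespace BranchedSurface

variable {V : Type*} [DecidableEq V] {M : ThreeManifold V} {B : BranchedSurface M} {v : V}

namespace Coorientation

variable {o : B.Coorientation} {nu : M.BdryOrientation} {C : B.Region}

theorem plusSame_of_inArc {n m : ℕ} {ends : Fin m → Fin n × Fin n}
    {S : Subdivides (linkGraph B.tri v) ends} {j : Fin m} {t t' : Finset V} (h : S.InArc j t)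
    (h' : S.InArc j t') : o.plusGluing.SameCell {v} t t' :=
  plusSame_of_sheetsSame (sheetsSame_of_inArc h h')

variable [Fintype V]

theorem vertexFormula_of_isBranchVertex (hv : ¬ M.IsBdry {v})
    (h : IsBranchVertex M B.tri B.maw v) : o.VertexFormula nu C v := by
  obtain ⟨S, hloc, hm0, hm1⟩ := h
  have hS := cornerModel_theta hv S
  have hin := fun j b => inArc_endTri (S := S) hS.ne j b
  obtain ⟨r, hr, Fr, Bk, hFB, hlab⟩ := exists_labels o hS.ne hloc ![(1, 2), (0, 2), (0, 1)]
    (by decide)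
  have f0 := hFB 0
  have f1 := hFB 1
  have f2 := hFB 2
  simp only [Matrix.cons_val] at f0 f1 f2
  have hm0' : B.maw {v, S.node 0} = S.endTri 0 false := hm0
  have hm1' : B.maw {v, S.node 1} = S.endTri 0 true := hm1
  have ha : S.InArc 0 (B.maw {v, S.node 0}) := hm0' ▸ hin 0 false
  let mawEnd : Fin 2 → Fin 3 × Bool := ![(0, false), (0, true)]
  have hmaw : ∀ i, B.maw {v, S.node i} = S.endTri (mawEnd i).1 (mawEnd i).2 := by
    intro i
    fin_cases i
    exacts [hm0', hm1']
  rcases upperLower_at_node o hS (i := 0) (by decide) (pm := (0, false)) (px := (1, false))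
    (py := (2, false)) hm0' (by decide) with h0 | h0
  · obtain ⟨e1, e2, e3⟩ := h0.labels (by simp) hr hlab ha (hin 1 false) (hin 2 false)
    obtain rfl : Bk = ![1, 0, 1] := by
      funext i
      rcases f0 with ⟨f0, f0'⟩ | ⟨f0, f0'⟩ <;> rcases f1 with ⟨f1, f1'⟩ | ⟨f1, f1'⟩ <;>
        rcases f2 with ⟨f2, f2'⟩ | ⟨f2, f2'⟩ <;> simp [f0, f1, f2, f0', f1', f2'] at e1 e2 e3;
        fin_cases i <;> simp [f0', f1', f2']
    refine vertexFormula_of_labels hS (by decide) hv hr (fun k t h => (hlab k t h).2) ?_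
      mawEnd (by decide) hmaw ?_
    · intro j k hjk t t' hj hk
      fin_cases j <;> fin_cases k <;> first
        | exact plusSame_of_inArc hj hk
        | (simp at hjk; done)
        | exact h0.plusSame (by simp) ha (hin 2 false) hj hk
        | exact (h0.plusSame (by simp) ha (hin 2 false) hk hj).symm
    · intro c
      have : Finset.univ.image (![1, 0, 1] : Fin 3 → Fin 3) = {0, 1} := by decide
      rw [this]
      simp [Fin.sum_univ_succ, endNode, thetaModel, mawEnd]
      ring
  · obtain ⟨e1, e2, e3⟩ := h0.labels (by simp) hr hlab ha (hin 2 false) (hin 1 false)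
    obtain rfl : Bk = ![2, 2, 0] := by
      funext i
      rcases f0 with ⟨f0, f0'⟩ | ⟨f0, f0'⟩ <;> rcases f1 with ⟨f1, f1'⟩ | ⟨f1, f1'⟩ <;>
        rcases f2 with ⟨f2, f2'⟩ | ⟨f2, f2'⟩ <;> simp [f0, f1, f2, f0', f1', f2'] at e1 e2 e3;
        fin_cases i <;> simp [f0', f1', f2']
    refine vertexFormula_of_labels hS (by decide) hv hr (fun k t h => (hlab k t h).2) ?_
      mawEnd (by decide) hmaw ?_
    · intro j k hjk t t' hj hk
      fin_cases j <;> fin_cases k <;> first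
        | exact plusSame_of_inArc hj hk
        | (simp at hjk; done)
        | exact h0.plusSame (by simp) ha (hin 1 false) hj hk
        | exact (h0.plusSame (by simp) ha (hin 1 false) hk hj).symm
    · intro c
      have : Finset.univ.image (![2, 2, 0] : Fin 3 → Fin 3) = {0, 2} := by decide
      rw [this]
      simp [Fin.sum_univ_succ, endNode, thetaModel, mawEnd]
      ring

theorem vertexFormula_of_isTriplePoint (hv : ¬ M.IsBdry {v})
    (h : IsTriplePoint M B.tri B.maw v) : o.VertexFormula nu C v := by
  obtain ⟨S, hloc, hm0, hm3, hm2, hm1⟩ := h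
  have hS := cornerModel_triple hv S
  have hin := fun j b => inArc_endTri (S := S) hS.ne j b
  obtain ⟨r, hr, Fr, Bk, hFB, hlab⟩ := exists_labels o hS.ne hloc
    ![(1, 2), (0, 1), (0, 3), (2, 3), (1, 3), (0, 2)] (by decide)
  have f0 := hFB 0
  have f1 := hFB 1
  have f2 := hFB 2
  have f3 := hFB 3
  have f4 := hFB 4
  have f5 := hFB 5
  simp only [Matrix.cons_val] at f0 f1 f2 f3 f4 f5
  have hm0' : B.maw {v, S.node 0} = S.endTri 0 false := hm0
  have hm3' : B.maw {v, S.node 3} = S.endTri 1 false := hm3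
  have hm2' : B.maw {v, S.node 2} = S.endTri 1 true := hm2
  have hm1' : B.maw {v, S.node 1} = S.endTri 2 true := hm1
  have a0 : S.InArc 0 (B.maw {v, S.node 0}) := hm0' ▸ hin 0 false
  have a3 : S.InArc 1 (B.maw {v, S.node 3}) := hm3' ▸ hin 1 false
  have a2 : S.InArc 1 (B.maw {v, S.node 2}) := hm2' ▸ hin 1 true
  have a1 : S.InArc 2 (B.maw {v, S.node 1}) := hm1' ▸ hin 2 true
  let mawEnd : Fin 4 → Fin 6 × Bool := ![(0, false), (2, true), (1, true), (1, false)]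
  have hmaw : ∀ i, B.maw {v, S.node i} = S.endTri (mawEnd i).1 (mawEnd i).2 := by
    intro i
    fin_cases i
    exacts [hm0', hm1', hm2', hm3']
  rcases upperLower_at_node o hS (i := 0) (by decide) (pm := (0, false)) (px := (3, true))
    (py := (4, false)) hm0' (by decide) with h0 | h0
  · obtain ⟨b1, b2, b3⟩ := h0.labels (by simp) hr hlab a0 (hin 3 true) (hin 4 false)
    have c0 : Fr 0 = 2 ∧ Bk 0 = 1 ∧ Bk 3 = 3 ∧ Bk 4 = 1 := by grind
    rcases upperLower_at_node o hS (i := 3) (by decide) (pm := (1, false)) (px := (0, true))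
      (py := (5, true)) hm3' (by decide) with h3 | h3
    · have := h3.labels (by simp) hr hlab a3 (hin 0 true) (hin 5 true)
      grind
    obtain ⟨b1, b2, b3⟩ := h3.labels (by simp) hr hlab a3 (hin 5 true) (hin 0 true)
    rcases upperLower_at_node o hS (i := 2) (by decide) (pm := (1, true)) (px := (2, false))
      (py := (4, true)) hm2' (by decide) with h2 | h2
    swap
    · have := h2.labels (by simp) hr hlab a2 (hin 4 true) (hin 2 false)
      grind
    obtain ⟨b1, b2, b3⟩ := h2.labels (by simp) hr hlab a2 (hin 2 false) (hin 4 true)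
    rcases upperLower_at_node o hS (i := 1) (by decide) (pm := (2, true)) (px := (3, false))
      (py := (5, false)) hm1' (by decide) with h1 | h1
    · have := h1.labels (by simp) hr hlab a1 (hin 3 false) (hin 5 false)
      grind
    obtain rfl : Bk = ![1, 1, 3, 3, 1, 2] := by
      funext i
      fin_cases i <;> simp <;> grind
    refine vertexFormula_of_labels hS (by decide) hv hr (fun k t h => (hlab k t h).2) ?_
      mawEnd (by decide) hmaw ?_
    · intro j k hjk t t' hj hk
      fin_cases j <;> fin_cases k <;> first
        | exact plusSame_of_inArc hj hk
        | (simp at hjk; done)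
        | exact h0.plusSame (by simp) a0 (hin 4 false) hj hk
        | exact (h0.plusSame (by simp) a0 (hin 4 false) hk hj).symm
        | exact h3.plusSame (by simp) a3 (hin 0 true) hj hk
        | exact (h3.plusSame (by simp) a3 (hin 0 true) hk hj).symm
        | exact h2.plusSame (by simp) a2 (hin 4 true) hj hk
        | exact (h2.plusSame (by simp) a2 (hin 4 true) hk hj).symm
        | exact h1.plusSame (by simp) a1 (hin 3 false) hj hk
        | exact (h1.plusSame (by simp) a1 (hin 3 false) hk hj).symm
    · intro c
      have : Finset.univ.image (![1, 1, 3, 3, 1, 2] : Fin 6 → Fin 4) = {1, 2, 3} := by decide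
      rw [this]
      simp [Fin.sum_univ_succ, endNode, tripleModel, mawEnd, Fin.ext_iff]
      ring
  · obtain ⟨b1, b2, b3⟩ := h0.labels (by simp) hr hlab a0 (hin 4 false) (hin 3 true)
    have c0 : Fr 0 = 1 ∧ Bk 0 = 2 ∧ Bk 3 = 2 ∧ Bk 4 = 3 := by grind
    rcases upperLower_at_node o hS (i := 3) (by decide) (pm := (1, false)) (px := (0, true))
      (py := (5, true)) hm3' (by decide) with h3 | h3
    swap
    · have := h3.labels (by simp) hr hlab a3 (hin 5 true) (hin 0 true)
      grind
    obtain ⟨b1, b2, b3⟩ := h3.labels (by simp) hr hlab a3 (hin 0 true) (hin 5 true)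
    rcases upperLower_at_node o hS (i := 2) (by decide) (pm := (1, true)) (px := (2, false))
      (py := (4, true)) hm2' (by decide) with h2 | h2
    · have := h2.labels (by simp) hr hlab a2 (hin 2 false) (hin 4 true)
      grind
    obtain ⟨b1, b2, b3⟩ := h2.labels (by simp) hr hlab a2 (hin 4 true) (hin 2 false)
    rcases upperLower_at_node o hS (i := 1) (by decide) (pm := (2, true)) (px := (3, false))
      (py := (5, false)) hm1' (by decide) with h1 | h1
    swap
    · have := h1.labels (by simp) hr hlab a1 (hin 5 false) (hin 3 false)
      grind
    obtain rfl : Bk = ![2, 0, 0, 2, 3, 0] := by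
      funext i
      fin_cases i <;> simp <;> grind
    refine vertexFormula_of_labels hS (by decide) hv hr (fun k t h => (hlab k t h).2) ?_
      mawEnd (by decide) hmaw ?_
    · intro j k hjk t t' hj hk
      fin_cases j <;> fin_cases k <;> first
        | exact plusSame_of_inArc hj hk
        | (simp at hjk; done)
        | exact h0.plusSame (by simp) a0 (hin 3 true) hj hk
        | exact (h0.plusSame (by simp) a0 (hin 3 true) hk hj).symm
        | exact h3.plusSame (by simp) a3 (hin 5 true) hj hk
        | exact (h3.plusSame (by simp) a3 (hin 5 true) hk hj).symm
        | exact h2.plusSame (by simp) a2 (hin 2 false) hj hk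
        | exact (h2.plusSame (by simp) a2 (hin 2 false) hk hj).symm
        | exact h1.plusSame (by simp) a1 (hin 5 false) hj hk
        | exact (h1.plusSame (by simp) a1 (hin 5 false) hk hj).symm
    · intro c
      have : Finset.univ.image (![2, 0, 0, 2, 3, 0] : Fin 6 → Fin 4) = {0, 2, 3} := by decide
      rw [this]
      simp [Fin.sum_univ_succ, endNode, tripleModel, mawEnd, Fin.ext_iff]
      ring

end Coorientation

end BranchedSurface

namespace BranchedSurface

variable {V : Type*} [DecidableEq V] {M : ThreeManifold V} {B : BranchedSurface M} {v : V}

namespace Coorientation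

variable {o : B.Coorientation} {nu : M.BdryOrientation} {C : B.Region}

theorem cornerModel_of_bdry {n m : ℕ} {ends : Fin m → Fin n × Fin n}
    {S : Subdivides (linkGraph B.tri v) ends} (hne : ∀ j, (ends j).1 ≠ (ends j).2)
    (hu : ∀ i, ∃ j b, endNode ends j b = i)
    (hd : ∀ i, nodeDegree ends i = 1 ∨ nodeDegree ends i = 3)
    (hb : ∀ u ∈ (linkGraph B.tri v).support,
      (M.IsBdry {v, u} ↔ ∃ i, u = S.node i ∧ nodeDegree ends i = 1)) : CornerModel S where
  ne := hne
  used := hu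
  degree := hd
  bdry t ht hv x hx hxv := by
    obtain ⟨y, -, hy⟩ := exists_linkGraph_adj (card_tri ht) ht hv hx hxv
    exact hb x ⟨y, hy⟩

theorem cornerModel_arc (S : Subdivides (linkGraph B.tri v) arcModel)
    (hb : ∀ u ∈ (linkGraph B.tri v).support,
      (M.IsBdry {v, u} ↔ u = S.node 0 ∨ u = S.node 1)) : CornerModel S := by
  have hd : ∀ i, nodeDegree arcModel i = 1 := by decide
  refine cornerModel_of_bdry (by decide) (by decide) (fun i => Or.inl (hd i)) fun u hu => ?_
  rw [hb u hu]
  simp [hd, Fin.exists_fin_two]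

theorem cornerModel_tripod (S : Subdivides (linkGraph B.tri v) tripodModel)
    (hb : ∀ u ∈ (linkGraph B.tri v).support,
      (M.IsBdry {v, u} ↔ u = S.node 1 ∨ u = S.node 2 ∨ u = S.node 3)) : CornerModel S := by
  have hd : ∀ i, nodeDegree tripodModel i = 1 ↔ i = 1 ∨ i = 2 ∨ i = 3 := by decide
  refine cornerModel_of_bdry (by decide) (by decide) (by decide) fun u hu => ?_
  rw [hb u hu]
  simp only [hd]
  constructor
  · rintro (rfl | rfl | rfl)
    exacts [⟨1, rfl, by simp⟩, ⟨2, rfl, by simp⟩, ⟨3, rfl, by simp⟩]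
  · rintro ⟨i, rfl, rfl | rfl | rfl⟩ <;> simp

theorem no_branch_of_isSmoothVertex (h : IsSmoothVertex B.tri v) (e : Finset V) (hv : v ∈ e) :
    ¬ IsBranchEdge B.tri e := by
  obtain ⟨S⟩ := h
  intro he
  have hne : ∀ j, (circleModel j).1 ≠ (circleModel j).2 := by decide
  obtain ⟨x, hxv, rfl⟩ := exists_eq_pair he.1 hv
  obtain ⟨t, ht, hs⟩ : {t | t ∈ B.tri ∧ {v, x} ⊆ t}.Nonempty :=
    Set.nonempty_of_ncard_ne_zero (by rw [he.2]; norm_num)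
  have h2 : {t | t ∈ B.tri ∧ {v, x} ⊆ t}.ncard = 2 := by
    by_cases hx : x ∈ Set.range S.node
    · obtain ⟨i, rfl⟩ := hx
      have hu : ∀ i, ∃ j b, endNode circleModel j b = i := by decide
      rw [ncard_at_node (fun _ => card_tri) hne i (hu i)]
      have hd : ∀ i, nodeDegree circleModel i = 2 := by decide
      exact hd i
    · exact ncard_of_notMem_range (S := S) (fun _ => card_tri) hx hxv ht hs
  have := he.2
  omega

variable [Fintype V]

theorem UpperLower.upper_unique {e u l u' l' : Finset V} (h : o.UpperLower e u l)
    (h' : o.UpperLower e u' l') : u' = u := by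
  obtain ⟨hau, hal, hul⟩ := h.distinct
  obtain ⟨hau', hal', hul'⟩ := h'.distinct
  rcases h.mem_iff.1 h'.upper_mem with h1 | h1 | h1
  · exact absurd h1.symm hau'
  · exact h1
  · rcases h.mem_iff.1 h'.lower_mem with h2 | h2 | h2
    · exact absurd h2.symm hal'
    · subst h1 h2
      have hinter := inter_eq_pair (card_tri h.maw_mem.1) (card_tri h.upper_mem.1) hau h.branch.1
        h.maw_mem.2 h.upper_mem.2
      rcases h.eq_of_plusGluing_adj h.maw_mem.1 h.upper_mem.1 hinter h'.plusGluing_adj with h3 | h3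
      · exact absurd h3.2 hul
      · exact absurd h3.1 hal
    · exact absurd (h1.trans h2.symm) hul'

theorem vertexFormula_of_tripod (hv : M.IsBdry {v}) (S : Subdivides (linkGraph B.tri v) tripodModel)
    (hb : ∀ u ∈ (linkGraph B.tri v).support,
      (M.IsBdry {v, u} ↔ u = S.node 1 ∨ u = S.node 2 ∨ u = S.node 3)) :
    o.VertexFormula nu C v := by
  classical
  have hS := cornerModel_tripod S hb
  have hin := fun j b => inArc_endTri (S := S) hS.ne j b
  have hd0 : nodeDegree tripodModel 0 = 3 := by decide
  have hd1 : ∀ j, nodeDegree tripodModel (endNode tripodModel j true) = 1 := by decide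
  have hn0 : ∀ j, endNode tripodModel j false = 0 := by decide
  have hdeg3 : ∀ i, nodeDegree tripodModel i = 3 → i = 0 := by decide
  obtain ⟨u, l, h⟩ := o.exists_upperLower ((hS.isBranchEdge_iff 0).2 hd0)
  obtain ⟨hau, hal, hul⟩ := h.distinct
  have hcenter : ∀ t, t ∈ B.tri ∧ {v, S.node 0} ⊆ t → ∃ j, t = S.endTri j false := by
    intro t ht
    have ht' : t ∈ {t | t ∈ B.tri ∧ {v, S.node 0} ⊆ t} := ht
    rw [triangles_at_node (fun _ => card_tri) hS.ne 0 (hS.used 0)] at ht'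
    obtain ⟨⟨j, b⟩, hp, rfl⟩ := ht'
    have hb : ∀ j b, endNode tripodModel j b = 0 → b = false := by decide
    obtain rfl := hb j b hp
    exact ⟨j, rfl⟩
  obtain ⟨a, ha⟩ := hcenter _ h.maw_mem
  obtain ⟨j, rfl⟩ := hcenter _ h.upper_mem
  obtain ⟨k, rfl⟩ := hcenter _ h.lower_mem
  rw [ha] at hau hal
  have haj : a ≠ j := fun h => hau (by rw [h])
  have hak : a ≠ k := fun h => hal (by rw [h])
  have hjk : j ≠ k := fun h => hul (by rw [h])
  have huniv : ∀ a j k : Fin 3, a ≠ j → a ≠ k → j ≠ k → Finset.univ = {a, j, k} := by decide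
  have hcases : ∀ i : Fin 3, i = a ∨ i = j ∨ i = k := by
    intro i
    have : i ∈ ({a, j, k} : Finset (Fin 3)) := huniv a j k haj hak hjk ▸ Finset.mem_univ i
    simpa using this
  have hve : v ∈ ({v, S.node 0} : Finset V) := by simp
  have ha' : S.InArc a (B.maw {v, S.node 0}) := ha ▸ hin a false
  have hC : ∀ {i t}, S.InArc i t → (B.cut.InPiece C (o.back t) ↔
      B.cut.InPiece C (o.back (S.endTri i false))) := fun ht =>
    (back_sameCell_of_plusSame (plusSame_of_inArc ht (hin _ false))).inPiece_iff C
  have hCa : B.cut.InPiece C (o.back (S.endTri a false)) ↔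
      B.cut.InPiece C (o.back (S.endTri k false)) :=
    (back_sameCell_of_plusSame (h.plusSame hve ha' (hin k false) (hin a false)
      (hin k false))).inPiece_iff C
  have hcusp : o.IsInwardCusp nu C v ↔
      ¬ nu.outward v ∧ B.cut.InPiece C (o.back (S.endTri j false)) := by
    constructor
    · rintro ⟨-, h1, e, u, l, hv', h', hu⟩
      obtain ⟨i, rfl, hi⟩ := hS.exists_node_of_isBranchEdge h'.branch hv'
      obtain rfl := hdeg3 i hi
      exact ⟨h1, h.upper_unique h' ▸ hu⟩
    · exact fun h' => ⟨hv, h'.1, _, _, _, hve, h, h'.2⟩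
  have hinner : ∀ i, CornerModel.InwardEnd nu S i false ↔ i = a := by
    intro i
    rw [hS.inwardEnd_of_degree_three (by rw [hn0, hd0]), endEdge, hn0, ha]
    constructor
    · intro h
      exact (endTri_injective hS.ne (hn0 a) (hn0 i) h).1.symm
    · rintro rfl
      rfl
  have houter : ∀ i, CornerModel.InwardEnd nu S i true ↔ ¬ nu.outward v :=
    fun i => hS.inwardEnd_of_degree_one (hd1 i)
  rw [VertexFormula, hS.sum_sheets _ (fun i =>
      if B.cut.InPiece C (o.back (S.endTri i false)) then
        1 - (if ¬ (i = a ↔ ¬ nu.outward v) then (1 / 2 : ℚ) else 0) else 0),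
    hS.sum_plus (fun i => decide (i = j)) {false, true} ?_ ?_ _
      (fun b : Bool => if b then (if B.cut.InPiece C (o.back (S.endTri j false)) then 1 else 0)
        else (if B.cut.InPiece C (o.back (S.endTri k false)) then 1 else 0)) ?_,
    hS.sum_branchEdges (fun t => B.cut.InPiece C (o.back t)), huniv a j k haj hak hjk,
    Finset.sum_insert (by simp [haj, hak]), Finset.sum_pair hjk, Finset.sum_pair (by simp)]
  · have : (Finset.univ.filter fun i => nodeDegree tripodModel i = 3) = {0} := by decide
    rw [this, Finset.sum_singleton, ha]
    simp only [hcusp, hCa, true_iff, haj.symm, hak.symm, false_iff, if_true, Bool.false_eq_true,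
      if_false, not_not]
    by_cases h1 : nu.outward v <;>
      by_cases h2 : B.cut.InPiece C (o.back (S.endTri j false)) <;>
      by_cases h3 : B.cut.InPiece C (o.back (S.endTri k false)) <;>
      simp [h1, h2, h3] <;> norm_num
  · intro b
    cases b
    · simpa using ⟨a, haj⟩
    · simp
  · intro i i' t t' ht ht'
    constructor
    · intro hs
      have : S.InArc j t ↔ S.InArc j t' := by
        refine hs.mem_iff (p := S.InArc j) fun t t' ht ht' hvt hvt' hadj => ?_
        rw [Finset.singleton_subset_iff] at hvt hvt'
        by_cases hbr : IsBranchEdge B.tri (t ∩ t')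
        · obtain ⟨i, he, hi⟩ := hS.exists_node_of_isBranchEdge hbr
            (Finset.mem_inter.2 ⟨hvt, hvt'⟩)
          obtain rfl := hdeg3 i hi
          have h1 : ¬ S.InArc j (B.maw {v, S.node 0}) := fun h' => haj (ha'.unique h')
          have h2 : ¬ S.InArc j (S.endTri k false) := fun h' => hjk (h'.unique (hin k false))
          rcases h.eq_of_plusGluing_adj ht ht' he hadj with ⟨rfl, rfl⟩ | ⟨rfl, rfl⟩
          · exact iff_of_false h1 h2
          · exact iff_of_false h2 h1
        · obtain ⟨i, hi⟩ := exists_inArc (S := S) (fun _ => card_tri) ht hvt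
          obtain ⟨i', hi'⟩ := exists_inArc (S := S) (fun _ => card_tri) ht' hvt'
          have hii : i = i' := (hS.sheetsSame_iff hi hi').1 (Gluing.SameCell.of_adj ht ht'
            (by simpa using hvt) (by simpa using hvt') (sheets_adj_of_plusGluing_adj hadj hbr))
          subst hii
          exact ⟨fun h' => hi.unique h' ▸ hi', fun h' => hi'.unique h' ▸ hi⟩
      have h2 : i = j ↔ i' = j :=
        ⟨fun h' => ht'.unique (this.1 (h' ▸ ht)), fun h' => ht.unique (this.2 (h' ▸ ht'))⟩
      simpa using h2
    · intro hl
      have hl : i = j ↔ i' = j := by simpa using hl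
      rcases hcases i with rfl | rfl | rfl <;> rcases hcases i' with rfl | rfl | rfl
      · exact plusSame_of_inArc ht ht'
      · exact absurd (hl.2 rfl) haj
      · exact h.plusSame hve ha' (hin _ false) ht ht'
      · exact absurd (hl.1 rfl) haj
      · exact plusSame_of_inArc ht ht'
      · exact absurd (hl.1 rfl) hjk.symm
      · exact (h.plusSame hve ha' (hin _ false) ht' ht).symm
      · exact absurd (hl.2 rfl) hjk.symm
      · exact plusSame_of_inArc ht ht'
  · intro i t ht
    simp only [hC ht]
    rcases hcases i with rfl | rfl | rfl
    · simp [haj, hCa]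
    · simp
    · simp [hjk.symm]
  · intro i t ht
    simp only [hC ht, hS.doubleCornerAt_iff ht, hinner, houter]

theorem vertexFormula (o : B.Coorientation) (nu : M.BdryOrientation) (C : B.Region) (v : V) :
    o.VertexFormula nu C v := by
  by_cases hv : ∃ t ∈ B.tri, v ∈ t
  · obtain ⟨t, ht, hvt⟩ := hv
    by_cases hb : M.IsBdry {v}
    · rcases B.boundary_model t ht v hvt hb with ⟨S, hS⟩ | ⟨S, hS⟩
      · refine vertexFormula_of_no_branch fun e he hbr => ?_
        obtain ⟨i, -, hi⟩ := (cornerModel_arc S hS).exists_node_of_isBranchEdge hbr he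
        have hd : ∀ i, nodeDegree arcModel i = 1 := by decide
        rw [hd] at hi
        omega
      · exact vertexFormula_of_tripod hb S hS
    · rcases B.interior_model t ht v hvt hb with h | h | h
      · exact vertexFormula_of_no_branch (no_branch_of_isSmoothVertex h)
      · exact vertexFormula_of_isBranchVertex hb h
      · exact vertexFormula_of_isTriplePoint hb h
  · refine vertexFormula_of_no_branch fun e he hbr => ?_
    obtain ⟨t, ht, hs⟩ : {t | t ∈ B.tri ∧ e ⊆ t}.Nonempty :=
      Set.nonempty_of_ncard_ne_zero (by rw [hbr.2]; norm_num)
    exact hv ⟨t, ht, hs he⟩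

end Coorientation

open Coorientation

open Classical in
theorem exists_sum_doubleCornerAt [Fintype V] (B : BranchedSurface M) (nu : M.BdryOrientation)
    (v : V) (q : Finset V → Prop)
    (hq : ∀ t t', B.sheets.SameCell {v} t t' → (q t ↔ q t')) :
    ∃ k : ℤ, ∑ t ∈ B.sheets.star {v},
        (if q t ∧ B.DoubleCornerAt nu v t then (1 : ℚ) else 0) / B.sheets.cellSize {v} t =
      ∑ t ∈ B.sheets.star {v}, ∑ e ∈ t.powerset with e.card = 2 ∧ v ∈ e,
        (if q t ∧ B.MawInward nu e t then (1 : ℚ) else 0) - 2 * k := by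
  by_cases hv : ∃ t ∈ B.tri, v ∈ t
  · obtain ⟨t, ht, hvt⟩ := hv
    by_cases hb : M.IsBdry {v}
    · rcases B.boundary_model t ht v hvt hb with ⟨S, hS⟩ | ⟨S, hS⟩
      · exact (cornerModel_arc S hS).sum_doubleCornerAt q hq
      · exact (cornerModel_tripod S hS).sum_doubleCornerAt q hq
    · rcases B.interior_model t ht v hvt hb with h | ⟨S, -⟩ | ⟨S, -⟩
      · have hbr := no_branch_of_isSmoothVertex h
        refine ⟨0, ?_⟩
        rw [Finset.sum_eq_zero, Finset.sum_eq_zero]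
        · simp
        · refine fun t _ => Finset.sum_eq_zero fun e he => if_neg ?_
          have hve := (Finset.mem_filter.1 he).2.2
          rintro ⟨-, h | h⟩
          · exact hbr e hve h.1
          · exact hb (isBdry_mono h.1 (by simpa using hve))
        · intro t _
          simp [not_doubleCornerAt_of_no_branch hbr]
      · exact (cornerModel_theta hb S).sum_doubleCornerAt q hq
      · exact (cornerModel_triple hb S).sum_doubleCornerAt q hq
  · have : B.sheets.star {v} = ∅ := by
      refine Finset.eq_empty_of_forall_notMem fun t ht => hv ?_
      rw [Gluing.mem_star, Finset.singleton_subset_iff] at ht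
      exact ⟨t, ht⟩
    exact ⟨0, by simp [this]⟩

end BranchedSurface

namespace Gluing

variable {V : Type*} {G : Gluing V}

open Classical in
theorem sum_powerset_singleton (t : Finset V) (F : Finset V → ℚ)
    (hF : ∀ σ, σ.card ≠ 1 → F σ = 0) :
    ∑ σ ∈ t.powerset with σ.Nonempty, F σ = ∑ v ∈ t, F {v} := by
  symm
  refine Finset.sum_of_injOn (fun v => {v}) ?_ ?_ ?_ ?_
  · exact fun v _ w _ h => Finset.singleton_injective h
  · intro v hv
    simpa using hv
  · intro σ hσ h
    refine hF σ fun hc => h ?_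
    obtain ⟨v, rfl⟩ := Finset.card_eq_one.1 hc
    refine ⟨v, ?_, rfl⟩
    simpa using hσ
  · intro v _
    rfl

theorem inPiece_iff {t : Finset V} (ht : t ∈ G.top) (c : G.Piece) :
    G.InPiece c t ↔ c = G.piece t ht :=
  ⟨fun ⟨_, h⟩ => h.symm, fun h => ⟨ht, h.symm⟩⟩

variable [Fintype V]

open Classical in
theorem sum_flags_comm (F : Finset V → Finset V → ℚ) :
    ∑ t ∈ G.star ∅, ∑ σ ∈ t.powerset with σ.Nonempty, F σ t =
      ∑ σ with σ.Nonempty, ∑ t ∈ G.star σ, F σ t := by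
  refine Finset.sum_comm' fun t σ => ?_
  simp only [mem_star, Finset.mem_filter, Finset.mem_powerset, Finset.mem_univ, true_and,
    Finset.empty_subset, and_true]
  tauto

open Classical in
theorem sum_vertices_comm (F : V → Finset V → ℚ) :
    ∑ t ∈ G.star ∅, ∑ v ∈ t, F v t = ∑ v, ∑ t ∈ G.star {v}, F v t := by
  refine Finset.sum_comm' fun t v => ?_
  simp [mem_star]

open Classical in
theorem sum_nonempty_of_card_le_two (X : Finset V → ℚ) (hX : ∀ σ, 3 ≤ σ.card → X σ = 0) :
    ∑ σ with σ.Nonempty, X σ = ∑ v, X {v} + ∑ e with e.card = 2, X e := by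
  have h1 : ∑ v, X {v} = ∑ σ with σ.card = 1, X σ := by
    have := sum_powerset_singleton (Finset.univ : Finset V)
      (fun σ => if σ.card = 1 then X σ else 0) (fun σ h => if_neg h)
    simp only [Finset.card_singleton, if_true] at this
    rw [← this, Finset.sum_filter, Finset.sum_filter, Finset.powerset_univ]
    refine Finset.sum_congr rfl fun σ _ => ?_
    by_cases h : σ.card = 1
    · simp [h, Finset.card_pos.1 (h ▸ Nat.one_pos)]
    · simp [h]
  rw [h1, Finset.sum_filter, Finset.sum_filter, Finset.sum_filter, ← Finset.sum_add_distrib]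
  refine Finset.sum_congr rfl fun σ _ => ?_
  simp only [← Finset.card_pos]
  rcases lt_or_ge σ.card 3 with h | h
  · interval_cases σ.card <;> simp
  · simp [hX σ h]

end Gluing

namespace BranchedSurface

variable {V : Type*} [DecidableEq V] {M : ThreeManifold V} {B : BranchedSurface M}
  {nu : M.BdryOrientation}

/-! ### The maw Euler characteristic as a sum over triangles -/

theorem sameCell_sub_iff [Fintype V] {s : B.Sector} {σ t t' : Finset V}
    (ht : B.sheets.InPiece s t) :
    (B.sheets.sub s).SameCell σ t t' ↔ B.sheets.SameCell σ t t' :=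
  Gluing.sameCell_restrict (Gluing.sub_top s) (fun _ _ => Iff.rfl)
    (Gluing.inPiece_iff_of_adj s) ht

theorem isDoubleCorner_cell_iff [Fintype V] {s : B.Sector} (p : (B.sheets.sub s).Flag) :
    B.IsDoubleCorner nu s p.cell ↔ ∃ v, p.1.1 = {v} ∧ B.DoubleCornerAt nu v p.1.2 := by
  have hp : B.sheets.InPiece s p.1.2 := p.2.2.2
  constructor
  · rintro ⟨hc, p₁, p₂, c1, c2, f1, f2, m1, m2⟩
    obtain ⟨v, hv⟩ := Finset.card_eq_one.1 hc
    have hv : p.1.1 = {v} := hv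
    have key : ∀ q : (B.sheets.sub s).Flag, p.cell.IsFace q.cell →
        v ∈ q.1.1 ∧ B.sheets.SameCell {v} p.1.2 q.1.2 := by
      intro q hq
      obtain ⟨σ, hσ, hs, h⟩ := Gluing.Flag.isFace_cell_iff.1 hq
      rw [Gluing.Flag.cell_eq_iff] at h
      obtain ⟨h1, h2⟩ := h
      have h1 : σ = p.1.1 := h1
      subst h1
      have h2 : (B.sheets.sub s).SameCell p.1.1 q.1.2 p.1.2 := h2
      rw [hv] at h2 hs
      exact ⟨by simpa using hs, ((sameCell_sub_iff q.2.2.2).1 h2).symm⟩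
    obtain ⟨v1, s1⟩ := key p₁ f1
    obtain ⟨v2, s2⟩ := key p₂ f2
    exact ⟨v, hv, _, _, _, _, s1, s2, c1, v1, p₁.2.2.1, m1, c2, v2, p₂.2.2.1, m2⟩
  · rintro ⟨v, hv, e₁, t₁, e₂, t₂, s1, s2, c1, v1, h1, m1, c2, v2, h2, m2⟩
    have key : ∀ e t, B.sheets.SameCell {v} p.1.2 t → e.card = 2 → v ∈ e → e ⊆ t →
        ∃ q : (B.sheets.sub s).Flag, q.1 = (e, t) ∧ p.cell.IsFace q.cell := by
      intro e t hs hc hve het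
      have ht : t ∈ (B.sheets.sub s).top := (hs.inPiece_iff s).1 hp
      refine ⟨⟨(e, t), ⟨v, hve⟩, het, ht⟩, rfl, Gluing.Flag.isFace_cell_iff.2
        ⟨{v}, by simp, by simpa using hve, ?_⟩⟩
      rw [Gluing.Flag.cell_eq_iff]
      exact ⟨hv.symm, (sameCell_sub_iff (s := s) ht).2 hs.symm⟩
    obtain ⟨q₁, hq1, f1⟩ := key e₁ t₁ s1 c1 v1 h1
    obtain ⟨q₂, hq2, f2⟩ := key e₂ t₂ s2 c2 v2 h2
    refine ⟨by simp [hv], q₁, q₂, ?_, ?_, f1, f2, ?_, ?_⟩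
    · rw [hq1]; exact c1
    · rw [hq2]; exact c2
    · rw [hq1]; exact m1
    · rw [hq2]; exact m2

open Classical in
theorem doubleCorners_eq_sum [Fintype V] (s : B.Sector) :
    (B.doubleCorners nu s : ℚ) = ∑ v, ∑ t ∈ B.sheets.star {v},
      (if B.sheets.InPiece s t ∧ B.DoubleCornerAt nu v t then (1 : ℚ) else 0) /
        B.sheets.cellSize {v} t := by
  have h1 : (B.doubleCorners nu s : ℚ) =
      ∑ x, if B.IsDoubleCorner nu s x then (1 : ℚ) else 0 := by
    rw [doubleCorners, Finset.sum_boole, ← Set.ncard_coe_finset]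
    congr 2
    ext
    simp
  rw [h1, Gluing.sum_cell _ (fun σ t => if ∃ v, σ = {v} ∧ B.DoubleCornerAt nu v t then 1 else 0)
    (fun p => by simp only [isDoubleCorner_cell_iff]),
    Gluing.sum_star_restrict (Gluing.sub_top s), ← Gluing.sum_vertices_comm]
  refine Finset.sum_congr rfl fun t _ => ?_
  by_cases hs : B.sheets.InPiece s t
  · simp only [hs, if_true, true_and]
    rw [Gluing.sum_powerset_singleton]
    · refine Finset.sum_congr rfl fun v _ => ?_
      rw [Gluing.cellSize_restrict (Gluing.sub_top s) (fun _ _ => Iff.rfl)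
        (Gluing.inPiece_iff_of_adj s) hs]
      simp
    · intro σ hσ
      rw [if_neg, zero_div]
      rintro ⟨v, rfl, -⟩
      simp at hσ
  · simp [hs]

open Classical in
/-- The contribution of the triangle `t` to the maw Euler characteristic of its sector. -/
def mawWeight [Fintype V] (B : BranchedSurface M) (nu : M.BdryOrientation) (t : Finset V) : ℚ :=
  ∑ σ ∈ t.powerset with σ.Nonempty, (-1) ^ (σ.card + 1) / (B.sheets.cellSize σ t : ℚ) -
    1 / 2 * ∑ v ∈ t, (if B.DoubleCornerAt nu v t then (1 : ℚ) else 0) / B.sheets.cellSize {v} t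

open Classical in
theorem mawEulerChar_eq_sum [Fintype V] (s : B.Sector) :
    B.mawEulerChar nu s =
      ∑ t ∈ B.sheets.star ∅, if B.sheets.InPiece s t then B.mawWeight nu t else 0 := by
  rw [mawEulerChar, Gluing.eulerChar_restrict (Gluing.sub_top s) (fun _ _ => Iff.rfl)
    (Gluing.inPiece_iff_of_adj s), doubleCorners_eq_sum, ← Gluing.sum_vertices_comm,
    Finset.mul_sum, ← Finset.sum_sub_distrib]
  refine Finset.sum_congr rfl fun t _ => ?_
  by_cases hs : B.sheets.InPiece s t <;> simp [hs, mawWeight]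

/-! ### Integrality -/

theorem exists_doubleCorners_eq [Fintype V] (s : B.Sector) :
    ∃ k : ℤ, (B.doubleCorners nu s : ℚ) = 2 * k := by
  classical
  choose k hk using fun v => B.exists_sum_doubleCornerAt nu v (B.sheets.InPiece s)
    fun _ _ h => h.inPiece_iff s
  refine ⟨(∑ t ∈ B.sheets.star ∅, ∑ e ∈ t.powerset with e.card = 2,
    if B.sheets.InPiece s t ∧ B.MawInward nu e t then 1 else 0) - ∑ v, k v, ?_⟩
  rw [doubleCorners_eq_sum, Finset.sum_congr rfl fun v _ => hk v, Finset.sum_sub_distrib,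
    ← Gluing.sum_vertices_comm, ← Finset.mul_sum]
  push_cast
  rw [mul_sub]
  congr 1
  rw [Finset.mul_sum]
  refine Finset.sum_congr rfl fun t _ => ?_
  rw [Finset.mul_sum, Finset.sum_comm' (t' := t.powerset.filter fun e => e.card = 2)
    (s' := fun e => e)]
  · refine Finset.sum_congr rfl fun e he => ?_
    rw [Finset.sum_const, (Finset.mem_filter.1 he).2, nsmul_eq_mul]
    simp
  · intro v e
    simp only [Finset.mem_filter, Finset.mem_powerset]
    exact ⟨fun h => ⟨h.2.2.2, h.2.1, h.2.2.1⟩, fun h => ⟨h.2.1 h.1, h.2.1, h.2.2, h.1⟩⟩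

theorem exists_mawEulerChar_eq [Fintype V] (s : B.Sector) :
    ∃ k : ℤ, B.mawEulerChar nu s = k := by
  obtain ⟨k, hk⟩ := exists_doubleCorners_eq (nu := nu) s
  refine ⟨(B.sheets.sub s).eulerChar - k, ?_⟩
  rw [mawEulerChar, hk]
  push_cast
  ring

namespace Coorientation

variable {o : B.Coorientation}

/-! ### The flow through a region -/

open Classical in
theorem outgoing_eq_sum [Fintype V] (o : B.Coorientation) (nu : M.BdryOrientation)
    (C : B.Region) : (o.mawDualGraph nu).outgoing C =
      ∑ t ∈ B.sheets.star ∅, if B.cut.InPiece C (o.back t) then B.mawWeight nu t else 0 := by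
  have h1 : (o.mawDualGraph nu).outgoing C = ∑ s with o.backRegion s = C,
      ∑ t ∈ B.sheets.star ∅, if B.sheets.InPiece s t then B.mawWeight nu t else 0 :=
    Finset.sum_congr rfl fun s _ => mawEulerChar_eq_sum s
  rw [h1, Finset.sum_comm]
  refine Finset.sum_congr rfl fun t ht => ?_
  have ht : t ∈ B.tri := (Gluing.mem_star.1 ht).1
  have hb : o.backRegion (B.sheets.piece t ht) = C ↔ B.cut.InPiece C (o.back t) := by
    rw [Gluing.inPiece_iff (o.back_mem t ht).1, eq_comm]
    rfl
  simp only [Gluing.inPiece_iff (G := B.sheets) ht]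
  rw [Finset.sum_ite_eq']
  simp [hb]

theorem cellSize_triangle [Fintype V] {σ t : Finset V} (hσ : 3 ≤ σ.card) (ht : t ∈ B.tri)
    (hs : σ ⊆ t) : B.sheets.cellSize σ t = o.plusGluing.cellSize σ t := by
  classical
  have huniq : ∀ t' ∈ B.tri, σ ⊆ t' → t' = σ := fun t' ht' hs' =>
    (Finset.eq_of_subset_of_card_le hs' (by rw [card_tri ht']; exact hσ)).symm
  have hstar : o.plusGluing.star σ = B.sheets.star σ := rfl
  rw [Gluing.cellSize, Gluing.cellSize, hstar]
  congr 1
  refine Finset.filter_congr fun t' ht' => ?_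
  rw [Gluing.mem_star] at ht'
  rw [huniq t ht hs, huniq t' ht'.1 ht'.2]
  exact iff_of_true (Gluing.SameCell.refl _ _) (Gluing.SameCell.refl _ _)

theorem inPiece_back_iff_of_adj {C : B.Region} (t t' : Finset V) (_ : t ∈ B.tri) (_ : t' ∈ B.tri)
    (h : o.plusGluing.adj t t') : B.cut.InPiece C (o.back t) ↔ B.cut.InPiece C (o.back t') :=
  h.2.inPiece_iff C

open Classical in
theorem sum_vertices_branchEdges [Fintype V] (p : Finset V → Prop) :
    ∑ v, ∑ e with v ∈ e, (if IsBranchEdge B.tri e ∧ p e then (1 : ℚ) else 0) =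
      2 * ∑ e with e.card = 2, if IsBranchEdge B.tri e ∧ p e then 1 else 0 := by
  rw [Finset.sum_comm' (t' := Finset.univ) (s' := fun e => e) (by simp), Finset.mul_sum,
    Finset.sum_filter]
  refine Finset.sum_congr rfl fun e _ => ?_
  rw [Finset.sum_const, nsmul_eq_mul]
  by_cases h : e.card = 2
  · simp [h]
  · have : ¬ IsBranchEdge B.tri e := fun h' => h h'.1
    simp [h, this]

open Classical in
theorem outgoing_eq [Fintype V] (o : B.Coorientation) (nu : M.BdryOrientation) (C : B.Region)
    (hC : IsPLBall 2 (o.plusBoundary C).barycentric) :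
    (o.mawDualGraph nu).outgoing C =
      1 - 1 / 2 * ∑ v, if o.IsInwardCusp nu C v then 1 else 0 := by
  have h1 : ((o.plusBoundary C).eulerChar : ℚ) = 1 := by
    exact_mod_cast Gluing.eulerChar_eq_one_of_isPLBall hC
  rw [Gluing.eulerChar_restrict (G := o.plusGluing) (G' := o.plusBoundary C)
    (p := fun t => B.cut.InPiece C (o.back t)) (fun _ => Iff.rfl) (fun _ _ => Iff.rfl)
    inPiece_back_iff_of_adj] at h1
  let pI : Finset V → ℚ := fun t => if B.cut.InPiece C (o.back t) then 1 else 0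
  have hplus : ∑ σ with σ.Nonempty, ∑ t ∈ o.plusGluing.star σ,
      (-1) ^ (σ.card + 1) * (pI t / o.plusGluing.cellSize σ t) = 1 := by
    refine Eq.trans ?_ h1
    rw [← Gluing.sum_flags_comm]
    refine Finset.sum_congr rfl fun t _ => ?_
    by_cases h : B.cut.InPiece C (o.back t)
    · simp [h, pI, div_eq_mul_inv]
    · simp [h, pI]
  have hout : (o.mawDualGraph nu).outgoing C = ∑ σ with σ.Nonempty, ∑ t ∈ B.sheets.star σ,
        (-1) ^ (σ.card + 1) * (pI t / B.sheets.cellSize σ t) -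
      1 / 2 * ∑ v, ∑ t ∈ B.sheets.star {v},
        pI t * ((if B.DoubleCornerAt nu v t then (1 : ℚ) else 0) / B.sheets.cellSize {v} t) := by
    rw [outgoing_eq_sum, ← Gluing.sum_flags_comm, ← Gluing.sum_vertices_comm, Finset.mul_sum,
      ← Finset.sum_sub_distrib]
    refine Finset.sum_congr rfl fun t _ => ?_
    by_cases h : B.cut.InPiece C (o.back t)
    · simp [h, pI, mawWeight, div_eq_mul_inv]
    · simp [h, pI]
  have hX := Gluing.sum_nonempty_of_card_le_two
    (fun σ : Finset V => ∑ t ∈ B.sheets.star σ,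
        (-1) ^ (σ.card + 1) * (pI t / B.sheets.cellSize σ t) -
      ∑ t ∈ o.plusGluing.star σ, (-1) ^ (σ.card + 1) * (pI t / o.plusGluing.cellSize σ t)) (by
      intro σ hσ
      rw [sub_eq_zero]
      refine Finset.sum_congr rfl fun t ht => ?_
      rw [Gluing.mem_star] at ht
      rw [cellSize_triangle hσ ht.1 ht.2])
  rw [Finset.sum_sub_distrib, hplus] at hX
  have hedge : ∀ e ∈ Finset.univ.filter (fun e : Finset V => e.card = 2),
      ∑ t ∈ B.sheets.star e, (-1) ^ (e.card + 1) * (pI t / B.sheets.cellSize e t) -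
      ∑ t ∈ o.plusGluing.star e, (-1) ^ (e.card + 1) * (pI t / o.plusGluing.cellSize e t) =
      - if IsBranchEdge B.tri e ∧ B.cut.InPiece C (o.back (B.maw e)) then (1 : ℚ) else 0 := by
    intro e he
    have he := (Finset.mem_filter.1 he).2
    rw [← sum_edge (o := o) he (fun t => B.cut.InPiece C (o.back t)) inPiece_back_iff_of_adj,
      ← Finset.mul_sum, ← Finset.mul_sum, he]
    ring
  have hvert : ∀ v : V,
      ∑ t ∈ B.sheets.star {v}, (-1) ^ (({v} : Finset V).card + 1) *
        (pI t / B.sheets.cellSize {v} t) -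
      ∑ t ∈ o.plusGluing.star {v}, (-1) ^ (({v} : Finset V).card + 1) *
        (pI t / o.plusGluing.cellSize {v} t) =
      1 / 2 * ∑ t ∈ B.sheets.star {v},
        pI t * ((if B.DoubleCornerAt nu v t then (1 : ℚ) else 0) / B.sheets.cellSize {v} t) +
      1 / 2 * ∑ e with v ∈ e,
        (if IsBranchEdge B.tri e ∧ B.cut.InPiece C (o.back (B.maw e)) then (1 : ℚ) else 0) -
      1 / 2 * if o.IsInwardCusp nu C v then 1 else 0 := by
    intro v
    have h := o.vertexFormula nu C v
    rw [VertexFormula] at h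
    have h2 : ∑ t ∈ B.sheets.star {v}, (if B.cut.InPiece C (o.back t) then
        1 - (if B.DoubleCornerAt nu v t then (1 / 2 : ℚ) else 0) else 0) /
          B.sheets.cellSize {v} t =
        ∑ t ∈ B.sheets.star {v}, (pI t / B.sheets.cellSize {v} t) - 1 / 2 *
          ∑ t ∈ B.sheets.star {v},
          pI t * ((if B.DoubleCornerAt nu v t then (1 : ℚ) else 0) / B.sheets.cellSize {v} t) := by
      rw [Finset.mul_sum, ← Finset.sum_sub_distrib]
      refine Finset.sum_congr rfl fun t _ => ?_
      by_cases h3 : B.cut.InPiece C (o.back t) <;> by_cases h4 : B.DoubleCornerAt nu v t <;>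
        simp [h3, h4, pI]
      ring
    rw [h2] at h
    simp only [Finset.card_singleton, Nat.reduceAdd, even_two, Even.neg_pow, one_pow, one_mul]
    change _ - ∑ t ∈ o.plusGluing.star {v}, pI t / (o.plusGluing.cellSize {v} t : ℚ) = _ at h
    linarith
  rw [Finset.sum_congr rfl hedge, Finset.sum_congr rfl fun v _ => hvert v, Finset.sum_sub_distrib,
    Finset.sum_add_distrib, ← Finset.mul_sum, ← Finset.mul_sum, ← Finset.mul_sum,
    sum_vertices_branchEdges (fun e => B.cut.InPiece C (o.back (B.maw e))),
    Finset.sum_neg_distrib] at hX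
  rw [hout]
  linarith

theorem incoming_eq_outgoing_reverse [Finite V] (o : B.Coorientation) (nu : M.BdryOrientation)
    (C : B.Region) : (o.mawDualGraph nu).incoming C = (o.reverse.mawDualGraph nu).outgoing C :=
  rfl

theorem isInwardCusp_reverse_iff (C : B.Region) (v : V) :
    o.reverse.IsInwardCusp nu C v ↔ o.IsInwardCusp nu C v := by
  constructor
  · rintro ⟨h1, h2, e, u, l, hv, h, hC⟩
    have h' : o.UpperLower e l u := h.reverse
    exact ⟨h1, h2, e, l, u, hv, h', (h'.between.inPiece_iff C).2 hC⟩
  · rintro ⟨h1, h2, e, u, l, hv, h, hC⟩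
    exact ⟨h1, h2, e, l, u, hv, h.reverse, (h.between.inPiece_iff C).1 hC⟩

open Classical in
theorem incoming_eq [Fintype V] (o : B.Coorientation) (nu : M.BdryOrientation) (C : B.Region)
    (hC : IsPLBall 2 (o.minusBoundary C).barycentric) :
    (o.mawDualGraph nu).incoming C =
      1 - 1 / 2 * ∑ v, if o.IsInwardCusp nu C v then 1 else 0 := by
  rw [incoming_eq_outgoing_reverse, outgoing_eq o.reverse nu C hC]
  simp only [isInwardCusp_reverse_iff]

end Coorientation

end BranchedSurface

theorem WeightedGraph.boundary_apply {Vertex Edge : Type*} [Fintype Edge]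
    (Γ : WeightedGraph Vertex Edge) (v : Vertex) :
    Γ.boundary v = Γ.incoming v - Γ.outgoing v := by
  classical
  rw [boundary, incoming, outgoing, Finset.sum_filter, Finset.sum_filter,
    ← Finset.sum_sub_distrib, Finsupp.finsetSum_apply]
  refine Finset.sum_congr rfl fun e _ => ?_
  simp only [Finsupp.smul_apply, Finsupp.sub_apply, Finsupp.single_apply, smul_eq_mul]
  by_cases h1 : Γ.target e = v <;> by_cases h2 : Γ.source e = v <;> simp [h1, h2]

end MawGraph

end

theorem mainTheorem7 {V : Type*} [Finite V] [DecidableEq V] (M : MawGraph.ThreeManifold V)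
    (n : M.BdryOrientation) (B : MawGraph.BranchedSurface M) (o : B.Coorientation)
    (hB : ∀ C : B.Region, o.IsProductBall C) :
    (o.mawDualGraph n).IsCycle ∧
    (∀ C : B.Region, (o.mawDualGraph n).incoming C = (o.mawDualGraph n).outgoing C) ∧
    (∀ C : B.Region,
      (∀ τ : Finset V, B.cut.InPiece C τ → ∀ v ∈ τ, M.IsBdry {v} → n.outward v) →
      (o.mawDualGraph n).incoming C = 1 ∧ (o.mawDualGraph n).outgoing C = 1) := by
  classical
  have := Fintype.ofFinite V
  have hin := fun C => o.incoming_eq n C (hB C).2.2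
  have hout := fun C => o.outgoing_eq n C (hB C).2.1
  have heq : ∀ C : B.Region, (o.mawDualGraph n).incoming C = (o.mawDualGraph n).outgoing C :=
    fun C => (hin C).trans (hout C).symm
  refine ⟨⟨fun s => MawGraph.BranchedSurface.exists_mawEulerChar_eq s, ?_⟩, heq, fun C hC => ?_⟩
  · ext C
    rw [MawGraph.WeightedGraph.boundary_apply, heq, sub_self, Finsupp.zero_apply]
  · have hcusp : ∀ v, ¬ o.IsInwardCusp n C v := by
      rintro v ⟨hb, hn, e, u, l, hv, h, hu⟩
      exact hn (hC _ hu v ((o.back_mem u h.upper_mem.1).2 (h.upper_mem.2 hv)) hb)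
    rw [heq, and_self, hout]
    simp [hcusp]
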